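/- Let $\frac12<H<1$, let $B^H=\{B^H_t,\ t\in[0,1]\}$ be a fractional Brownian motion with Hurst parameter $H$, that is, a centered Gaussian process with covariance $R_H(t,s)=\frac12\left(t^{2H}+s^{2H}-|t-s|^{2H}\right)$, on a probability space $(\Omega,\mathcal F,P)$ where $\mathcal F$ is the $P$-completion of the $\sigma$-field generated by $B^H$. Let $\mathfrak H$ be the Hilbert space obtained by completing the step functions on $[0,1]$ for the scalar product $\langle \mathbf 1_{[0,t]},\mathbf 1_{[0,s]}\rangle_{\mathfrak H}=R_H(t,s)$; a function $f\in L^1([0,1])$ is identified with the element $h$ of $\mathfrak H$ (if there is one) such that $\langle h,\mathbf 1_{[0,t]}\rangle_{\mathfrak H}=H(2H-1)\int_0^1\int_0^t f(s)|s-r|^{2H-2}\,dr\,ds$ for all $t\in[0,1]$. Let $D$ be the Malliavin derivative with respect to $B^H$, let $\mathbb D^{1,2}$ be the closure of the smooth cylindrical random variables $f(B^H_{t_1},\dots,B^H_{t_d})$, $f\in C_b^\infty(\mathbb R^d)$, for the norm $\|F\|_{1,2}=\left(E[F^2]+E\|DF\|_{\mathfrak H}^2\right)^{1/2}$, and let the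 Skorohod integral $\int_0^1 v_t\,\delta B^H_t=\delta(v)$ be the divergence (the adjoint of $D$) of $v$. Let $\phi_n$, $n\ge 1$, be nonnegative, bounded, measurable functions on $[0,1]$ such that (h3) for every $\delta\in[0,1)$, $\left(\sup_{0\le t\le\delta}\phi_n(t)\right)\left(\sup_{0\le t\le 1}\phi_n(t)\right)\to 0$ as $n\to\infty$; (h4) $\|\phi_n\|_{\mathfrak H}^2\to L$ as $n\to\infty$, for some $L>0$; (h5) $\|\phi_n\|_{L^r([0,1])}\to 0$ as $n\to\infty$, for some $0<r<\frac1H$. Let $u=\{u_t,\ t\in[0,1]\}$ be a (jointly measurable) stochastic process such that (i) $u_t\in\mathbb D^{1,2}$ for every $t\in[0,1]$, and the function $t\mapsto\|u_t\|_{1,2}$ belongs to $\mathfrak H$; (ii) $\|u_t-u_1\|_{1,2}\to 0$ as $t\to 1$; (iii) $Du_1$ is given by a jointly measurable process $(D_su_1)_{s\in[0,1]}$ with $\int_0^1\left(E|D_su_1|\right)^p ds<\infty$, where $0<p<\infty$ and $\frac1p+\frac1r=2H$ with the $r$ of (h5). Then, for every $n$, the process $(\phi_n(t)u_t)_{t\in[0,1]}$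 belongs to the domain of $\delta$, and the Skorohod integrals $F_n=\int_0^1\phi_n(t)u_t\,\delta B^H_t$ converge stably, as $n\to\infty$, to $\sqrt L\,u_1Z$, where $Z$ is an $N(0,1)$ random variable, defined on an extension $(\Omega',\mathcal F',P')$ of the probability space, that is independent of $B^H$. That is, $E\left[Ye^{i\lambda F_n}\right]\to E'\left[Ye^{i\lambda\sqrt L\,u_1Z}\right]$ for every $\lambda\in\mathbb R$ and every bounded $\mathcal F$-measurable random variable $Y$. -/

import Mathlib

open MeasureTheory ProbabilityTheory Filter Topology Set
open scoped ENNReal unitInterval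

noncomputable section

namespace FracBM

/-! ### The covariance of fractional Brownian motion -/

/-- `R_H(t,s) = (t^{2H} + s^{2H} - |t-s|^{2H}) / 2` for `s, t ∈ [0,1]`. -/
def cov (H : ℝ) (t s : I) : ℝ :=
  ((t : ℝ) ^ (2 * H) + (s : ℝ) ^ (2 * H) - |(t : ℝ) - s| ^ (2 * H)) / 2

/-- `α_H = H (2H - 1)`. -/
def alpha (H : ℝ) : ℝ := H * (2 * H - 1)

/-! `R_H` is positive semidefinite. This is what makes the scalar product below one; it follows
from `a^{2H} = c ∫_0^∞ (1 - cos (a x)) x^{-1-2H} dx`. -/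

theorem integrableOn_kernel {H : ℝ} (h0 : 0 < H) (h1 : H < 1) :
    IntegrableOn (fun x : ℝ => (1 - Real.cos x) * x ^ (-1 - 2 * H)) (Ioi 0) := by
  have hm : ∀ s : Set ℝ, AEStronglyMeasurable
      (fun x : ℝ => (1 - Real.cos x) * x ^ (-1 - 2 * H)) (volume.restrict s) := fun s =>
    ((measurable_const.sub Real.measurable_cos).mul
      (measurable_id.pow_const _)).aestronglyMeasurable
  rw [← Ioc_union_Ioi_eq_Ioi (zero_le_one : (0 : ℝ) ≤ 1)]
  refine IntegrableOn.union ?_ ?_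
  · have hi : IntegrableOn (fun x : ℝ => x ^ (1 - 2 * H)) (Ioc 0 1) :=
      (intervalIntegrable_iff_integrableOn_Ioc_of_le zero_le_one).1
        (intervalIntegral.intervalIntegrable_rpow' (by linarith))
    refine Integrable.mono' hi (hm _) ?_
    refine (ae_restrict_iff' measurableSet_Ioc).2 (Eventually.of_forall fun x hx => ?_)
    have hx0 : 0 < x := hx.1
    have hp : 0 < x ^ (-1 - 2 * H) := Real.rpow_pos_of_pos hx0 _
    have hc : 0 ≤ 1 - Real.cos x := by linarith [Real.cos_le_one x]
    rw [Real.norm_of_nonneg (mul_nonneg hc hp.le)]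
    have he : x ^ (1 - 2 * H) = x ^ (2 : ℝ) * x ^ (-1 - 2 * H) := by
      rw [← Real.rpow_add hx0]; congr 1; ring
    rw [he, Real.rpow_two]
    refine mul_le_mul_of_nonneg_right ?_ hp.le
    nlinarith [Real.one_sub_sq_div_two_le_cos (x := x), sq_nonneg x]
  · have hi : IntegrableOn (fun x : ℝ => 2 * x ^ (-1 - 2 * H)) (Ioi 1) :=
      (integrableOn_Ioi_rpow_of_lt (by linarith) zero_lt_one).const_mul 2
    refine Integrable.mono' hi (hm _) ?_
    refine (ae_restrict_iff' measurableSet_Ioi).2 (Eventually.of_forall fun x hx => ?_)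
    have hx0 : 0 < x := lt_trans zero_lt_one hx
    have hp : 0 < x ^ (-1 - 2 * H) := Real.rpow_pos_of_pos hx0 _
    have hc : 0 ≤ 1 - Real.cos x := by linarith [Real.cos_le_one x]
    rw [Real.norm_of_nonneg (mul_nonneg hc hp.le)]
    exact mul_le_mul_of_nonneg_right (by linarith [Real.neg_one_le_cos x]) hp.le

theorem kernel_pos {H : ℝ} (h0 : 0 < H) (h1 : H < 1) :
    0 < ∫ x in Ioi (0 : ℝ), (1 - Real.cos x) * x ^ (-1 - 2 * H) := by
  have hpos : ∀ x ∈ Ioo (0 : ℝ) 1, 0 < (1 - Real.cos x) * x ^ (-1 - 2 * H) := fun x hx => by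
    have : Real.cos x < 1 := by
      have := Real.cos_lt_cos_of_nonneg_of_le_pi le_rfl
        (by linarith [hx.2, Real.pi_gt_three]) hx.1
      simpa using this
    exact mul_pos (by linarith) (Real.rpow_pos_of_pos hx.1 _)
  have hnn : ∀ x ∈ Ioi (0 : ℝ), 0 ≤ (1 - Real.cos x) * x ^ (-1 - 2 * H) := fun x hx =>
    mul_nonneg (by linarith [Real.cos_le_one x]) (Real.rpow_pos_of_pos hx _).le
  rw [setIntegral_pos_iff_support_of_nonneg_ae
    ((ae_restrict_iff' measurableSet_Ioi).2 (Eventually.of_forall hnn))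
    (integrableOn_kernel h0 h1)]
  refine lt_of_lt_of_le (b := volume (Ioo (0 : ℝ) 1)) (by simp) (measure_mono fun x hx => ?_)
  exact ⟨(hpos x hx).ne', hx.1⟩

theorem kernel_scale {H : ℝ} (h0 : 0 < H) (h1 : H < 1) {a : ℝ} (ha : 0 ≤ a) :
    IntegrableOn (fun x : ℝ => (1 - Real.cos (a * x)) * x ^ (-1 - 2 * H)) (Ioi 0) ∧
    ∫ x in Ioi (0 : ℝ), (1 - Real.cos (a * x)) * x ^ (-1 - 2 * H) =
      a ^ (2 * H) * ∫ x in Ioi (0 : ℝ), (1 - Real.cos x) * x ^ (-1 - 2 * H) := by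
  rcases ha.eq_or_lt with rfl | ha
  · simp [Real.zero_rpow (by linarith : 2 * H ≠ 0)]
  have key : ∀ x ∈ Ioi (0 : ℝ), (1 - Real.cos (a * x)) * x ^ (-1 - 2 * H) =
      a ^ (1 + 2 * H) * ((1 - Real.cos (a * x)) * (a * x) ^ (-1 - 2 * H)) := fun x hx => by
    rw [Real.mul_rpow ha.le (le_of_lt hx)]
    have : a ^ (1 + 2 * H) * a ^ (-1 - 2 * H) = 1 := by
      rw [← Real.rpow_add ha]; simp
    linear_combination (-(1 - Real.cos (a * x)) * x ^ (-1 - 2 * H)) * this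
  constructor
  · rw [integrableOn_congr_fun key measurableSet_Ioi]
    have := (integrableOn_Ioi_comp_mul_left_iff
      (fun x : ℝ => (1 - Real.cos x) * x ^ (-1 - 2 * H)) 0 ha).2
      (by simpa using integrableOn_kernel h0 h1)
    exact this.const_mul _
  · rw [setIntegral_congr_fun measurableSet_Ioi key, integral_const_mul,
      integral_comp_mul_left_Ioi (fun x : ℝ => (1 - Real.cos x) * x ^ (-1 - 2 * H)) 0 ha,
      mul_zero, smul_eq_mul, ← mul_assoc, ← Real.rpow_neg_one a, ← Real.rpow_add ha]
    congr 2
    ring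

theorem cov_posSemidef {H : ℝ} (h0 : 0 < H) (h1 : H < 1) (s : Finset I) (a : I → ℝ) :
    0 ≤ ∑ i ∈ s, ∑ j ∈ s, a i * a j * cov H i j := by
  set w : ℝ → ℝ := fun x => x ^ (-1 - 2 * H) with hw
  set C := ∫ x in Ioi (0 : ℝ), (1 - Real.cos x) * x ^ (-1 - 2 * H) with hC
  have hCpos : 0 < C := kernel_pos h0 h1
  set g : I → I → ℝ → ℝ := fun i j x =>
    (1 - Real.cos ((i : ℝ) * x)) * w x + (1 - Real.cos ((j : ℝ) * x)) * w x
      - (1 - Real.cos (|(i : ℝ) - j| * x)) * w x with hg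
  have hgi : ∀ i j, IntegrableOn (g i j) (Ioi 0) := fun i j =>
    ((kernel_scale h0 h1 i.2.1).1.add (kernel_scale h0 h1 j.2.1).1).sub
      (kernel_scale h0 h1 (abs_nonneg _)).1
  have hgint : ∀ i j, ∫ x in Ioi (0 : ℝ), g i j x = 2 * C * cov H i j := fun i j => by
    have e1 := kernel_scale h0 h1 i.2.1
    have e2 := kernel_scale h0 h1 j.2.1
    have e3 := kernel_scale h0 h1 (abs_nonneg ((i : ℝ) - j))
    have : ∫ x in Ioi (0 : ℝ), g i j x = (i : ℝ) ^ (2 * H) * C + (j : ℝ) ^ (2 * H) * C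
        - |(i : ℝ) - j| ^ (2 * H) * C := by
      rw [← e1.2, ← e2.2, ← e3.2, ← integral_add e1.1 e2.1]
      exact integral_sub (e1.1.add e2.1) e3.1
    rw [this, cov]; ring
  have hsum : 2 * C * ∑ i ∈ s, ∑ j ∈ s, a i * a j * cov H i j =
      ∫ x in Ioi (0 : ℝ), ∑ i ∈ s, ∑ j ∈ s, a i * a j * g i j x := by
    rw [integral_finsetSum s fun i _ => integrable_finsetSum s fun j _ => (hgi i j).const_mul _,
      Finset.mul_sum]
    refine Finset.sum_congr rfl fun i _ => ?_
    rw [integral_finsetSum s fun j _ => (hgi i j).const_mul _, Finset.mul_sum]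
    refine Finset.sum_congr rfl fun j _ => ?_
    rw [integral_const_mul, hgint]; ring
  have hpt : ∀ x ∈ Ioi (0 : ℝ), 0 ≤ ∑ i ∈ s, ∑ j ∈ s, a i * a j * g i j x := fun x hx => by
    have : ∑ i ∈ s, ∑ j ∈ s, a i * a j * g i j x =
        ((∑ i ∈ s, a i * (1 - Real.cos ((i : ℝ) * x))) ^ 2
          + (∑ i ∈ s, a i * Real.sin ((i : ℝ) * x)) ^ 2) * w x := by
      rw [sq, sq, Finset.sum_mul_sum, Finset.sum_mul_sum, ← Finset.sum_add_distrib, Finset.sum_mul]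
      refine Finset.sum_congr rfl fun i _ => ?_
      rw [← Finset.sum_add_distrib, Finset.sum_mul]
      refine Finset.sum_congr rfl fun j _ => ?_
      have hcos : Real.cos (|(i : ℝ) - j| * x) = Real.cos ((i : ℝ) * x) * Real.cos ((j : ℝ) * x)
          + Real.sin ((i : ℝ) * x) * Real.sin ((j : ℝ) * x) := by
        rw [← Real.cos_sub, ← sub_mul]
        rcases abs_choice ((i : ℝ) - j) with h | h <;> rw [h]
        rw [neg_mul, Real.cos_neg]
      simp only [hg, hcos]
      ring
    rw [this]
    exact mul_nonneg (by positivity) (Real.rpow_pos_of_pos hx _).le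
  have : 0 ≤ 2 * C * ∑ i ∈ s, ∑ j ∈ s, a i * a j * cov H i j := by
    rw [hsum]; exact setIntegral_nonneg measurableSet_Ioi hpt
  exact nonneg_of_mul_nonneg_right this (by positivity)

/-! ### The Hilbert space `𝔥` -/

/-- Step functions on `[0,1]`: the finitely supported `f` stands for
`∑ t, f t • 𝟙_{[0,t]}`. -/
def StepFun (H : ℝ) (_hH : H ∈ Ioo (1 / 2 : ℝ) 1) : Type := I →₀ ℝ

variable {H : ℝ} {hH : H ∈ Ioo (1 / 2 : ℝ) 1}

instance : AddCommGroup (StepFun H hH) := inferInstanceAs (AddCommGroup (I →₀ ℝ))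

instance : Module ℝ (StepFun H hH) := inferInstanceAs (Module ℝ (I →₀ ℝ))

/-- The bilinear extension of `⟨𝟙_{[0,t]}, 𝟙_{[0,s]}⟩ = R_H(t,s)` to step functions. -/
def stepInner (H : ℝ) (f g : I →₀ ℝ) : ℝ := f.sum fun t a => g.sum fun s b => a * b * cov H t s

theorem cov_comm (H : ℝ) (t s : I) : cov H t s = cov H s t := by
  rw [cov, cov, abs_sub_comm, add_comm ((t : ℝ) ^ (2 * H))]

theorem stepInner_comm (H : ℝ) (f g : I →₀ ℝ) : stepInner H g f = stepInner H f g := by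
  unfold stepInner
  rw [Finsupp.sum_comm]
  refine Finsupp.sum_congr fun t _ => Finsupp.sum_congr fun s _ => ?_
  rw [cov_comm]; ring

theorem stepInner_add (H : ℝ) (f g k : I →₀ ℝ) :
    stepInner H (f + g) k = stepInner H f k + stepInner H g k := by
  unfold stepInner
  refine Finsupp.sum_add_index' (fun t => by simp [Finsupp.sum]) fun t a b => ?_
  rw [← Finsupp.sum_add]
  exact Finsupp.sum_congr fun s _ => by ring

theorem stepInner_smul (H c : ℝ) (f g : I →₀ ℝ) :
    stepInner H (c • f) g = c * stepInner H f g := by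
  unfold stepInner
  rw [Finsupp.sum_smul_index' (fun t => by simp [Finsupp.sum]), Finsupp.mul_sum]
  refine Finsupp.sum_congr fun t _ => ?_
  rw [Finsupp.mul_sum]
  exact Finsupp.sum_congr fun s _ => by simp only [smul_eq_mul]; ring

/-- The (semidefinite) scalar product on step functions. -/
instance stepCore : PreInnerProductSpace.Core ℝ (StepFun H hH) where
  inner f g := stepInner H f g
  conj_inner_symm f g := stepInner_comm H f g
  re_inner_nonneg f := cov_posSemidef (by linarith [hH.1]) hH.2 (Finsupp.support f) (Finsupp.toFun f)
  add_left f g k := stepInner_add H f g k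
  smul_left f g c := stepInner_smul H c f g

instance : SeminormedAddCommGroup (StepFun H hH) :=
  InnerProductSpace.Core.toSeminormedAddCommGroup (𝕜 := ℝ)

instance : InnerProductSpace ℝ (StepFun H hH) := InnerProductSpace.ofCore stepCore

/-- The Hilbert space `𝔥`: the completion of the step functions. -/
abbrev Hsp (H : ℝ) (hH : H ∈ Ioo (1 / 2 : ℝ) 1) : Type := UniformSpace.Completion (StepFun H hH)

/-- The element `𝟙_{[0,t]}` of `𝔥`. -/
def ind (hH : H ∈ Ioo (1 / 2 : ℝ) 1) (t : I) : Hsp H hH :=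
  UniformSpace.Completion.coe' (show StepFun H hH from Finsupp.single (M := ℝ) t 1)

/-- The integrable function `f` on `[0,1]` and the element `h` of `𝔥` are the same: their scalar
products with every `𝟙_{[0,t]}`, which for `f` is
`α_H ∫_0^1 ∫_0^t f(s) |s-r|^{2H-2} dr ds`, agree. At most one `h` fits a given `f`, since the
`𝟙_{[0,t]}` span a dense subspace. -/
def Represents (hH : H ∈ Ioo (1 / 2 : ℝ) 1) (f : I → ℝ) (h : Hsp H hH) : Prop :=
  Integrable f ∧ ∀ t : I, inner ℝ h (ind hH t) =
    alpha H * ∫ s : I, ∫ r in Iic t, f s * |(s : ℝ) - r| ^ (2 * H - 2)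

/-- The function `f` belongs to `𝔥`. -/
def MemHsp (hH : H ∈ Ioo (1 / 2 : ℝ) 1) (f : I → ℝ) : Prop := ∃ h : Hsp H hH, Represents hH f h

open Classical in
/-- A function that belongs to `𝔥`, as an element of `𝔥` (and `0` for the other functions). -/
def toHsp (hH : H ∈ Ioo (1 / 2 : ℝ) 1) (f : I → ℝ) : Hsp H hH :=
  if h : MemHsp hH f then h.choose else 0

/-! ### Fractional Brownian motion and Malliavin calculus -/

variable {Ω : Type*} [MeasurableSpace Ω]

/-- `B` is a fractional Brownian motion on `[0,1]` with Hurst parameter `H`. -/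
structure IsFBM (H : ℝ) (B : I → Ω → ℝ) (P : Measure Ω) : Prop where
  measurable : ∀ t, Measurable (B t)
  gaussian : IsGaussianProcess B P
  mean_zero : ∀ t, ∫ ω, B t ω ∂P = 0
  covariance : ∀ t s, ∫ ω, B t ω * B s ω ∂P = cov H t s

/-- The `σ`-field of `Ω` is, up to `P`-null sets, the one generated by `B`. (The completion of
the `σ`-field generated by `B` has this property.) -/
def GeneratedBy (B : I → Ω → ℝ) (P : Measure Ω) : Prop :=
  ∀ A : Set Ω, MeasurableSet A →
    ∃ A' : Set Ω, MeasurableSet[⨆ t, (borel ℝ).comap (B t)] A' ∧ A =ᵐ[P] A'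

/-- `F = f(B_{t_1}, …, B_{t_d})` with `f ∈ C_b^∞(ℝ^d)` is a smooth and cylindrical random
variable, and `DF = ∑ i, ∂_i f(B_{t_1}, …, B_{t_d}) 𝟙_{[0,t_i]}`. -/
def IsSmoothCyl (hH : H ∈ Ioo (1 / 2 : ℝ) 1) (B : I → Ω → ℝ) (F : Ω → ℝ)
    (DF : Ω → Hsp H hH) : Prop :=
  ∃ (d : ℕ) (t : Fin d → I) (f : (Fin d → ℝ) → ℝ),
    ContDiff ℝ (⊤ : ℕ∞) f ∧ (∀ k : ℕ, ∃ C : ℝ, ∀ x, ‖iteratedFDeriv ℝ k f x‖ ≤ C) ∧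
    (F = fun ω => f fun i => B (t i) ω) ∧
    DF = fun ω => ∑ i, fderiv ℝ f (fun j => B (t j) ω) (Pi.single i 1) • ind hH (t i)

/-- `F ∈ 𝔻^{1,2}`, with Malliavin derivative `DF`: the pair is a limit in
`L²(Ω) × L²(Ω; 𝔥)` of smooth and cylindrical random variables and their derivatives. -/
def HasMalliavinDeriv (hH : H ∈ Ioo (1 / 2 : ℝ) 1) (B : I → Ω → ℝ) (P : Measure Ω) (F : Ω → ℝ)
    (DF : Ω → Hsp H hH) : Prop :=
  MemLp F 2 P ∧ MemLp DF 2 P ∧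
  ∃ (G : ℕ → Ω → ℝ) (DG : ℕ → Ω → Hsp H hH),
    (∀ k, IsSmoothCyl hH B (G k) (DG k)) ∧
    Tendsto (fun k => eLpNorm (G k - F) 2 P) atTop (𝓝 0) ∧
    Tendsto (fun k => eLpNorm (DG k - DF) 2 P) atTop (𝓝 0)

/-- The norm `‖F‖_{1,2} = (E|F|² + E‖DF‖²)^{1/2}`, where `DF` is the Malliavin derivative
of `F`. -/
def norm12 (P : Measure Ω) (F : Ω → ℝ) (DF : Ω → Hsp H hH) : ℝ :=
  √((∫ ω, F ω ^ 2 ∂P) + ∫ ω, ‖DF ω‖ ^ 2 ∂P)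

/-- The `𝔥`-valued random variable `V ∈ L²(Ω; 𝔥)` belongs to the domain of the divergence
operator, and `δ(V) = F`: the variable `F` is in `L²(Ω)` and `E[G F] = E⟨DG, V⟩` for every
`G ∈ 𝔻^{1,2}`. (By the Riesz theorem such an `F` exists if and only if
`|E⟨DG, V⟩| ≤ c ‖G‖_{L²}` for all `G ∈ 𝔻^{1,2}` and some `c`.) -/
def HasDivergence (hH : H ∈ Ioo (1 / 2 : ℝ) 1) (B : I → Ω → ℝ) (P : Measure Ω)
    (V : Ω → Hsp H hH) (F : Ω → ℝ) : Prop :=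
  MemLp V 2 P ∧ MemLp F 2 P ∧
  ∀ (G : Ω → ℝ) (DG : Ω → Hsp H hH), HasMalliavinDeriv hH B P G DG →
    ∫ ω, G ω * F ω ∂P = ∫ ω, inner ℝ (DG ω) (V ω) ∂P

/-- The process `v` is Skorohod integrable, and `∫_0^1 v_t δB_t = F`: almost every path of `v`
belongs to `𝔥`, and `F` is the divergence of the resulting random element of `𝔥`. -/
def HasSkorohodIntegral (hH : H ∈ Ioo (1 / 2 : ℝ) 1) (B : I → Ω → ℝ) (P : Measure Ω)
    (v : I → Ω → ℝ) (F : Ω → ℝ) : Prop :=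
  (∀ᵐ ω ∂P, MemHsp hH fun t => v t ω) ∧
  HasDivergence hH B P (fun ω => toHsp hH fun t => v t ω) F

/-- The random variables `F n` on `(Ω, P)` converge stably to the random variable `G` on the
extension `(Ω', P')` of `(Ω, P)`, the extension being given by the measure preserving map
`π : Ω' → Ω`. -/
def ConvergesStably {Ω' : Type*} [MeasurableSpace Ω'] (P : Measure Ω) (F : ℕ → Ω → ℝ)
    (P' : Measure Ω') (π : Ω' → Ω) (G : Ω' → ℝ) : Prop :=
  ∀ (lam : ℝ) (Y : Ω → ℝ), Measurable Y → (∃ C, ∀ ω, |Y ω| ≤ C) →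
    Tendsto (fun n => ∫ ω, (Y ω : ℂ) * Complex.exp (Complex.I * (lam * F n ω : ℝ)) ∂P) atTop
      (𝓝 (∫ ω', (Y (π ω') : ℂ) * Complex.exp (Complex.I * (lam * G ω' : ℝ)) ∂P'))

end FracBM

end

/-!
The kernels `φ_n` concentrate at `t = 1`, so the Skorohod integral of `φ_n u` behaves like the
product `u_1 X(φ_n)`, where `X : 𝔥 → L²(Ω)` is the Wiener integral, and `X(φ_n)` is asymptotically
Gaussian and independent of everything.

*The space `𝔥`.* The kernel `α_H |s - t|^{2H-2}` is the Gram kernel `∫ k(x,s) k(x,t) dx` of the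
functions `k(x,s) = feature H x s`. Hence `𝔥` embeds isometrically into `L²(ℝ)` (`embed`), and
`energy H f = α_H ∫∫ f(s) f(t) |s - t|^{2H-2} ds dt`, for `f ≥ 0`, is the squared norm of `f`
in `𝔥`. A function `f` belongs to `𝔥` if `|f|` has finite energy (`FiniteEnergy.memHsp`), and a
nonnegative function that belongs to `𝔥` has finite energy (`Represents.finiteEnergy`).

*The divergence.* For smooth `F_j` and `h_j ∈ 𝔥`, Gaussian integration by parts gives
`E[δ(∑ F_j h_j)²] ≤ ∑ ⟨F_j, F_k⟩_{1,2} ⟨h_j, h_k⟩`. This passes to the closure `𝔻^{1,2}`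
(`divBound_sum`) and, by approximation with simple functions of `t`, to
`E[δ(v)²] ≤ α_H ∫∫ ‖v_s‖_{1,2} ‖v_t‖_{1,2} |s - t|^{2H-2} ds dt` (`divBound_path`). The
approximation needs `t ↦ (u_t, Du_t)` to be measurable as a curve in `L²(Ω) × L²(Ω; 𝔥)`. It is,
because `F` determines `DF`, so that weak measurability of `t ↦ u_t` suffices
(`aestronglyMeasurable_sobolev`). The estimate yields the existence of `δ(φ_n u)` through the Riesz
theorem (`DivBound.exists_hasDivergence`).

*Reduction to a product.* The estimate bounds `E[δ(φ_n (u - u_1))²]` by the energy of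
`φ_n(t) ‖u_t - u_1‖_{1,2}`, which tends to zero (`tendsto_energy_kernel_mul`). If `G` is smooth and
close to `u_1`, then `δ(φ_n u_1)` is close to `δ(φ_n G) = G X(φ_n) - ⟨DG, φ_n⟩`. The kernels tend to
zero weakly in `𝔥` (`tendsto_inner_toHsp_kernel`), which disposes of the last term. Therefore
`δ(φ_n u) - u_1 X(φ_n) → 0` in `L¹(Ω)` (`tendsto_integral_abs_skorohod_sub`).

*The limit.* If `k_n → 0` weakly in `𝔥` and `‖k_n‖² → L`, the Gaussian formula for
`E[e^{i X(h)} e^{i X(k_n)}]` and the totality of the `e^{i X(h)}` in `L²(Ω)` show that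
`E[Y e^{i X(k_n)}] → e^{-L/2} E[Y]` (`tendsto_inner_wcos_wsin`). Approximating `u_1` by random
variables with finitely many values gives `E[Y e^{i λ u_1 X(φ_n)}] → E[Y e^{-λ² L u_1² / 2}]`
(`tendsto_integral_mul_exp_wiener`). The right-hand side is `E[Y e^{i λ √L u_1 Z}]`, since `Z` is
independent of the whole original space (`map_prodMk_eq_prod`).
-/

noncomputable section

namespace FracBM

/-! ### A square root of the kernel `α_H |s - t|^{2H-2}` -/

section

/-- `β = ∫_0^∞ y^{H-3/2} (1+y)^{H-3/2} dy`. -/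
def betaConst (H : ℝ) : ℝ := ∫ y in Ioi (0 : ℝ), y ^ (H - 3 / 2) * (1 + y) ^ (H - 3 / 2)

theorem integrableOn_betaConst {H : ℝ} (hH : H ∈ Ioo (1 / 2 : ℝ) 1) :
    IntegrableOn (fun y : ℝ => y ^ (H - 3 / 2) * (1 + y) ^ (H - 3 / 2)) (Ioi 0) := by
  obtain ⟨h0, h1⟩ := hH
  have hm : ∀ s : Set ℝ, AEStronglyMeasurable
      (fun y : ℝ => y ^ (H - 3 / 2) * (1 + y) ^ (H - 3 / 2)) (volume.restrict s) := fun s =>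
    ((measurable_id.pow_const _).mul
      ((measurable_const.add measurable_id).pow_const _)).aestronglyMeasurable
  rw [← Ioc_union_Ioi_eq_Ioi (zero_le_one : (0 : ℝ) ≤ 1)]
  refine IntegrableOn.union ?_ ?_
  · have hi : IntegrableOn (fun x : ℝ => x ^ (H - 3 / 2)) (Ioc 0 1) :=
      (intervalIntegrable_iff_integrableOn_Ioc_of_le zero_le_one).1
        (intervalIntegral.intervalIntegrable_rpow' (by linarith))
    refine Integrable.mono' hi (hm _) ((ae_restrict_iff' measurableSet_Ioc).2 (.of_forall ?_))
    intro y hy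
    have hy0 : 0 < y := hy.1
    rw [Real.norm_of_nonneg (by positivity)]
    exact mul_le_of_le_one_right (by positivity)
      (Real.rpow_le_one_of_one_le_of_nonpos (by linarith) (by linarith))
  · have hi : IntegrableOn (fun y : ℝ => y ^ (2 * H - 3)) (Ioi 1) :=
      integrableOn_Ioi_rpow_of_lt (by linarith) zero_lt_one
    refine Integrable.mono' hi (hm _) ((ae_restrict_iff' measurableSet_Ioi).2 (.of_forall ?_))
    intro y hy
    have hy0 : 0 < y := lt_trans zero_lt_one hy
    rw [Real.norm_of_nonneg (by positivity),
      show 2 * H - 3 = (H - 3 / 2) + (H - 3 / 2) by ring, Real.rpow_add hy0]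
    exact mul_le_mul_of_nonneg_left
      (Real.rpow_le_rpow_of_nonpos hy0 (by linarith) (by linarith)) (by positivity)

theorem betaConst_pos {H : ℝ} (hH : H ∈ Ioo (1 / 2 : ℝ) 1) : 0 < betaConst H := by
  have hpos : ∀ y ∈ Ioi (0 : ℝ), 0 < y ^ (H - 3 / 2) * (1 + y) ^ (H - 3 / 2) := fun y hy => by
    have : 0 < y := hy
    positivity
  rw [betaConst, setIntegral_pos_iff_support_of_nonneg_ae
    ((ae_restrict_iff' measurableSet_Ioi).2 (.of_forall fun y hy => (hpos y hy).le))
    (integrableOn_betaConst hH)]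
  refine lt_of_lt_of_le (b := volume (Ioi (0 : ℝ))) (by simp) (measure_mono fun y hy => ?_)
  exact ⟨(hpos y hy).ne', hy⟩

theorem alpha_pos {H : ℝ} (hH : H ∈ Ioo (1 / 2 : ℝ) 1) : 0 < alpha H := by
  obtain ⟨h0, h1⟩ := hH
  unfold alpha
  exact mul_pos (by linarith) (by linarith)

/-- The Mandelbrot–Van Ness type kernel, a square root of `α_H |s - t|^{2H-2}`: see
`lintegral_feature_mul`. -/
def feature (H : ℝ) (x : ℝ) (s : I) : ℝ :=
  √(alpha H / betaConst H) * if x < s then ((s : ℝ) - x) ^ (H - 3 / 2) else 0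

theorem feature_nonneg (H x : ℝ) (s : I) : 0 ≤ feature H x s := by
  unfold feature
  split_ifs with h
  · have : 0 < (s : ℝ) - x := by linarith
    positivity
  · simp

theorem measurable_feature (H : ℝ) : Measurable (Function.uncurry (feature H)) := by
  unfold feature Function.uncurry
  refine measurable_const.mul (Measurable.ite ?_ ?_ measurable_const)
  · exact measurableSet_lt measurable_fst (measurable_subtype_coe.comp measurable_snd)
  · exact ((measurable_subtype_coe.comp measurable_snd).sub measurable_fst).pow_const _

theorem lintegral_comp_mul_sub (φ : ℝ → ℝ≥0∞) (hφ : Measurable φ) {c : ℝ} (hc : 0 < c) (s : ℝ) :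
    ∫⁻ x, φ (c * (s - x)) = ENNReal.ofReal c⁻¹ * ∫⁻ x, φ x := by
  rw [lintegral_sub_left_eq_self (fun x => φ (c * x)) s,
    ← lintegral_map hφ (measurable_const_mul c), Real.map_volume_mul_left hc.ne',
    lintegral_smul_measure, abs_of_pos (inv_pos.2 hc), smul_eq_mul]

/-- The Gram identity `∫ k(x,s) k(x,t) dx = α_H |s - t|^{2H-2}` for `s < t`. The substitution
`y = (s - x) / (t - s)` turns the left-hand side into a multiple of the integral `β`. -/
theorem lintegral_feature_mul_of_lt {H : ℝ} (hH : H ∈ Ioo (1 / 2 : ℝ) 1) {s t : I} (hst : s < t) :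
    ∫⁻ x, ENNReal.ofReal (feature H x s) * ENNReal.ofReal (feature H x t) =
      ENNReal.ofReal (alpha H * |(s : ℝ) - t| ^ (2 * H - 2)) := by
  have hd : 0 < (t : ℝ) - s := sub_pos.2 hst
  set φ : ℝ → ℝ≥0∞ := (Ioi (0 : ℝ)).indicator
    fun y => ENNReal.ofReal (y ^ (H - 3 / 2) * (1 + y) ^ (H - 3 / 2)) with hφ
  have hφm : Measurable φ := Measurable.indicator (by fun_prop) measurableSet_Ioi
  have hβ := betaConst_pos hH
  have hα := alpha_pos hH
  have hint : ∫⁻ y, φ y = ENNReal.ofReal (betaConst H) := by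
    rw [hφ, lintegral_indicator measurableSet_Ioi, betaConst,
      ofReal_integral_eq_lintegral_ofReal (integrableOn_betaConst hH)]
    refine (ae_restrict_iff' measurableSet_Ioi).2 (.of_forall fun y hy => ?_)
    have : 0 < y := hy
    simp only [Pi.zero_apply]; positivity
  have key : ∀ x, ENNReal.ofReal (feature H x s) * ENNReal.ofReal (feature H x t) =
      ENNReal.ofReal (alpha H / betaConst H * ((t : ℝ) - s) ^ (2 * H - 3)) *
        φ (((t : ℝ) - s)⁻¹ * (s - x)) := by
    intro x
    rw [← ENNReal.ofReal_mul (feature_nonneg _ _ _)]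
    by_cases hx : x < s
    · have hxt : x < t := lt_trans hx hst
      have hsx : 0 < (s : ℝ) - x := by linarith
      have htx : 0 < (t : ℝ) - x := by linarith
      have hmem : ((t : ℝ) - s)⁻¹ * (s - x) ∈ Ioi (0 : ℝ) := by
        simp only [mem_Ioi]; positivity
      rw [hφ, indicator_of_mem hmem, ← ENNReal.ofReal_mul (by positivity)]
      congr 1
      simp only [feature, if_pos hx, if_pos hxt]
      have e1 : 1 + ((t : ℝ) - s)⁻¹ * (s - x) = ((t : ℝ) - s)⁻¹ * (t - x) := by
        field_simp; ring
      rw [e1, Real.mul_rpow (by positivity) hsx.le, Real.mul_rpow (by positivity) htx.le]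
      have e2 : ((t : ℝ) - s) ^ (2 * H - 3) * ((((t : ℝ) - s)⁻¹) ^ (H - 3 / 2) *
          (((t : ℝ) - s)⁻¹) ^ (H - 3 / 2)) = 1 := by
        rw [Real.inv_rpow hd.le, ← Real.rpow_neg hd.le, ← Real.rpow_add hd, ← Real.rpow_add hd,
          show 2 * H - 3 + (-(H - 3 / 2) + -(H - 3 / 2)) = 0 by ring, Real.rpow_zero]
      have e3 := Real.mul_self_sqrt (show 0 ≤ alpha H / betaConst H by positivity)
      calc _ = (√(alpha H / betaConst H) * √(alpha H / betaConst H)) *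
            (((s : ℝ) - x) ^ (H - 3 / 2) * ((t : ℝ) - x) ^ (H - 3 / 2)) := by ring
        _ = alpha H / betaConst H * (((t : ℝ) - s) ^ (2 * H - 3) *
            ((((t : ℝ) - s)⁻¹) ^ (H - 3 / 2) * (((t : ℝ) - s)⁻¹) ^ (H - 3 / 2))) *
            (((s : ℝ) - x) ^ (H - 3 / 2) * ((t : ℝ) - x) ^ (H - 3 / 2)) := by rw [e3, e2, mul_one]
        _ = _ := by ring
    · have hmem : ((t : ℝ) - s)⁻¹ * (s - x) ∉ Ioi (0 : ℝ) := by
        simp only [mem_Ioi, not_lt]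
        exact mul_nonpos_of_nonneg_of_nonpos (by positivity) (by linarith)
      rw [hφ, indicator_of_notMem hmem]
      simp [feature, if_neg hx]
  simp_rw [key]
  rw [lintegral_const_mul _ (show Measurable fun x : ℝ => φ (((t : ℝ) - s)⁻¹ * (s - x)) from
      hφm.comp (by fun_prop)),
    lintegral_comp_mul_sub φ hφm (inv_pos.2 hd), hint, inv_inv, ← ENNReal.ofReal_mul hd.le,
    ← ENNReal.ofReal_mul (by positivity), abs_sub_comm, abs_of_pos hd]
  congr 1
  have e : ((t : ℝ) - s) ^ (2 * H - 2) = ((t : ℝ) - s) ^ (2 * H - 3) * ((t : ℝ) - s) := by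
    rw [show 2 * H - 2 = (2 * H - 3) + 1 by ring, Real.rpow_add_one hd.ne']
  rw [e]
  field_simp

theorem lintegral_feature_mul {H : ℝ} (hH : H ∈ Ioo (1 / 2 : ℝ) 1) {s t : I} (hst : s ≠ t) :
    ∫⁻ x, ENNReal.ofReal (feature H x s) * ENNReal.ofReal (feature H x t) =
      ENNReal.ofReal (alpha H * |(s : ℝ) - t| ^ (2 * H - 2)) := by
  rcases lt_or_gt_of_ne hst with h | h
  · exact lintegral_feature_mul_of_lt hH h
  · rw [abs_sub_comm, ← lintegral_feature_mul_of_lt hH h]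
    simp_rw [mul_comm]

end

/-! ### The covariance as a double integral -/

section

theorem intervalIntegrable_abs_rpow {q : ℝ} (hq : -1 < q) (a b : ℝ) :
    IntervalIntegrable (fun x : ℝ => |x| ^ q) volume a b := by
  have hpos : ∀ c : ℝ, 0 ≤ c → IntervalIntegrable (fun x : ℝ => |x| ^ q) volume 0 c := by
    intro c hc
    refine (intervalIntegral.intervalIntegrable_rpow' hq).congr fun x hx => ?_
    rw [uIoc_of_le hc] at hx
    simp only [abs_of_pos hx.1]
  have h0 : ∀ c : ℝ, IntervalIntegrable (fun x : ℝ => |x| ^ q) volume 0 c := by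
    intro c
    rcases le_total 0 c with hc | hc
    · exact hpos c hc
    · have := (hpos (-c) (by linarith)).comp_sub_left 0
      simpa using this
  exact (h0 a).symm.trans (h0 b)

theorem continuous_abs_rpow_mul {H : ℝ} (h : 1 / 2 < H) :
    Continuous fun x : ℝ => |x| ^ (2 * H - 2) * x := by
  have h1 : 1 < 2 * H := by linarith
  have hd : deriv (fun x : ℝ => ‖x‖ ^ (2 * H)) = fun x => 2 * H * |x| ^ (2 * H - 2) * x :=
    funext fun x => (hasDerivAt_abs_rpow x h1).deriv
  have hc := (contDiff_norm_rpow (E := ℝ) h1).continuous_deriv le_rfl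
  rw [hd] at hc
  have h2 : 2 * H ≠ 0 := by linarith
  convert hc.const_mul (2 * H)⁻¹ using 2
  field_simp

theorem hasDerivAt_abs_rpow_mul (q : ℝ) {x : ℝ} (hx : x ≠ 0) :
    HasDerivAt (fun x : ℝ => |x| ^ q * x) ((q + 1) * |x| ^ q) x := by
  have h1 : HasDerivAt (fun x : ℝ => |x| ^ q) (SignType.sign x * q * |x| ^ (q - 1)) x :=
    (hasDerivAt_abs hx).rpow_const (Or.inl (abs_ne_zero.2 hx))
  refine (h1.mul (hasDerivAt_id x)).congr_deriv ?_
  have e : |x| ^ q = |x| ^ (q - 1) * |x| := by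
    rw [← Real.rpow_add_one (abs_ne_zero.2 hx)]; ring_nf
  have e2 : (SignType.sign x : ℝ) * x = |x| := by
    rcases lt_or_gt_of_ne hx with h | h
    · simp [h, abs_of_neg]
    · simp [h, abs_of_pos]
  simp only [id, mul_one]
  linear_combination (q * |x| ^ (q - 1)) * e2 - q * e

theorem integral_abs_sub_rpow {H : ℝ} (h : 1 / 2 < H) (x t : ℝ) :
    ∫ r in (0 : ℝ)..t, |x - r| ^ (2 * H - 2) =
      (|x| ^ (2 * H - 2) * x - |x - t| ^ (2 * H - 2) * (x - t)) / (2 * H - 1) := by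
  have hc := continuous_abs_rpow_mul h
  have h1 : 2 * H - 1 ≠ 0 := by linarith
  rw [MeasureTheory.integral_eq_of_hasDerivAt_off_countable
    (fun r => -(|x - r| ^ (2 * H - 2) * (x - r)) / (2 * H - 1)) _ (countable_singleton x)
    ((hc.comp (by fun_prop : Continuous fun r => x - r)).neg.div_const _).continuousOn]
  · simp only [sub_zero]; ring
  · intro r hr
    have hne : x - r ≠ 0 := by
      intro h0; exact hr.2 (by simp only [mem_singleton_iff]; linarith)
    refine (((hasDerivAt_abs_rpow_mul (2 * H - 2) hne).comp r
      ((hasDerivAt_id r).const_sub x)).neg.div_const (2 * H - 1)).congr_deriv ?_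
    rw [show 2 * H - 2 + 1 = 2 * H - 1 by ring, mul_neg_one, neg_neg, mul_div_cancel_left₀ _ h1]
  · have := (intervalIntegrable_abs_rpow (q := 2 * H - 2) (by linarith) (x - 0) (x - t)).comp_sub_left x
    simpa using this

theorem integral_Iic_eq (f : ℝ → ℝ) (t : I) : ∫ r in Iic t, f r = ∫ r in (0 : ℝ)..t, f r := by
  rw [intervalIntegral.integral_of_le t.2.1, ← integral_Icc_eq_integral_Ioc,
    ← image_subtype_val_Icc_Iic, unitInterval.volume_def]
  exact (setIntegral_map_subtype f t)
where
  setIntegral_map_subtype (f : ℝ → ℝ) (t : I) :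
      ∫ r in Iic t, f r ∂(volume.comap (Subtype.val : I → ℝ)) =
        ∫ r in Subtype.val '' (Iic t), f r := by
    have h := unitInterval.measurableEmbedding_coe
    have hr : (volume.comap (Subtype.val : I → ℝ)).restrict (Iic t) =
        (volume.restrict (Subtype.val '' (Iic t))).comap Subtype.val := by
      rw [h.comap_restrict, preimage_image_eq _ Subtype.val_injective]
    rw [hr, ← h.integral_map, h.map_comap, Measure.restrict_restrict]
    · congr 2
      exact inter_eq_self_of_subset_right (image_subset_range _ _)
    · exact h.measurableSet_range

theorem alpha_mul_integral_abs_sub {H : ℝ} (hH : H ∈ Ioo (1 / 2 : ℝ) 1) (s t : I) :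
    alpha H * ∫ x in Iic s, ∫ r in Iic t, |(x : ℝ) - r| ^ (2 * H - 2) = cov H t s := by
  have h2 : 2 * H - 1 ≠ 0 := by linarith [hH.1]
  have h1 : 1 < 2 * H := by linarith [hH.1]
  have h3 : H ≠ 0 := by linarith
  have hc := continuous_abs_rpow_mul hH.1
  have e1 : ∀ x : I, ∫ r in Iic t, |(x : ℝ) - r| ^ (2 * H - 2) =
      (|(x : ℝ)| ^ (2 * H - 2) * x - |(x : ℝ) - t| ^ (2 * H - 2) * (x - t)) / (2 * H - 1) :=
    fun x => by rw [integral_Iic_eq (fun r => |(x : ℝ) - r| ^ (2 * H - 2)), integral_abs_sub_rpow hH.1]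
  simp_rw [e1]
  rw [integral_Iic_eq fun x =>
    (|x| ^ (2 * H - 2) * x - |x - t| ^ (2 * H - 2) * (x - t)) / (2 * H - 1),
    intervalIntegral.integral_eq_sub_of_hasDerivAt
    (f := fun x => (|x| ^ (2 * H) - |x - t| ^ (2 * H)) / (2 * H) / (2 * H - 1))]
  · have ht : |(0 : ℝ) - t| = t := by rw [zero_sub, abs_neg, abs_of_nonneg t.2.1]
    rw [ht, abs_zero, Real.zero_rpow (by linarith), abs_of_nonneg s.2.1, cov,
      abs_sub_comm (t : ℝ), alpha]
    generalize 2 * H - 1 = d at h2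
    field_simp
    ring
  · intro x _
    have d1 := hasDerivAt_abs_rpow x h1
    have d2 := (hasDerivAt_abs_rpow (x - t) h1).comp x ((hasDerivAt_id x).sub_const (t : ℝ))
    refine (((d1.sub d2).div_const (2 * H)).div_const (2 * H - 1)).congr_deriv ?_
    rw [mul_one]
    field_simp
  · exact ((hc.sub (hc.comp (by fun_prop : Continuous fun x : ℝ => x - t))).div_const
      _).intervalIntegrable _ _

end

/-! ### Energy of nonnegative functions -/

section

/-- The potential `x ↦ ∫ f(s) k(x,s) ds` of a nonnegative function on `[0,1]`, where `k` is
`feature H`. -/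
def potential (H : ℝ) (f : I → ℝ≥0∞) (x : ℝ) : ℝ≥0∞ :=
  ∫⁻ s, f s * ENNReal.ofReal (feature H x s)

/-- The energy `α_H ∫∫ f(s) f(t) |s-t|^{2H-2} ds dt` of a nonnegative function, in the form
`∫ (potential f)^2`; see `lintegral_potential_mul`. -/
def energy (H : ℝ) (f : I → ℝ≥0∞) : ℝ≥0∞ := ∫⁻ x, potential H f x ^ 2

variable {H : ℝ}

theorem measurable_ofReal_feature : Measurable fun z : ℝ × I =>
    ENNReal.ofReal (feature H z.1 z.2) :=
  (measurable_feature H).ennreal_ofReal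

theorem potential_congr {f g : I → ℝ≥0∞} (h : f =ᵐ[volume] g) :
    potential H f = potential H g := by
  funext x
  exact lintegral_congr_ae (h.mono fun s hs => by simp only [hs])

theorem measurable_potential {f : I → ℝ≥0∞} (hf : AEMeasurable f) :
    Measurable (potential H f) := by
  rw [potential_congr hf.ae_eq_mk]
  exact Measurable.lintegral_prod_right'
    (f := fun z : ℝ × I => hf.mk f z.2 * ENNReal.ofReal (feature H z.1 z.2))
    ((hf.measurable_mk.comp measurable_snd).mul measurable_ofReal_feature)

theorem measurable_ofReal_feature_right (x : ℝ) :
    Measurable fun s : I => ENNReal.ofReal (feature H x s) :=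
  measurable_ofReal_feature.comp measurable_prodMk_left

theorem potential_mono {f g : I → ℝ≥0∞} (h : f ≤ᵐ[volume] g) (x : ℝ) :
    potential H f x ≤ potential H g x :=
  lintegral_mono_ae (h.mono fun s hs => by gcongr)

theorem potential_add {f g : I → ℝ≥0∞} (hf : AEMeasurable f) (x : ℝ) :
    potential H (fun s => f s + g s) x = potential H f x + potential H g x := by
  simp only [potential, add_mul]
  exact lintegral_add_left' (hf.mul (measurable_ofReal_feature_right x).aemeasurable) _

theorem potential_const_mul {f : I → ℝ≥0∞} (hf : AEMeasurable f) (c : ℝ≥0∞) (x : ℝ) :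
    potential H (fun s => c * f s) x = c * potential H f x := by
  simp only [potential, mul_assoc]
  exact lintegral_const_mul'' _ (hf.mul (measurable_ofReal_feature_right x).aemeasurable)

theorem energy_mono {f g : I → ℝ≥0∞} (h : f ≤ᵐ[volume] g) : energy H f ≤ energy H g :=
  lintegral_mono fun x => by
    have := potential_mono (H := H) h x
    dsimp only
    gcongr

theorem energy_congr {f g : I → ℝ≥0∞} (h : f =ᵐ[volume] g) : energy H f = energy H g := by
  simp only [energy, potential_congr h]

theorem energy_const_mul {f : I → ℝ≥0∞} (hf : AEMeasurable f) (c : ℝ≥0∞) :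
    energy H (fun s => c * f s) = c ^ 2 * energy H f := by
  simp only [energy, potential_const_mul hf, mul_pow]
  exact lintegral_const_mul _ ((measurable_potential hf).pow_const 2)

theorem energy_add_le {f g : I → ℝ≥0∞} (hf : AEMeasurable f) :
    energy H (fun s => f s + g s) ≤ 4 * (energy H f + energy H g) := by
  have hm := (measurable_potential (H := H) hf).pow_const 2
  rw [energy, energy, energy, ← lintegral_add_left hm, ← lintegral_const_mul' _ _ (by simp)]
  refine lintegral_mono fun x => ?_
  rw [potential_add hf]
  have aux : ∀ a b : ℝ≥0∞, a ≤ b → (a + b) ^ 2 ≤ 4 * (a ^ 2 + b ^ 2) := fun a b h =>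
    calc (a + b) ^ 2 ≤ (b + b) ^ 2 := by gcongr
      _ = 4 * b ^ 2 := by ring
      _ ≤ 4 * (a ^ 2 + b ^ 2) := by gcongr; exact le_add_self
  rcases le_total (potential H f x) (potential H g x) with h | h
  · exact aux _ _ h
  · rw [add_comm, add_comm (potential H f x ^ 2)]; exact aux _ _ h

theorem ae_ne_right (s : I) : ∀ᵐ t : I, s ≠ t := by
  have h : ({s}ᶜ : Set I) ∈ ae (volume : Measure I) :=
    compl_mem_ae_iff.2 (measure_singleton s)
  exact mem_of_superset h fun t ht hst => ht hst.symm

/-- By Tonelli, the scalar product in `L²(ℝ)` of two potentials is the double integral against the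
kernel `α_H |s - t|^{2H-2}`. -/
theorem lintegral_potential_mul (hH : H ∈ Ioo (1 / 2 : ℝ) 1) {f g : I → ℝ≥0∞}
    (hf : AEMeasurable f) (hg : AEMeasurable g) :
    ∫⁻ x, potential H f x * potential H g x =
      ∫⁻ s, ∫⁻ t, f s * g t * ENNReal.ofReal (alpha H * |(s : ℝ) - t| ^ (2 * H - 2)) := by
  wlog hm : Measurable f ∧ Measurable g generalizing f g
  · rw [potential_congr hf.ae_eq_mk, potential_congr hg.ae_eq_mk,
      this hf.measurable_mk.aemeasurable hg.measurable_mk.aemeasurable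
        ⟨hf.measurable_mk, hg.measurable_mk⟩]
    refine lintegral_congr_ae (hf.ae_eq_mk.mono fun s hs => ?_)
    refine lintegral_congr_ae (hg.ae_eq_mk.mono fun t ht => ?_)
    simp only [hs, ht]
  obtain ⟨hfm, hgm⟩ := hm
  have hk := measurable_ofReal_feature (H := H)
  have hfk : ∀ {f : I → ℝ≥0∞}, Measurable f → ∀ x,
      Measurable fun s => f s * ENNReal.ofReal (feature H x s) := fun hf x =>
    hf.mul (measurable_ofReal_feature_right x)
  calc ∫⁻ x, potential H f x * potential H g x
      = ∫⁻ x, ∫⁻ s, ∫⁻ t, (f s * ENNReal.ofReal (feature H x s)) *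
          (g t * ENNReal.ofReal (feature H x t)) := by
        refine lintegral_congr fun x => ?_
        rw [potential, ← lintegral_mul_const _ (hfk hfm x)]
        refine lintegral_congr fun s => ?_
        rw [potential, ← lintegral_const_mul _ (hfk hgm x)]
    _ = ∫⁻ s, ∫⁻ x, ∫⁻ t, (f s * ENNReal.ofReal (feature H x s)) *
          (g t * ENNReal.ofReal (feature H x t)) := by
        refine lintegral_lintegral_swap (Measurable.aemeasurable ?_)
        refine Measurable.lintegral_prod_right' (f := fun z : (ℝ × I) × I =>
          (f z.1.2 * ENNReal.ofReal (feature H z.1.1 z.1.2)) *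
          (g z.2 * ENNReal.ofReal (feature H z.1.1 z.2))) ?_
        exact ((hfm.comp (by fun_prop)).mul (hk.comp measurable_fst)).mul
          ((hgm.comp measurable_snd).mul (hk.comp (by fun_prop :
            Measurable fun z : (ℝ × I) × I => (z.1.1, z.2))))
    _ = ∫⁻ s, ∫⁻ t, ∫⁻ x, (f s * ENNReal.ofReal (feature H x s)) *
          (g t * ENNReal.ofReal (feature H x t)) := by
        refine lintegral_congr fun s => lintegral_lintegral_swap (Measurable.aemeasurable ?_)
        exact (measurable_const.mul (hk.comp (by fun_prop :
            Measurable fun z : ℝ × I => (z.1, s)))).mul ((hgm.comp measurable_snd).mul hk)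
    _ = _ := by
        refine lintegral_congr fun s => lintegral_congr_ae ((ae_ne_right s).mono fun t hst => ?_)
        simp only
        rw [← lintegral_feature_mul hH hst, ← lintegral_const_mul]
        · refine lintegral_congr fun x => ?_
          ring
        · exact (hk.comp (by fun_prop : Measurable fun x : ℝ => (x, s))).mul
            (hk.comp (by fun_prop : Measurable fun x : ℝ => (x, t)))

theorem energy_eq (hH : H ∈ Ioo (1 / 2 : ℝ) 1) {f : I → ℝ≥0∞} (hf : AEMeasurable f) :
    energy H f =
      ∫⁻ s, ∫⁻ t, f s * f t * ENNReal.ofReal (alpha H * |(s : ℝ) - t| ^ (2 * H - 2)) := by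
  rw [← lintegral_potential_mul hH hf hf, energy]
  simp_rw [sq]

/-- The kernel has bounded marginals. -/
theorem exists_lintegral_kernel_le (hH : H ∈ Ioo (1 / 2 : ℝ) 1) : ∃ C : ℝ, 0 ≤ C ∧ ∀ s : I,
    ∫⁻ t : I, ENNReal.ofReal (alpha H * |(s : ℝ) - t| ^ (2 * H - 2)) ≤ ENNReal.ofReal C := by
  have h1 : 0 < 2 * H - 1 := by linarith [hH.1]
  have hα := alpha_pos hH
  refine ⟨alpha H * (2 / (2 * H - 1)), by positivity, fun s => ?_⟩
  have hint : Integrable fun t : I => |(s : ℝ) - t| ^ (2 * H - 2) := by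
    have := (intervalIntegrable_abs_rpow (q := 2 * H - 2) (by linarith) (s - 0) (s - 1)).comp_sub_left s
    simp only [sub_sub_cancel] at this
    rw [intervalIntegrable_iff_integrableOn_Icc_of_le zero_le_one] at this
    exact (unitInterval.measurePreserving_coe.integrable_comp_emb
      unitInterval.measurableEmbedding_coe).2 this
  rw [← ofReal_integral_eq_lintegral_ofReal (hint.const_mul _)
    (.of_forall fun t => by simp only [Pi.zero_apply]; positivity), integral_const_mul]
  refine ENNReal.ofReal_le_ofReal (mul_le_mul_of_nonneg_left ?_ hα.le)
  have e := integral_Iic_eq (fun r => |(s : ℝ) - r| ^ (2 * H - 2)) 1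
  have hu : Iic (1 : I) = univ := eq_univ_of_forall fun x => x.2.2
  rw [hu, setIntegral_univ, integral_abs_sub_rpow hH.1] at e
  rw [e]
  have b : ∀ y : ℝ, |y| ≤ 1 → |(|y| ^ (2 * H - 2) * y)| ≤ 1 := fun y hy => by
    rw [abs_mul, abs_of_nonneg (by positivity : (0 : ℝ) ≤ |y| ^ (2 * H - 2))]
    rcases eq_or_ne y 0 with rfl | hy0
    · simp
    rw [← Real.rpow_add_one (abs_ne_zero.2 hy0)]
    exact Real.rpow_le_one (abs_nonneg _) hy (by linarith)
  have b1 := b s (by rw [abs_of_nonneg s.2.1]; exact s.2.2)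
  have b2 := b ((s : ℝ) - 1) (by rw [abs_le]; constructor <;> linarith [s.2.1, s.2.2])
  rw [abs_le] at b1 b2
  simp only [Icc.coe_one]
  gcongr
  linarith [b1.2, b2.1]

theorem lintegral_potential_mul_le (hH : H ∈ Ioo (1 / 2 : ℝ) 1) : ∃ C : ℝ, 0 ≤ C ∧
    ∀ f g : I → ℝ≥0∞, AEMeasurable f → AEMeasurable g → (∀ t, g t ≤ 1) →
      ∫⁻ x, potential H f x * potential H g x ≤ ENNReal.ofReal C * ∫⁻ s, f s := by
  obtain ⟨C, hC0, hC⟩ := exists_lintegral_kernel_le hH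
  refine ⟨C, hC0, fun f g hf hg hg1 => ?_⟩
  rw [lintegral_potential_mul hH hf hg, ← lintegral_const_mul'' _ hf]
  refine lintegral_mono fun s => ?_
  calc _ ≤ ∫⁻ t : I, f s * ENNReal.ofReal (alpha H * |(s : ℝ) - t| ^ (2 * H - 2)) := by
        refine lintegral_mono fun t => ?_
        dsimp only
        gcongr
        exact mul_le_of_le_one_right' (hg1 t)
    _ ≤ _ := by
        rw [lintegral_const_mul _ (by fun_prop), mul_comm]
        gcongr
        exact hC s

theorem energy_lt_top_of_le (hH : H ∈ Ioo (1 / 2 : ℝ) 1) {f : I → ℝ≥0∞} {C : ℝ≥0∞} (hC : C ≠ ∞)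
    (h : ∀ᵐ t, f t ≤ C) : energy H f < ∞ := by
  have h1 : energy H (fun _ => 1) < ∞ := by
    obtain ⟨K, hK0, hK⟩ := lintegral_potential_mul_le hH
    refine lt_of_le_of_lt ?_ (ENNReal.mul_lt_top (ENNReal.ofReal_lt_top (r := K))
      (by simp : ∫⁻ _ : I, (1 : ℝ≥0∞) < ∞))
    rw [energy]
    simp_rw [sq]
    exact hK _ _ (by fun_prop) (by fun_prop) fun _ => le_rfl
  calc energy H f ≤ energy H (fun _ => C * 1) := energy_mono (h.mono fun t ht => by simpa using ht)
    _ = C ^ 2 * energy H (fun _ => 1) := energy_const_mul (by fun_prop) _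
    _ < ∞ := ENNReal.mul_lt_top (by finiteness) h1

/-- On `[δ,1]` the kernel is at least `α_H (1-δ)^{2H-2}`. -/
theorem sq_setLIntegral_le_energy (hH : H ∈ Ioo (1 / 2 : ℝ) 1) {f : I → ℝ≥0∞}
    (hf : AEMeasurable f) {δ : I} (hδ : δ < 1) :
    ENNReal.ofReal (alpha H * (1 - δ : ℝ) ^ (2 * H - 2)) * (∫⁻ s in Ici δ, f s) ^ 2 ≤
      energy H f := by
  have hα := alpha_pos hH
  have hδ' : 0 < 1 - (δ : ℝ) := sub_pos.2 hδ
  calc _ = ∫⁻ s in Ici δ, ∫⁻ t in Ici δ,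
        f s * f t * ENNReal.ofReal (alpha H * (1 - δ : ℝ) ^ (2 * H - 2)) := by
        have hfr : AEMeasurable f (volume.restrict (Ici δ)) := hf.restrict
        have : ∀ s, ∫⁻ t in Ici δ, f s * f t * ENNReal.ofReal (alpha H * (1 - δ : ℝ) ^ (2 * H - 2))
            = f s * ((∫⁻ t in Ici δ, f t) * ENNReal.ofReal (alpha H * (1 - δ : ℝ) ^ (2 * H - 2))) := by
          intro s
          simp_rw [mul_assoc]
          rw [lintegral_const_mul'' _ (hfr.mul_const _), lintegral_mul_const'' _ hfr]
        simp_rw [this]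
        rw [lintegral_mul_const'' _ hfr]
        ring
    _ ≤ ∫⁻ s in Ici δ, ∫⁻ t in Ici δ,
        f s * f t * ENNReal.ofReal (alpha H * |(s : ℝ) - t| ^ (2 * H - 2)) := by
        refine lintegral_mono_ae ((ae_restrict_iff' measurableSet_Ici).2 (.of_forall fun s hs => ?_))
        refine lintegral_mono_ae ((ae_restrict_iff' measurableSet_Ici).2
          ((ae_ne_right s).mono fun t hst ht => ?_))
        have hz : 2 * H - 2 ≤ 0 := by linarith [hH.2]
        have hp : 0 < |(s : ℝ) - t| := abs_pos.2 (sub_ne_zero.2 fun h => hst (Subtype.ext h))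
        refine mul_le_mul' le_rfl (ENNReal.ofReal_le_ofReal (mul_le_mul_of_nonneg_left
          (Real.rpow_le_rpow_of_nonpos hp ?_ hz) hα.le))
        have h1 : (δ : ℝ) ≤ s := hs
        have h2 : (δ : ℝ) ≤ t := ht
        rw [abs_le]
        constructor <;> linarith [s.2.2, t.2.2]
    _ ≤ _ := by
        rw [energy_eq hH hf]
        exact (setLIntegral_le_lintegral _ _).trans
          (lintegral_mono fun s => setLIntegral_le_lintegral _ _)

theorem lintegral_lt_top_of_energy (hH : H ∈ Ioo (1 / 2 : ℝ) 1) {f : I → ℝ≥0∞}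
    (hf : AEMeasurable f) (h : energy H f < ∞) : ∫⁻ s, f s < ∞ := by
  have h0 := sq_setLIntegral_le_energy hH hf (δ := 0) (by simp)
  have hu : Ici (0 : I) = univ := eq_univ_of_forall fun x => x.2.1
  rw [hu, setLIntegral_univ] at h0
  by_contra hc
  rw [not_lt, top_le_iff] at hc
  rw [hc] at h0
  have hα := alpha_pos hH
  simp [ENNReal.mul_top, hα] at h0
  exact h.ne h0

end

/-! ### Functions of finite energy and the Hilbert space `𝔥` -/

section

variable {H : ℝ}

/-- The real function `x ↦ ∫ f(s) k(x,s) ds`, where `k` is `feature H`. -/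
def featureMap (H : ℝ) (f : I → ℝ) (x : ℝ) : ℝ := ∫ s, f s * feature H x s

theorem enorm_feature (x : ℝ) (s : I) : ‖feature H x s‖ₑ = ENNReal.ofReal (feature H x s) :=
  Real.enorm_of_nonneg (feature_nonneg H x s)

theorem enorm_featureMap_le (f : I → ℝ) (x : ℝ) :
    ‖featureMap H f x‖ₑ ≤ potential H (fun s => ‖f s‖ₑ) x := by
  refine (enorm_integral_le_lintegral_enorm _).trans_eq ?_
  simp only [enorm_mul, enorm_feature, potential]

theorem featureMap_congr {f g : I → ℝ} (h : f =ᵐ[volume] g) : featureMap H f = featureMap H g := by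
  funext x
  exact integral_congr_ae (h.mono fun s hs => by simp only [hs])

theorem aestronglyMeasurable_featureMap {f : I → ℝ} (hf : AEStronglyMeasurable f) :
    AEStronglyMeasurable (featureMap H f) := by
  rw [featureMap_congr hf.ae_eq_mk]
  refine StronglyMeasurable.aestronglyMeasurable ?_
  exact StronglyMeasurable.integral_prod_right
    (f := fun (x : ℝ) (s : I) => hf.mk f s * feature H x s)
    ((hf.stronglyMeasurable_mk.comp_measurable measurable_snd).mul
      (measurable_feature H).stronglyMeasurable)

/-- `f` is measurable and has finite energy. -/
def FiniteEnergy (H : ℝ) (f : I → ℝ) : Prop :=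
  AEStronglyMeasurable f ∧ energy H (fun s => ‖f s‖ₑ) < ∞

theorem lintegral_potential_sq (f : I → ℝ≥0∞) :
    (∫⁻ x, potential H f x ^ (2 : ℝ)) = energy H f := by
  simp only [ENNReal.rpow_two, energy]

theorem FiniteEnergy.memLp {f : I → ℝ} (hf : FiniteEnergy H f) : MemLp (featureMap H f) 2 := by
  refine ⟨aestronglyMeasurable_featureMap hf.1, ?_⟩
  rw [eLpNorm_lt_top_iff_lintegral_rpow_enorm_lt_top (by simp) (by simp)]
  refine lt_of_le_of_lt (lintegral_mono fun x => ?_) hf.2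
  simp only [ENNReal.toReal_ofNat, ENNReal.rpow_two]
  have := enorm_featureMap_le (H := H) f x
  gcongr

theorem FiniteEnergy.congr {f g : I → ℝ} (hf : FiniteEnergy H f) (h : f =ᵐ[volume] g) :
    FiniteEnergy H g :=
  ⟨hf.1.congr h, lt_of_le_of_lt
    (energy_mono (h.mono fun _ hs => (congrArg _ hs.symm).le)) hf.2⟩

theorem FiniteEnergy.add {f g : I → ℝ} (hf : FiniteEnergy H f) (hg : FiniteEnergy H g) :
    FiniteEnergy H (fun s => f s + g s) := by
  refine ⟨hf.1.add hg.1, ?_⟩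
  calc _ ≤ energy H (fun s => ‖f s‖ₑ + ‖g s‖ₑ) :=
        energy_mono (.of_forall fun s => enorm_add_le _ _)
    _ ≤ 4 * (energy H (fun s => ‖f s‖ₑ) + energy H (fun s => ‖g s‖ₑ)) :=
        energy_add_le hf.1.enorm
    _ < ∞ := ENNReal.mul_lt_top (by simp) (ENNReal.add_lt_top.2 ⟨hf.2, hg.2⟩)

theorem FiniteEnergy.const_mul {f : I → ℝ} (hf : FiniteEnergy H f) (c : ℝ) :
    FiniteEnergy H (fun s => c * f s) := by
  refine ⟨hf.1.const_mul c, ?_⟩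
  simp only [enorm_mul]
  rw [energy_const_mul hf.1.enorm]
  exact ENNReal.mul_lt_top (by finiteness) hf.2

theorem finiteEnergy_of_bounded (hH : H ∈ Ioo (1 / 2 : ℝ) 1) {f : I → ℝ}
    (hf : AEStronglyMeasurable f) {C : ℝ} (hC : ∀ᵐ t, ‖f t‖ ≤ C) : FiniteEnergy H f :=
  ⟨hf, energy_lt_top_of_le hH (C := ENNReal.ofReal C) (by simp) (hC.mono fun t ht => by
    rw [← ofReal_norm]
    exact ENNReal.ofReal_le_ofReal ht)⟩

theorem FiniteEnergy.integrable (hH : H ∈ Ioo (1 / 2 : ℝ) 1) {f : I → ℝ}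
    (hf : FiniteEnergy H f) : Integrable f :=
  ⟨hf.1, lintegral_lt_top_of_energy hH hf.1.enorm hf.2⟩

theorem lintegral_potential_mul_lt_top {f g : I → ℝ} (hf : FiniteEnergy H f)
    (hg : FiniteEnergy H g) :
    ∫⁻ x, potential H (fun s => ‖f s‖ₑ) x * potential H (fun s => ‖g s‖ₑ) x < ∞ := by
  refine lt_of_le_of_lt (ENNReal.lintegral_mul_le_Lp_mul_Lq volume
    (Real.HolderConjugate.two_two) (measurable_potential hf.1.enorm).aemeasurable
    (measurable_potential hg.1.enorm).aemeasurable) ?_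
  rw [lintegral_potential_sq, lintegral_potential_sq]
  exact ENNReal.mul_lt_top (ENNReal.rpow_lt_top_of_nonneg (by norm_num) hf.2.ne)
    (ENNReal.rpow_lt_top_of_nonneg (by norm_num) hg.2.ne)

/-- Fubini for the pairing of `featureMap H f` with a square integrable function. -/
theorem integral_featureMap_mul {f : I → ℝ} (hf : FiniteEnergy H f) {ψ : ℝ → ℝ}
    (hψ : MemLp ψ 2) :
    Integrable (fun s => f s * ∫ x, feature H x s * ψ x) ∧
    ∫ x, featureMap H f x * ψ x = ∫ s, f s * ∫ x, feature H x s * ψ x := by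
  have hm : AEStronglyMeasurable (fun z : ℝ × I => f z.2 * feature H z.1 z.2 * ψ z.1)
      ((volume : Measure ℝ).prod (volume : Measure I)) :=
    ((hf.1.comp_snd).mul (measurable_feature H).aestronglyMeasurable).mul hψ.1.comp_fst
  have hint : Integrable (fun z : ℝ × I => f z.2 * feature H z.1 z.2 * ψ z.1)
      ((volume : Measure ℝ).prod (volume : Measure I)) := by
    refine ⟨hm, ?_⟩
    rw [HasFiniteIntegral, lintegral_prod _ hm.enorm]
    have e : ∀ x, ∫⁻ s, ‖f s * feature H x s * ψ x‖ₑ =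
        potential H (fun s => ‖f s‖ₑ) x * ‖ψ x‖ₑ := fun x => by
      simp only [enorm_mul, enorm_feature, potential]
      exact lintegral_mul_const' _ _ enorm_ne_top
    simp_rw [e]
    refine lt_of_le_of_lt (ENNReal.lintegral_mul_le_Lp_mul_Lq volume
      (Real.HolderConjugate.two_two) (measurable_potential hf.1.enorm).aemeasurable
      hψ.1.enorm) ?_
    rw [lintegral_potential_sq]
    have h2 := lintegral_rpow_enorm_lt_top_of_eLpNorm_lt_top (by simp) (by simp) hψ.2
    simp only [ENNReal.toReal_ofNat] at h2
    exact ENNReal.mul_lt_top (ENNReal.rpow_lt_top_of_nonneg (by norm_num) hf.2.ne)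
      (ENNReal.rpow_lt_top_of_nonneg (by norm_num) h2.ne)
  constructor
  · have := hint.integral_prod_right
    refine this.congr (.of_forall fun s => ?_)
    simp only [mul_assoc]
    exact integral_const_mul _ _
  · calc _ = ∫ x, ∫ s, f s * feature H x s * ψ x := by
          refine integral_congr_ae (.of_forall fun x => ?_)
          simp only [featureMap]
          exact (integral_mul_const _ _).symm
      _ = ∫ s, ∫ x, f s * feature H x s * ψ x := integral_integral_swap hint
      _ = _ := by
          refine integral_congr_ae (.of_forall fun s => ?_)
          simp only [mul_assoc]
          exact integral_const_mul _ _

theorem integral_feature_mul (hH : H ∈ Ioo (1 / 2 : ℝ) 1) {s t : I} (hst : s ≠ t) :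
    ∫ x, feature H x s * feature H x t = alpha H * |(s : ℝ) - t| ^ (2 * H - 2) := by
  have hα := alpha_pos hH
  rw [integral_eq_lintegral_of_nonneg_ae
    (.of_forall fun x => mul_nonneg (feature_nonneg _ _ _) (feature_nonneg _ _ _))]
  · simp_rw [ENNReal.ofReal_mul (feature_nonneg _ _ _)]
    rw [lintegral_feature_mul hH hst, ENNReal.toReal_ofReal (by positivity)]
  · exact (((measurable_feature H).comp (by fun_prop : Measurable fun x : ℝ => (x, s))).mul
      ((measurable_feature H).comp
        (by fun_prop : Measurable fun x : ℝ => (x, t)))).aestronglyMeasurable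

/-- The signed form of `lintegral_potential_mul`: Fubini applies because the energies are finite. -/
theorem integral_featureMap_mul_featureMap (hH : H ∈ Ioo (1 / 2 : ℝ) 1) {f g : I → ℝ}
    (hf : FiniteEnergy H f) (hg : FiniteEnergy H g) :
    ∫ x, featureMap H f x * featureMap H g x =
      alpha H * ∫ s, ∫ t, f s * g t * |(s : ℝ) - t| ^ (2 * H - 2) := by
  set F : ℝ × (I × I) → ℝ := fun z =>
    (f z.2.1 * feature H z.1 z.2.1) * (g z.2.2 * feature H z.1 z.2.2) with hF
  have hk := measurable_feature H
  have hm : AEStronglyMeasurable F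
      ((volume : Measure ℝ).prod ((volume : Measure I).prod (volume : Measure I))) :=
    ((hf.1.comp_fst.comp_snd).mul (hk.comp (by fun_prop :
        Measurable fun z : ℝ × (I × I) => (z.1, z.2.1))).aestronglyMeasurable).mul
      ((hg.1.comp_snd.comp_snd).mul (hk.comp (by fun_prop :
        Measurable fun z : ℝ × (I × I) => (z.1, z.2.2))).aestronglyMeasurable)
  have hmx : ∀ {f : I → ℝ}, AEStronglyMeasurable f → ∀ x,
      AEMeasurable fun s => ‖f s‖ₑ * ENNReal.ofReal (feature H x s) := fun hf x =>
    hf.enorm.mul (measurable_ofReal_feature_right x).aemeasurable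
  have hint : Integrable F
      ((volume : Measure ℝ).prod ((volume : Measure I).prod (volume : Measure I))) := by
    refine ⟨hm, ?_⟩
    rw [HasFiniteIntegral, lintegral_prod _ hm.enorm]
    have e : ∀ x, ∫⁻ y : I × I, ‖F (x, y)‖ₑ ∂((volume : Measure I).prod (volume : Measure I)) =
        potential H (fun s => ‖f s‖ₑ) x * potential H (fun s => ‖g s‖ₑ) x := fun x => by
      simp only [hF, enorm_mul, enorm_feature, potential]
      exact lintegral_prod_mul (hmx hf.1 x) (hmx hg.1 x)
    simp_rw [e]
    exact lintegral_potential_mul_lt_top hf hg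
  have hint2 := hint.integral_prod_right
  have hdiag : ∀ᵐ y : I × I ∂((volume : Measure I).prod (volume : Measure I)), y.1 ≠ y.2 := by
    refine (Measure.ae_prod_iff_ae_ae ?_).2 (.of_forall fun s => ae_ne_right s)
    exact (isClosed_diagonal.measurableSet.compl : MeasurableSet (diagonal I)ᶜ)
  have heq : (fun y : I × I => ∫ x, F (x, y)) =ᵐ[(volume : Measure I).prod (volume : Measure I)]
      fun y => alpha H * (f y.1 * g y.2 * |(y.1 : ℝ) - y.2| ^ (2 * H - 2)) := by
    refine hdiag.mono fun y hy => ?_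
    have : ∀ x, F (x, y) = (f y.1 * g y.2) * (feature H x y.1 * feature H x y.2) := fun x => by
      simp only [hF]; ring
    simp only [this]
    rw [integral_const_mul, integral_feature_mul hH hy]
    ring
  calc _ = ∫ x, ∫ y, F (x, y) ∂((volume : Measure I).prod (volume : Measure I)) := by
        refine integral_congr_ae (.of_forall fun x => ?_)
        simp only [featureMap, hF]
        exact (integral_prod_mul (fun s => f s * feature H x s)
          (fun t => g t * feature H x t)).symm
    _ = ∫ y, ∫ x, F (x, y) ∂volume ∂((volume : Measure I).prod (volume : Measure I)) :=
        integral_integral_swap hint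
    _ = ∫ s, ∫ t, alpha H * (f s * g t * |(s : ℝ) - t| ^ (2 * H - 2)) := by
        rw [integral_congr_ae heq, integral_prod _ (hint2.congr heq)]
    _ = _ := by simp_rw [integral_const_mul]

/-- The function `𝟙_{[0,t]}`. -/
def indFun (t : I) : I → ℝ := (Iic t).indicator fun _ => 1

theorem measurable_indFun (t : I) : Measurable (indFun t) :=
  measurable_const.indicator measurableSet_Iic

theorem norm_indFun_le (t s : I) : ‖indFun t s‖ ≤ 1 := by
  by_cases h : s ∈ Iic t <;> simp [indFun, h]

theorem enorm_indFun_le (t s : I) : ‖indFun t s‖ₑ ≤ 1 := by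
  by_cases h : s ∈ Iic t <;> simp [indFun, h]

theorem finiteEnergy_indFun (hH : H ∈ Ioo (1 / 2 : ℝ) 1) (t : I) : FiniteEnergy H (indFun t) :=
  finiteEnergy_of_bounded hH (measurable_indFun t).aestronglyMeasurable
    (.of_forall (norm_indFun_le t))

theorem integral_mul_indFun (t : I) (f : I → ℝ) :
    ∫ s, f s * indFun t s = ∫ s in Iic t, f s := by
  rw [← integral_indicator measurableSet_Iic]
  congr 1; funext s
  by_cases h : s ∈ Iic t <;> simp [indFun, h]

theorem integral_featureMap_mul_indFun (hH : H ∈ Ioo (1 / 2 : ℝ) 1) {f : I → ℝ}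
    (hf : FiniteEnergy H f) (t : I) :
    ∫ x, featureMap H f x * featureMap H (indFun t) x =
      alpha H * ∫ s : I, ∫ r in Iic t, f s * |(s : ℝ) - r| ^ (2 * H - 2) := by
  rw [integral_featureMap_mul_featureMap hH hf (finiteEnergy_indFun hH t)]
  congr 2; funext s
  rw [← integral_mul_indFun t]
  congr 1; funext r; ring

theorem integral_featureMap_indFun (hH : H ∈ Ioo (1 / 2 : ℝ) 1) (s t : I) :
    ∫ x, featureMap H (indFun s) x * featureMap H (indFun t) x = cov H s t := by
  rw [integral_featureMap_mul_indFun hH (finiteEnergy_indFun hH s), cov_comm,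
    ← alpha_mul_integral_abs_sub hH]
  congr 1
  rw [← integral_mul_indFun s]
  congr 1; funext x
  rw [integral_const_mul]; ring

end

/-! ### The embedding of `𝔥` into `L²(ℝ)` -/

section

variable {H : ℝ} {hH : H ∈ Ioo (1 / 2 : ℝ) 1}

/-- The step function `𝟙_{[0,t]}`, before completion. -/
def stepInd (hH : H ∈ Ioo (1 / 2 : ℝ) 1) (t : I) : StepFun H hH :=
  show StepFun H hH from Finsupp.single (M := ℝ) t 1

/-- The `𝟙_{[0,t]}` span the step functions. -/
theorem mem_of_stepInd_mem {S : Submodule ℝ (StepFun H hH)} (h : ∀ t, stepInd hH t ∈ S)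
    (f : StepFun H hH) : f ∈ S := by
  have key : ∀ f : I →₀ ℝ, (show StepFun H hH from f) ∈ S := by
    intro f
    induction f using Finsupp.induction_linear with
    | zero => exact S.zero_mem
    | add f g hf hg => exact S.add_mem hf hg
    | single t a =>
      have e : (Finsupp.single t a : I →₀ ℝ) = a • Finsupp.single t 1 := by simp
      rw [e]
      exact S.smul_mem a (h t)
  exact key f

theorem inner_ind (s t : I) : inner ℝ (ind hH s) (ind hH t) = cov H s t := by
  rw [ind, ind]
  refine (UniformSpace.Completion.inner_coe _ _).trans ?_
  show stepInner H (Finsupp.single s 1) (Finsupp.single t 1) = _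
  simp [stepInner]

/-- The inclusion of the step functions into `𝔥`. -/
def stepIncl (hH : H ∈ Ioo (1 / 2 : ℝ) 1) : StepFun H hH →ₗᵢ[ℝ] Hsp H hH :=
  UniformSpace.Completion.toComplₗᵢ

theorem stepIncl_stepInd (t : I) : stepIncl hH (stepInd hH t) = ind hH t := rfl

theorem denseRange_stepIncl : DenseRange (stepIncl hH) :=
  UniformSpace.Completion.denseRange_coe

theorem stepIncl_mem_span (f : StepFun H hH) :
    stepIncl hH f ∈ Submodule.span ℝ (range (ind hH)) := by
  have := mem_of_stepInd_mem (S := (Submodule.span ℝ (range (ind hH))).comap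
    (stepIncl hH).toLinearMap) (fun t => Submodule.subset_span (mem_range_self t)) f
  exact this

theorem dense_span_ind : Dense (Submodule.span ℝ (range (ind hH)) : Set (Hsp H hH)) :=
  denseRange_stepIncl.mono (by rintro _ ⟨f, rfl⟩; exact stepIncl_mem_span f)

/-- `featureMap H (indFun t)` in `L²(ℝ)`. -/
def featureInd (hH : H ∈ Ioo (1 / 2 : ℝ) 1) (t : I) : Lp ℝ 2 (volume : Measure ℝ) :=
  (finiteEnergy_indFun hH t).memLp.toLp _

theorem inner_toLp {f g : ℝ → ℝ} (hf : MemLp f 2) (hg : MemLp g 2) :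
    inner ℝ (hf.toLp f) (hg.toLp g) = ∫ x, f x * g x := by
  rw [L2.inner_def]
  refine integral_congr_ae ?_
  filter_upwards [hf.coeFn_toLp, hg.coeFn_toLp] with x h1 h2
  rw [h1, h2]; simp [mul_comm]

section Isometry

variable {V : Type*} [NormedAddCommGroup V] [InnerProductSpace ℝ V] {g : I → V}

/-- The linear map `𝟙_{[0,t]} ↦ g t` on step functions. -/
def stepLift (hH : H ∈ Ioo (1 / 2 : ℝ) 1) (g : I → V) : StepFun H hH →ₗ[ℝ] V :=
  (Finsupp.linearCombination ℝ g : (I →₀ ℝ) →ₗ[ℝ] _)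

theorem inner_linearCombination (hg : ∀ s t, inner ℝ (g s) (g t) = cov H s t) (f f' : I →₀ ℝ) :
    inner ℝ (Finsupp.linearCombination ℝ g f) (Finsupp.linearCombination ℝ g f') =
      stepInner H f f' := by
  simp only [Finsupp.linearCombination_apply, stepInner, Finsupp.sum]
  rw [sum_inner]
  refine Finset.sum_congr rfl fun s _ => ?_
  rw [inner_sum]
  refine Finset.sum_congr rfl fun t _ => ?_
  rw [real_inner_smul_left, real_inner_smul_right, hg]
  ring

theorem norm_stepLift (hg : ∀ s t, inner ℝ (g s) (g t) = cov H s t) (f : StepFun H hH) :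
    ‖stepLift hH g f‖ = ‖f‖ := by
  have : inner ℝ (stepLift hH g f) (stepLift hH g f) = inner ℝ f f :=
    inner_linearCombination hg f f
  rw [← sq_eq_sq₀ (norm_nonneg _) (norm_nonneg _), ← real_inner_self_eq_norm_sq,
    ← real_inner_self_eq_norm_sq, this]

theorem stepLift_stepInd (t : I) : stepLift hH g (stepInd hH t) = g t := by
  have : Finsupp.linearCombination ℝ g (Finsupp.single t (1 : ℝ)) = g t := by simp
  exact this

variable [CompleteSpace V]

theorem extendOfNorm_stepLift (hg : ∀ s t, inner ℝ (g s) (g t) = cov H s t) (f : StepFun H hH) :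
    (stepLift hH g).extendOfNorm (stepIncl hH).toLinearMap (stepIncl hH f) = stepLift hH g f :=
  LinearMap.extendOfNorm_eq (e := (stepIncl hH).toLinearMap) denseRange_stepIncl
    ⟨1, fun f => by rw [norm_stepLift hg, one_mul]; exact ((stepIncl hH).norm_map f).ge⟩ f

/-- A family of vectors with Gram matrix `R_H` is the image of `𝟙_{[0,t]}` under an isometry
of `𝔥`. -/
def isometryOfCov (hH : H ∈ Ioo (1 / 2 : ℝ) 1) (g : I → V)
    (hg : ∀ s t, inner ℝ (g s) (g t) = cov H s t) : Hsp H hH →ₗᵢ[ℝ] V where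
  toLinearMap := ((stepLift hH g).extendOfNorm (stepIncl hH).toLinearMap).toLinearMap
  norm_map' h := by
    refine denseRange_stepIncl.induction_on
      (p := fun h => ‖(stepLift hH g).extendOfNorm (stepIncl hH).toLinearMap h‖ = ‖h‖) h
      (isClosed_eq (by fun_prop) (by fun_prop)) fun f => ?_
    rw [extendOfNorm_stepLift hg, norm_stepLift hg, (stepIncl hH).norm_map]

theorem isometryOfCov_ind (hg : ∀ s t, inner ℝ (g s) (g t) = cov H s t) (t : I) :
    isometryOfCov hH g hg (ind hH t) = g t := by
  rw [← stepIncl_stepInd, ← stepLift_stepInd (hH := hH) (g := g)]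
  exact extendOfNorm_stepLift hg _

end Isometry

/-- The isometric embedding of `𝔥` into `L²(ℝ)` extending `f ↦ featureMap H f`. -/
def embed (hH : H ∈ Ioo (1 / 2 : ℝ) 1) : Hsp H hH →ₗᵢ[ℝ] Lp ℝ 2 (volume : Measure ℝ) :=
  isometryOfCov hH (featureInd hH) fun s t => by
    rw [featureInd, featureInd, inner_toLp, integral_featureMap_indFun hH]

theorem embed_ind (t : I) : embed hH (ind hH t) = featureInd hH t := isometryOfCov_ind _ t

/-- Two elements of `𝔥` with the same scalar products with the `𝟙_{[0,t]}` are equal. -/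
theorem Hsp.ext_inner {h h' : Hsp H hH} (e : ∀ t, inner ℝ h (ind hH t) = inner ℝ h' (ind hH t)) :
    h = h' := by
  refine dense_span_ind.eq_of_inner_left ℝ fun v hv => ?_
  induction hv using Submodule.span_induction with
  | mem v hv => obtain ⟨t, rfl⟩ := hv; exact e t
  | zero => simp
  | add v w _ _ h1 h2 => rw [inner_add_right, inner_add_right, h1, h2]
  | smul c v _ h1 => rw [real_inner_smul_right, real_inner_smul_right, h1]

theorem Represents.unique {f : I → ℝ} {h h' : Hsp H hH} (h1 : Represents hH f h)
    (h2 : Represents hH f h') : h = h' :=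
  Hsp.ext_inner fun t => by rw [h1.2, h2.2]

/-- An integrable function whose integrals over all `[0,t]` vanish is zero almost everywhere. -/
theorem ae_eq_zero_of_setIntegral_Iic {g : I → ℝ} (hg : Integrable g)
    (h : ∀ t, ∫ s in Iic t, g s = 0) : g =ᵐ[volume] 0 := by
  refine hg.ae_eq_zero_of_forall_setIntegral_eq_zero fun A hA _ => ?_
  have huniv : ∫ s, g s = 0 := by
    have hu : Iic (1 : I) = univ := eq_univ_of_forall fun x => x.2.2
    rw [← setIntegral_univ, ← hu, h]
  induction A, hA using MeasurableSpace.induction_on_inter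
    (h_eq := (inferInstance : BorelSpace I).measurable_eq.trans (borel_eq_generateFrom_Iic I))
    (h_inter := isPiSystem_Iic) with
  | empty => simp
  | basic A hA => obtain ⟨t, rfl⟩ := hA; exact h t
  | compl A hA ih => rw [setIntegral_compl hA hg, ih (measure_lt_top _ _), huniv, sub_zero]
  | iUnion A hd hA ih =>
    rw [integral_iUnion hA hd hg.integrableOn]
    simp [fun i => ih i (measure_lt_top _ _)]

/-- A function of finite energy is an element of `𝔥`. -/
theorem FiniteEnergy.exists_embed {f : I → ℝ} (hf : FiniteEnergy H f) :
    ∃ h : Hsp H hH, embed hH h = hf.memLp.toLp _ := by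
  set K : Submodule ℝ (Lp ℝ 2 (volume : Measure ℝ)) := LinearMap.range (embed hH).toLinearMap
  have hK : IsClosed (K : Set (Lp ℝ 2 (volume : Measure ℝ))) :=
    (embed hH).isometry.isClosedEmbedding.isClosed_range
  suffices hf.memLp.toLp _ ∈ K from this
  rw [← hK.submodule_topologicalClosure_eq, ← Submodule.orthogonal_orthogonal_eq_closure]
  refine (Submodule.mem_orthogonal _ _).2 fun ψ hψ => ?_
  -- `ψ` is orthogonal to the image of every `𝟙_{[0,t]}`, so its adjoint transform vanishes
  have hψL : MemLp (ψ : ℝ → ℝ) 2 := Lp.memLp ψ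
  have h0 : ∀ t, ∫ s in Iic t, ∫ x, feature H x s * ψ x = 0 := fun t => by
    have h1 : inner ℝ (featureInd hH t) ψ = 0 := by
      have := (Submodule.mem_orthogonal _ _).1 hψ _ ⟨ind hH t, rfl⟩
      rw [← embed_ind]; exact this
    rw [featureInd, ← Lp.toLp_coeFn ψ hψL, inner_toLp _ hψL,
      (integral_featureMap_mul (finiteEnergy_indFun hH t) hψL).2] at h1
    rw [← integral_mul_indFun, ← h1]
    simp_rw [mul_comm]
  have hint : Integrable fun s : I => ∫ x, feature H x s * ψ x := by
    have h1 : FiniteEnergy H fun _ : I => (1 : ℝ) :=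
      finiteEnergy_of_bounded hH aestronglyMeasurable_const (C := 1) (by simp)
    simpa using (integral_featureMap_mul h1 hψL).1
  have hz := ae_eq_zero_of_setIntegral_Iic hint h0
  rw [real_inner_comm, ← Lp.toLp_coeFn ψ hψL, inner_toLp _ hψL,
    (integral_featureMap_mul hf hψL).2]
  exact integral_eq_zero_of_ae (hz.mono fun s hs => by simp only [hs, Pi.zero_apply, mul_zero])

theorem represents_of_embed {f : I → ℝ} (hf : FiniteEnergy H f) {h : Hsp H hH}
    (e : embed hH h = hf.memLp.toLp _) : Represents hH f h := by
  refine ⟨hf.integrable hH, fun t => ?_⟩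
  rw [← (embed hH).inner_map_map, e, embed_ind, featureInd, inner_toLp,
    integral_featureMap_mul_indFun hH hf]

theorem FiniteEnergy.memHsp {f : I → ℝ} (hf : FiniteEnergy H f) : MemHsp hH f :=
  let ⟨h, e⟩ := hf.exists_embed (hH := hH)
  ⟨h, represents_of_embed hf e⟩

theorem MemHsp.represents {f : I → ℝ} (h : MemHsp hH f) : Represents hH f (toHsp hH f) := by
  rw [toHsp, dif_pos h]; exact h.choose_spec

theorem Represents.toHsp_eq {f : I → ℝ} {h : Hsp H hH} (hf : Represents hH f h) :
    toHsp hH f = h :=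
  (MemHsp.represents ⟨h, hf⟩).unique hf

theorem FiniteEnergy.embed_toHsp {f : I → ℝ} (hf : FiniteEnergy H f) :
    embed hH (toHsp hH f) = hf.memLp.toLp _ := by
  obtain ⟨h, e⟩ := hf.exists_embed (hH := hH)
  rw [(represents_of_embed hf e).toHsp_eq, e]

theorem FiniteEnergy.inner_toHsp {f g : I → ℝ} (hf : FiniteEnergy H f) (hg : FiniteEnergy H g) :
    inner ℝ (toHsp hH f) (toHsp hH g) = ∫ x, featureMap H f x * featureMap H g x := by
  rw [← (embed hH).inner_map_map, hf.embed_toHsp, hg.embed_toHsp, inner_toLp]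

theorem FiniteEnergy.inner_toHsp_nonneg {f g : I → ℝ} (hf : FiniteEnergy H f)
    (hg : FiniteEnergy H g) (hf0 : ∀ t, 0 ≤ f t) (hg0 : ∀ t, 0 ≤ g t) :
    0 ≤ inner ℝ (toHsp hH f) (toHsp hH g) := by
  rw [hf.inner_toHsp hg]
  exact integral_nonneg fun x => mul_nonneg
    (integral_nonneg fun s => mul_nonneg (hf0 s) (feature_nonneg _ _ _))
    (integral_nonneg fun s => mul_nonneg (hg0 s) (feature_nonneg _ _ _))

theorem FiniteEnergy.norm_toHsp_le {f : I → ℝ} (hf : FiniteEnergy H f) :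
    ENNReal.ofReal (‖toHsp hH f‖ ^ 2) ≤ energy H (fun s => ‖f s‖ₑ) := by
  rw [← (embed hH).norm_map, hf.embed_toHsp, ENNReal.ofReal_pow (norm_nonneg _), Lp.norm_toLp,
    ENNReal.ofReal_toReal hf.memLp.eLpNorm_ne_top, eLpNorm_eq_lintegral_rpow_enorm_toReal (by simp)
      (by simp)]
  simp only [ENNReal.toReal_ofNat]
  rw [← ENNReal.rpow_two, ← ENNReal.rpow_mul]
  norm_num
  refine lintegral_mono fun x => ?_
  have := enorm_featureMap_le (H := H) f x
  gcongr

theorem FiniteEnergy.inner_toHsp_ind {f : I → ℝ} (hf : FiniteEnergy H f) (t : I) :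
    Integrable (fun s => f s * ∫ x, feature H x s * featureMap H (indFun t) x) ∧
    inner ℝ (toHsp hH f) (ind hH t) =
      ∫ s, f s * ∫ x, feature H x s * featureMap H (indFun t) x := by
  have h := integral_featureMap_mul hf (finiteEnergy_indFun hH t).memLp
  refine ⟨h.1, ?_⟩
  rw [← (embed hH).inner_map_map, hf.embed_toHsp, embed_ind, featureInd, inner_toLp, h.2]

theorem FiniteEnergy.toHsp_add {f g : I → ℝ} (hf : FiniteEnergy H f) (hg : FiniteEnergy H g) :
    toHsp hH (fun s => f s + g s) = toHsp hH f + toHsp hH g := by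
  refine Hsp.ext_inner fun t => ?_
  rw [inner_add_left, ((hf.add hg).inner_toHsp_ind t).2, (hf.inner_toHsp_ind t).2,
    (hg.inner_toHsp_ind t).2, ← integral_add (hf.inner_toHsp_ind (hH := hH) t).1
      (hg.inner_toHsp_ind (hH := hH) t).1]
  simp_rw [add_mul]

theorem FiniteEnergy.toHsp_const_mul {f : I → ℝ} (hf : FiniteEnergy H f) (c : ℝ) :
    toHsp hH (fun s => c * f s) = c • toHsp hH f := by
  refine Hsp.ext_inner fun t => ?_
  rw [real_inner_smul_left, ((hf.const_mul c).inner_toHsp_ind t).2, (hf.inner_toHsp_ind t).2,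
    ← integral_const_mul]
  simp_rw [mul_assoc]

/-- On functions of finite energy, the pairing with `𝟙_{[0,t]}` is bounded in the norm of `L¹`. -/
theorem exists_abs_inner_toHsp_ind_le (hH : H ∈ Ioo (1 / 2 : ℝ) 1) : ∃ C : ℝ, 0 ≤ C ∧
    ∀ f : I → ℝ, FiniteEnergy H f → ∀ t,
      ‖inner ℝ (toHsp hH f) (ind hH t)‖ₑ ≤ ENNReal.ofReal C * ∫⁻ s, ‖f s‖ₑ := by
  obtain ⟨C, hC0, hC⟩ := lintegral_potential_mul_le hH
  refine ⟨C, hC0, fun f hf t => ?_⟩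
  rw [← (embed hH).inner_map_map, hf.embed_toHsp, embed_ind, featureInd, inner_toLp]
  refine (enorm_integral_le_lintegral_enorm _).trans (le_trans (lintegral_mono fun x => ?_)
    (hC _ _ hf.1.enorm (measurable_indFun t).enorm.aemeasurable (enorm_indFun_le t)))
  rw [enorm_mul]
  exact mul_le_mul' (enorm_featureMap_le f x) (enorm_featureMap_le _ x)

/-- The adjoint of `featureMap H`, applied to an element of `𝔥` that represents a function `f`,
is the potential `α_H ∫ f(r) |r-s|^{2H-2} dr`. -/
theorem Represents.integral_feature_mul_embed {f : I → ℝ} {h : Hsp H hH}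
    (hf : Represents hH f h) :
    Integrable (fun z : I × I => alpha H * (f z.1 * |(z.1 : ℝ) - z.2| ^ (2 * H - 2)))
      ((volume : Measure I).prod volume) ∧
    (fun s => ∫ x, feature H x s * embed hH h x) =ᵐ[volume]
      fun s => ∫ r, alpha H * (f r * |(r : ℝ) - s| ^ (2 * H - 2)) := by
  have hα := alpha_pos hH
  have hψL : MemLp (embed hH h : ℝ → ℝ) 2 := Lp.memLp _
  have hm : AEStronglyMeasurable
      (fun z : I × I => alpha H * (f z.1 * |(z.1 : ℝ) - z.2| ^ (2 * H - 2)))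
      ((volume : Measure I).prod volume) := by
    refine (hf.1.1.comp_fst.mul (Measurable.aestronglyMeasurable ?_)).const_mul _
    fun_prop
  have hG : Integrable (fun z : I × I => alpha H * (f z.1 * |(z.1 : ℝ) - z.2| ^ (2 * H - 2)))
      ((volume : Measure I).prod volume) := by
    refine ⟨hm, ?_⟩
    obtain ⟨C, hC0, hC⟩ := exists_lintegral_kernel_le hH
    rw [HasFiniteIntegral, lintegral_prod _ hm.enorm]
    calc _ ≤ ∫⁻ s, ‖f s‖ₑ * ENNReal.ofReal C := by
          refine lintegral_mono fun s => ?_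
          have : ∀ t : I, ‖alpha H * (f s * |(s : ℝ) - t| ^ (2 * H - 2))‖ₑ =
              ‖f s‖ₑ * ENNReal.ofReal (alpha H * |(s : ℝ) - t| ^ (2 * H - 2)) := fun t => by
            rw [← Real.enorm_of_nonneg (by positivity), ← enorm_mul]
            congr 1; ring
          simp only [this]
          rw [lintegral_const_mul _ (by fun_prop)]
          gcongr
          exact hC s
      _ < ∞ := by
          rw [lintegral_mul_const' _ _ (by simp)]
          exact ENNReal.mul_lt_top hf.1.2 (by simp)
  refine ⟨hG, ?_⟩
  have h1 : FiniteEnergy H fun _ : I => (1 : ℝ) :=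
    finiteEnergy_of_bounded hH aestronglyMeasurable_const (C := 1) (by simp)
  have hi1 : Integrable fun s : I => ∫ x, feature H x s * embed hH h x := by
    simpa using (integral_featureMap_mul h1 hψL).1
  have hi2 := hG.integral_prod_right
  have hz := ae_eq_zero_of_setIntegral_Iic (hi1.sub hi2) fun t => by
    simp only [Pi.sub_apply]
    rw [integral_sub hi1.integrableOn hi2.integrableOn, sub_eq_zero]
    have e1 : ∫ s in Iic t, ∫ x, feature H x s * embed hH h x = inner ℝ h (ind hH t) := by
      rw [← (embed hH).inner_map_map, real_inner_comm, embed_ind, featureInd]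
      conv_rhs => rw [← Lp.toLp_coeFn (embed hH h) hψL]
      rw [inner_toLp _ hψL, (integral_featureMap_mul (finiteEnergy_indFun hH t) hψL).2,
        ← integral_mul_indFun]
      simp_rw [mul_comm]
    rw [e1, hf.2, ← integral_const_mul]
    have hG' : Integrable (Function.uncurry fun s r : I => alpha H *
        (f s * |(s : ℝ) - r| ^ (2 * H - 2))) ((volume : Measure I).prod (volume.restrict (Iic t))) := by
      have e : (volume : Measure I).prod ((volume : Measure I).restrict (Iic t)) =
          ((volume : Measure I).prod volume).restrict (univ ×ˢ Iic t) := by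
        rw [← Measure.prod_restrict, Measure.restrict_univ]
      rw [e]
      exact hG.restrict
    rw [← integral_integral_swap hG']
    simp_rw [integral_const_mul]
  filter_upwards [hz] with s hs
  simpa [sub_eq_zero] using hs

/-- For `f ≥ 0` there are no cancellations: `featureMap H f` is the potential of `|f|`, so the
energy of `f` is its squared norm in `𝔥`. -/
theorem FiniteEnergy.energy_le_of_nonneg {f : I → ℝ} (hf : FiniteEnergy H f) (h0 : ∀ t, 0 ≤ f t) :
    energy H (fun s => ‖f s‖ₑ) ≤ ENNReal.ofReal (‖toHsp hH f‖ ^ 2) := by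
  rw [← (embed hH).norm_map, hf.embed_toHsp, ENNReal.ofReal_pow (norm_nonneg _), Lp.norm_toLp,
    ENNReal.ofReal_toReal hf.memLp.eLpNorm_ne_top, eLpNorm_eq_lintegral_rpow_enorm_toReal (by simp)
      (by simp)]
  simp only [ENNReal.toReal_ofNat]
  rw [← ENNReal.rpow_two, ← ENNReal.rpow_mul]
  norm_num
  have hfin : ∀ᵐ x, potential H (fun s => ‖f s‖ₑ) x ^ 2 < ∞ :=
    ae_lt_top ((measurable_potential hf.1.enorm).pow_const 2) hf.2.ne
  refine lintegral_mono_ae (hfin.mono fun x hx => ?_)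
  have e : ‖featureMap H f x‖ₑ = potential H (fun s => ‖f s‖ₑ) x := by
    have hnn : ∀ s, 0 ≤ f s * feature H x s := fun s => mul_nonneg (h0 s) (feature_nonneg _ _ _)
    have hm : AEStronglyMeasurable (fun s => f s * feature H x s) :=
      hf.1.mul ((measurable_feature H).comp measurable_prodMk_left).aestronglyMeasurable
    have e1 : potential H (fun s => ‖f s‖ₑ) x = ∫⁻ s, ENNReal.ofReal (f s * feature H x s) := by
      refine lintegral_congr fun s => ?_
      simp only [ENNReal.ofReal_mul (h0 s), Real.enorm_of_nonneg (h0 s)]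
    have hlt : ∫⁻ s, ENNReal.ofReal (f s * feature H x s) ≠ ∞ := by
      rw [← e1]; intro h; rw [h] at hx; simp at hx
    rw [featureMap, integral_eq_lintegral_of_nonneg_ae (.of_forall hnn) hm, e1,
      Real.enorm_of_nonneg ENNReal.toReal_nonneg, ENNReal.ofReal_toReal hlt]
  rw [e]

/-- A nonnegative function that belongs to `𝔥` has finite energy. -/
theorem Represents.finiteEnergy {f : I → ℝ} {h : Hsp H hH} (hf : Represents hH f h)
    (h0 : ∀ t, 0 ≤ f t) : FiniteEnergy H f := by
  have hα := alpha_pos hH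
  refine ⟨hf.1.1, ?_⟩
  set g : ℕ → I → ℝ := fun N s => min (f s) N with hg
  have hg0 : ∀ N s, 0 ≤ g N s := fun N s => le_min (h0 s) (Nat.cast_nonneg N)
  have hgE : ∀ N, FiniteEnergy H (g N) := fun N =>
    finiteEnergy_of_bounded hH (hf.1.1.inf aestronglyMeasurable_const) (C := N)
      (.of_forall fun s => by
        rw [Real.norm_of_nonneg (hg0 N s)]; exact min_le_right _ _)
  -- the truncations of `f` are bounded in `𝔥`
  have hbound : ∀ N, ‖toHsp hH (g N)‖ ≤ ‖h‖ := by
    intro N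
    have hr := ((hgE N).memHsp (hH := hH)).represents
    obtain ⟨hGN, hN⟩ := hr.integral_feature_mul_embed
    obtain ⟨hG, hF⟩ := hf.integral_feature_mul_embed
    have aux : ∀ h' : Hsp H hH, Integrable (fun s => g N s * ∫ x, feature H x s * embed hH h' x) ∧
        inner ℝ (toHsp hH (g N)) h' = ∫ s, g N s * ∫ x, feature H x s * embed hH h' x := by
      intro h'
      have hL : MemLp (embed hH h' : ℝ → ℝ) 2 := Lp.memLp _
      refine ⟨(integral_featureMap_mul (hgE N) hL).1, ?_⟩
      rw [← (embed hH).inner_map_map, (hgE N).embed_toHsp]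
      conv_lhs => rw [← Lp.toLp_coeFn (embed hH h') hL]
      rw [inner_toLp _ hL, (integral_featureMap_mul (hgE N) hL).2]
    -- `‖g_N‖² = ⟨g_N, g_N⟩ ≤ ⟨g_N, h⟩`, since `0 ≤ g_N ≤ f` and the kernel is nonnegative
    have key : ‖toHsp hH (g N)‖ ^ 2 ≤ ‖toHsp hH (g N)‖ * ‖h‖ := by
      refine le_trans ?_ (real_inner_le_norm _ _)
      rw [← real_inner_self_eq_norm_sq, (aux _).2, (aux h).2]
      refine integral_mono_ae (aux _).1 (aux h).1 ?_
      filter_upwards [hN, hF, hGN.prod_left_ae, hG.prod_left_ae] with s h1 h2 i1 i2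
      simp only [h1, h2]
      refine mul_le_mul_of_nonneg_left (integral_mono i1 i2 fun r => ?_) (hg0 N s)
      have : g N r ≤ f r := min_le_left _ _
      dsimp only
      gcongr
    rcases (norm_nonneg (toHsp hH (g N))).eq_or_lt with h | h
    · rw [← h]; exact norm_nonneg _
    · nlinarith
  have hlim : ∀ x, potential H (fun s => ‖f s‖ₑ) x = ⨆ N, potential H (fun s => ‖g N s‖ₑ) x := by
    intro x
    rw [potential]
    have e : ∀ s, ‖f s‖ₑ * ENNReal.ofReal (feature H x s) =
        ⨆ N, ‖g N s‖ₑ * ENNReal.ofReal (feature H x s) := by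
      intro s
      refine le_antisymm ?_ (iSup_le fun N => ?_)
      · obtain ⟨N, hN⟩ := exists_nat_ge (f s)
        refine le_iSup_of_le N ?_
        simp only [hg, min_eq_left hN, le_refl]
      · rw [Real.enorm_of_nonneg (hg0 N s), Real.enorm_of_nonneg (h0 s)]
        gcongr
        exact min_le_left _ _
    simp_rw [e]
    refine lintegral_iSup' (fun N => ((hgE N).1.enorm.mul
      (measurable_ofReal_feature_right x).aemeasurable)) (.of_forall fun s N M hNM => ?_)
    simp only [Real.enorm_of_nonneg (hg0 _ s)]
    gcongr
    exact min_le_min le_rfl (Nat.cast_le.2 hNM)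
  have hmono : ∀ x, Monotone fun N => potential H (fun s => ‖g N s‖ₑ) x := fun x N M hNM =>
    potential_mono (.of_forall fun s => by
      simp only [Real.enorm_of_nonneg (hg0 _ s)]
      gcongr
      exact min_le_min le_rfl (Nat.cast_le.2 hNM)) x
  have hsup : energy H (fun s => ‖f s‖ₑ) = ⨆ N, energy H (fun s => ‖g N s‖ₑ) := by
    simp only [energy, hlim]
    rw [← lintegral_iSup (fun N => (measurable_potential (hgE N).1.enorm).pow_const 2)
      (fun N M hNM x => pow_le_pow_left' (hmono x hNM) 2)]
    refine lintegral_congr fun x => ?_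
    exact ENNReal.iSup_pow_of_ne_zero two_ne_zero _
  rw [hsup]
  refine lt_of_le_of_lt (iSup_le fun N => ?_) (ENNReal.ofReal_lt_top (r := ‖h‖ ^ 2))
  refine ((hgE N).energy_le_of_nonneg (hH := hH) (hg0 N)).trans (ENNReal.ofReal_le_ofReal ?_)
  have := hbound N
  gcongr

theorem norm_ind_sub_sq (s t : I) :
    ‖ind hH s - ind hH t‖ ^ 2 = |(s : ℝ) - t| ^ (2 * H) := by
  have h0 : 2 * H ≠ 0 := by linarith [hH.1]
  rw [norm_sub_sq_real, ← real_inner_self_eq_norm_sq, ← real_inner_self_eq_norm_sq, inner_ind,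
    inner_ind, inner_ind]
  simp only [cov, sub_self, abs_zero, Real.zero_rpow h0]
  ring

theorem continuous_ind : Continuous (ind hH) := by
  have h0 : 0 < 2 * H := by linarith [hH.1]
  refine continuous_iff_continuousAt.2 fun t => tendsto_iff_norm_sub_tendsto_zero.2 ?_
  have h1 : Tendsto (fun s : I => √(|(s : ℝ) - t| ^ (2 * H))) (𝓝 t) (𝓝 0) := by
    have : Continuous fun s : I => √(|(s : ℝ) - t| ^ (2 * H)) :=
      Real.continuous_sqrt.comp ((continuous_abs.comp (by fun_prop :
        Continuous fun s : I => (s : ℝ) - t)).rpow_const fun _ => Or.inr h0.le)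
    simpa [Real.zero_rpow h0.ne'] using this.tendsto t
  refine h1.congr fun s => ?_
  rw [← norm_ind_sub_sq (hH := hH), Real.sqrt_sq (norm_nonneg _)]

instance : SecondCountableTopology (Hsp H hH) := by
  have h1 : TopologicalSpace.IsSeparable (range (ind hH)) :=
    TopologicalSpace.isSeparable_range continuous_ind
  have h2 := (h1.span (R := ℝ)).closure
  rw [dense_span_ind.closure_eq, TopologicalSpace.isSeparable_univ_iff] at h2
  exact UniformSpace.secondCountable_of_separable _

end

/-! ### Gaussian integration by parts -/

section

theorem hasDerivAt_gaussianPDFReal {v : NNReal} (hv : v ≠ 0) (x : ℝ) :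
    HasDerivAt (gaussianPDFReal 0 v) (-(x / v) * gaussianPDFReal 0 v x) x := by
  have hv' : (v : ℝ) ≠ 0 := by exact_mod_cast hv
  have h1 : HasDerivAt (fun x : ℝ => -(x - 0) ^ 2 / (2 * v)) (-(x / v)) x := by
    refine ((((hasDerivAt_id x).sub_const 0).pow 2).neg.div_const (2 * (v : ℝ))).congr_deriv ?_
    simp only [id, sub_zero, Nat.cast_ofNat, mul_one]
    field_simp
    simp
  have h2 := (h1.exp).const_mul (√(2 * Real.pi * v))⁻¹
  simp only [gaussianPDFReal_def]
  refine h2.congr_deriv ?_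
  ring

theorem integrable_gaussianReal_iff {v : NNReal} (hv : v ≠ 0) {f : ℝ → ℝ} :
    Integrable f (gaussianReal 0 v) ↔ Integrable fun x => gaussianPDFReal 0 v x * f x := by
  rw [gaussianReal_of_var_ne_zero _ hv, integrable_withDensity_iff_integrable_smul'
    (measurable_gaussianPDF 0 v) (by simp [gaussianPDF])]
  simp [toReal_gaussianPDF]

/-- Stein's identity. -/
theorem integral_mul_gaussianReal {v : NNReal} (hv : v ≠ 0) {f f' : ℝ → ℝ}
    (hf : ∀ x, HasDerivAt f (f' x) x) (h1 : Integrable f (gaussianReal 0 v))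
    (h2 : Integrable (fun x => f x * x) (gaussianReal 0 v))
    (h3 : Integrable f' (gaussianReal 0 v)) :
    ∫ x, f x * x ∂gaussianReal 0 v = v * ∫ x, f' x ∂gaussianReal 0 v := by
  have hv' : (v : ℝ) ≠ 0 := by exact_mod_cast hv
  rw [integrable_gaussianReal_iff hv] at h1 h2 h3
  have key := integral_mul_deriv_eq_deriv_mul_of_integrable (u := f) (v := gaussianPDFReal 0 v)
    (fun x _ => hf x) (fun x _ => hasDerivAt_gaussianPDFReal hv x)
    ((h2.const_mul (-(v : ℝ)⁻¹)).congr (.of_forall fun x => by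
      simp only [Pi.mul_apply]; ring))
    (h3.congr (.of_forall fun x => by simp only [Pi.mul_apply]; ring))
    (h1.congr (.of_forall fun x => by simp only [Pi.mul_apply]; ring))
  rw [integral_gaussianReal_eq_integral_smul hv, integral_gaussianReal_eq_integral_smul hv]
  simp only [smul_eq_mul]
  have e1 : ∫ x, gaussianPDFReal 0 v x * (f x * x) =
      -(v : ℝ) * ∫ x, f x * (-(x / v) * gaussianPDFReal 0 v x) := by
    rw [← integral_const_mul]
    congr 1; funext x; field_simp
  rw [e1, key]
  simp_rw [mul_comm (gaussianPDFReal 0 v _)]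
  ring

variable {Ω : Type*} [MeasurableSpace Ω] {P : Measure Ω} {ι : Type*} [Fintype ι] [DecidableEq ι]

theorem fderiv_apply_eq_sum {f : (ι → ℝ) → ℝ} (x c : ι → ℝ) :
    fderiv ℝ f x c = ∑ i, c i * fderiv ℝ f x (Pi.single i 1) := by
  conv_lhs => rw [pi_eq_sum_univ' c]
  rw [map_sum]
  refine Finset.sum_congr rfl fun i _ => ?_
  rw [map_smul, smul_eq_mul]

/-- Integration by parts for a centered Gaussian vector `X`:
`E[f(X) X_k] = ∑ i, E[X_i X_k] E[∂_i f(X)]`. -/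
theorem integral_mul_gaussian {X : Ω → ι → ℝ} (hX : HasGaussianLaw X P)
    (hmean : ∀ i, ∫ ω, X ω i ∂P = 0) (k : ι) {f : (ι → ℝ) → ℝ} (hf : ContDiff ℝ 1 f)
    (h1 : Integrable (fun ω => f (X ω)) P) (h2 : Integrable (fun ω => f (X ω) * X ω k) P)
    (h3 : ∀ i, Integrable (fun ω => fderiv ℝ f (X ω) (Pi.single i 1)) P) :
    ∫ ω, f (X ω) * X ω k ∂P =
      ∑ i, (∫ ω, X ω i * X ω k ∂P) * ∫ ω, fderiv ℝ f (X ω) (Pi.single i 1) ∂P := by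
  have hP : IsProbabilityMeasure P := hX.isProbabilityMeasure
  have hL : ∀ i, MemLp (fun ω => X ω i) 2 P := fun i =>
    (hX.map_fun (ContinuousLinearMap.proj (R := ℝ) i)).memLp (by simp)
  have hmul : ∀ i j, Integrable (fun ω => X ω i * X ω j) P := fun i j => (hL i).integrable_mul (hL j)
  set σ2 := ∫ ω, X ω k * X ω k ∂P with hσ
  have hσ0 : 0 ≤ σ2 := integral_nonneg fun ω => mul_self_nonneg _
  rcases hσ0.eq_or_lt with h0 | hpos
  · -- the degenerate case `X_k = 0`
    have hz : ∀ᵐ ω ∂P, X ω k = 0 := by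
      have := (integral_eq_zero_iff_of_nonneg (fun ω => mul_self_nonneg (X ω k)) (hmul k k)).1
        h0.symm
      exact this.mono fun ω h => mul_self_eq_zero.1 h
    rw [integral_eq_zero_of_ae (hz.mono fun ω h => by simp [h])]
    refine (Finset.sum_eq_zero fun i _ => ?_).symm
    rw [integral_eq_zero_of_ae (hz.mono fun ω h => by simp [h]), zero_mul]
  set c : ι → ℝ := fun i => (∫ ω, X ω i * X ω k ∂P) / σ2 with hc
  -- `R` is the part of `X` that is independent of `X_k`
  set R : Ω → ι → ℝ := fun ω => X ω - X ω k • c with hR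
  have hjoint : HasGaussianLaw (fun ω => (X ω k, R ω)) P :=
    hX.map_fun ((ContinuousLinearMap.proj (R := ℝ) (φ := fun _ : ι => ℝ) k).prod
      (ContinuousLinearMap.id ℝ (ι → ℝ) -
        (ContinuousLinearMap.proj (R := ℝ) (φ := fun _ : ι => ℝ) k).smulRight c))
  have hRk : ∀ i, Integrable (fun ω => X ω k * R ω i) P := fun i => by
    have : (fun ω => X ω k * R ω i) = fun ω => X ω k * X ω i - c i * (X ω k * X ω k) := by
      funext ω; simp only [hR, Pi.sub_apply, Pi.smul_apply, smul_eq_mul]; ring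
    rw [this]
    exact (hmul k i).sub ((hmul k k).const_mul _)
  have hRk0 : ∀ i, ∫ ω, X ω k * R ω i ∂P = 0 := fun i => by
    have : (fun ω => X ω k * R ω i) = fun ω => X ω i * X ω k - c i * (X ω k * X ω k) := by
      funext ω; simp only [hR, Pi.sub_apply, Pi.smul_apply, smul_eq_mul]; ring
    rw [this, integral_sub (hmul i k) ((hmul k k).const_mul _), integral_const_mul, ← hσ]
    simp only [hc]
    field_simp
    ring
  have hind : IndepFun (fun ω => X ω k) R P := by
    refine hjoint.indepFun_of_covariance_strongDual fun L₁ L₂ => ?_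
    have hX1 : MemLp (L₁ ∘ fun ω => X ω k) 2 P := L₁.comp_memLp' (hL k)
    have hR1 : MemLp (L₂ ∘ R) 2 P := L₂.comp_memLp' (hjoint.snd.memLp (by simp))
    rw [covariance_eq_sub hX1 hR1]
    have e1 : ∀ x : ℝ, L₁ x = L₁ 1 * x := fun x => by
      have := L₁.map_smul x 1; simp only [smul_eq_mul, mul_one] at this; rw [this]; ring
    have m1 : ∫ ω, (L₁ ∘ fun ω => X ω k) ω ∂P = 0 := by
      simp only [Function.comp]
      simp_rw [e1 (X _ k)]
      rw [integral_const_mul, hmean, mul_zero]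
    rw [m1, zero_mul, sub_zero]
    have e2 : ∀ ω, ((L₁ ∘ fun ω => X ω k) * (L₂ ∘ R)) ω =
        ∑ i, (L₁ 1 * L₂ (Pi.single i 1)) * (X ω k * R ω i) := fun ω => by
      simp only [Pi.mul_apply, Function.comp]
      rw [e1 (X ω k), pi_eq_sum_univ' (R ω), map_sum, Finset.mul_sum]
      refine Finset.sum_congr rfl fun i _ => ?_
      rw [map_smul, smul_eq_mul]
      simp only [← pi_eq_sum_univ']
      have : (fun j => if i = j then (1 : ℝ) else 0) = Pi.single i 1 := by
        funext j; simp [Pi.single_apply, eq_comm]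
      rw [← this]; ring
    simp_rw [e2]
    rw [integral_finsetSum _ fun i _ => (hRk i).const_mul _]
    exact Finset.sum_eq_zero fun i _ => by rw [integral_const_mul, hRk0, mul_zero]
  have hmX : AEMeasurable (fun ω => X ω k) P := (hL k).1.aemeasurable
  have hmR : AEMeasurable R P := hjoint.snd.aemeasurable
  have hlaw := (indepFun_iff_map_prod_eq_prod_map_map hmX hmR).1 hind
  have hγ : P.map (fun ω => X ω k) = gaussianReal 0 σ2.toNNReal := by
    have h := (hX.map_fun (ContinuousLinearMap.proj (R := ℝ) (φ := fun _ : ι => ℝ) k)).map_eq_gaussianReal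
    simp only [ContinuousLinearMap.proj_apply] at h
    rw [h, hmean, variance_of_integral_eq_zero hmX (hmean k)]
    simp only [hσ, sq]
  have hv : σ2.toNNReal ≠ 0 := by simpa using hpos
  rw [hγ] at hlaw
  have hmXR : AEMeasurable (fun ω => (X ω k, R ω)) P := hmX.prodMk hmR
  have : IsProbabilityMeasure (P.map R) := Measure.isProbabilityMeasure_map hmR
  have hback : ∀ ω, X ω k • c + R ω = X ω := fun ω => by simp [hR]
  -- transfer of integrals to the product law of `(X_k, R)`
  have transfer : ∀ {F : ℝ × (ι → ℝ) → ℝ}, Continuous F → Integrable (fun ω => F (X ω k, R ω)) P →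
      Integrable F ((gaussianReal 0 σ2.toNNReal).prod (P.map R)) ∧
      ∫ ω, F (X ω k, R ω) ∂P = ∫ r, ∫ x, F (x, r) ∂gaussianReal 0 σ2.toNNReal ∂(P.map R) := by
    intro F hF hi
    have hFi : Integrable F ((gaussianReal 0 σ2.toNNReal).prod (P.map R)) := by
      rw [← hlaw]
      exact (integrable_map_measure hF.aestronglyMeasurable hmXR).2 hi
    refine ⟨hFi, ?_⟩
    rw [← integral_prod_symm _ hFi, ← hlaw, integral_map hmXR hF.aestronglyMeasurable]
  have hcf := hf.continuous
  have hcd : Continuous (fderiv ℝ f) := hf.continuous_fderiv one_ne_zero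
  have t1 := transfer (F := fun z => f (z.1 • c + z.2)) (by fun_prop) (by simpa [hback] using h1)
  have t2 := transfer (F := fun z => f (z.1 • c + z.2) * z.1) (by fun_prop)
    (by simpa [hback] using h2)
  have h3' : Integrable (fun ω => fderiv ℝ f (X ω) c) P := by
    simp_rw [fderiv_apply_eq_sum _ c]
    exact integrable_finsetSum _ fun i _ => (h3 i).const_mul _
  have t3 := transfer (F := fun z => fderiv ℝ f (z.1 • c + z.2) c) (by fun_prop)
    (by simpa [hback] using h3')
  have e : ∀ᵐ r ∂(P.map R), ∫ x, f (x • c + r) * x ∂gaussianReal 0 σ2.toNNReal =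
      σ2 * ∫ x, fderiv ℝ f (x • c + r) c ∂gaussianReal 0 σ2.toNNReal := by
    filter_upwards [t1.1.prod_left_ae, t2.1.prod_left_ae, t3.1.prod_left_ae] with r i1 i2 i3
    have := integral_mul_gaussianReal hv (f := fun x => f (x • c + r))
      (f' := fun x => fderiv ℝ f (x • c + r) c) (fun x => ?_) i1 i2 i3
    · rw [this, Real.coe_toNNReal _ hσ0]
    · have hd := (hf.differentiable one_ne_zero (x • c + r)).hasFDerivAt
      have hl : HasDerivAt (fun x : ℝ => x • c + r) c x := by
        simpa using ((hasDerivAt_id x).smul_const c).add_const r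
      exact hd.comp_hasDerivAt x hl
  have t2' := t2.2
  have t3' := t3.2
  simp only [hback] at t2' t3'
  rw [t2', integral_congr_ae e, integral_const_mul, ← t3']
  simp_rw [fderiv_apply_eq_sum _ c]
  rw [integral_finsetSum _ fun i _ => (h3 i).const_mul _, Finset.mul_sum]
  refine Finset.sum_congr rfl fun i _ => ?_
  rw [integral_const_mul, ← mul_assoc]
  congr 1
  simp only [hc]
  field_simp

end

/-! ### The divergence of smooth functions of a Gaussian vector -/

section

variable {ι : Type*} [Fintype ι]

/-- A continuous function of polynomial growth. -/
def Tame (f : (ι → ℝ) → ℝ) : Prop :=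
  Continuous f ∧ ∃ (K : ℝ) (n : ℕ), ∀ x, |f x| ≤ K * (1 + ‖x‖) ^ n

namespace Tame

theorem of_bounded {f : (ι → ℝ) → ℝ} (hf : Continuous f) {K : ℝ} (hK : ∀ x, |f x| ≤ K) : Tame f :=
  ⟨hf, K, 0, by simpa using hK⟩

theorem coord (i : ι) : Tame fun x : ι → ℝ => x i :=
  ⟨continuous_apply i, 1, 1, fun x => by
    have := norm_le_pi_norm x i
    rw [Real.norm_eq_abs] at this
    simp only [pow_one, one_mul]
    linarith⟩

theorem const (c : ℝ) : Tame fun _ : ι → ℝ => c := of_bounded continuous_const fun _ => le_rfl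

theorem mul {f g : (ι → ℝ) → ℝ} (hf : Tame f) (hg : Tame g) : Tame fun x => f x * g x := by
  obtain ⟨hfc, K, n, hK⟩ := hf
  obtain ⟨hgc, L, m, hL⟩ := hg
  refine ⟨hfc.mul hgc, K * L, n + m, fun x => ?_⟩
  rw [abs_mul, pow_add, mul_mul_mul_comm]
  exact mul_le_mul (hK x) (hL x) (abs_nonneg _) ((abs_nonneg _).trans (hK x))

theorem add {f g : (ι → ℝ) → ℝ} (hf : Tame f) (hg : Tame g) : Tame fun x => f x + g x := by
  obtain ⟨hfc, K, n, hK⟩ := hf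
  obtain ⟨hgc, L, m, hL⟩ := hg
  refine ⟨hfc.add hgc, |K| + |L|, n + m, fun x => ?_⟩
  have h1 : (1 : ℝ) ≤ 1 + ‖x‖ := by linarith [norm_nonneg x]
  have e1 : K * (1 + ‖x‖) ^ n ≤ |K| * (1 + ‖x‖) ^ (n + m) :=
    mul_le_mul (le_abs_self K) (pow_le_pow_right₀ h1 (by omega)) (by positivity) (abs_nonneg _)
  have e2 : L * (1 + ‖x‖) ^ m ≤ |L| * (1 + ‖x‖) ^ (n + m) :=
    mul_le_mul (le_abs_self L) (pow_le_pow_right₀ h1 (by omega)) (by positivity) (abs_nonneg _)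
  calc _ ≤ |f x| + |g x| := abs_add_le _ _
    _ ≤ _ := by rw [add_mul]; linarith [hK x, hL x]

theorem sum {J : Type*} (s : Finset J) {f : J → (ι → ℝ) → ℝ} (hf : ∀ j, Tame (f j)) :
    Tame fun x => ∑ j ∈ s, f j x := by
  classical
  induction s using Finset.induction_on with
  | empty => simpa using const 0
  | insert j s hj ih =>
    simp only [Finset.sum_insert hj]
    exact (hf j).add ih

theorem const_mul {f : (ι → ℝ) → ℝ} (hf : Tame f) (c : ℝ) : Tame fun x => c * f x :=
  (const c).mul hf

variable {Ω : Type*} [MeasurableSpace Ω] {P : Measure Ω}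

theorem integrable {f : (ι → ℝ) → ℝ} (hf : Tame f) {X : Ω → ι → ℝ} (hX : HasGaussianLaw X P) :
    Integrable (fun ω => f (X ω)) P := by
  have hP : IsProbabilityMeasure P := hX.isProbabilityMeasure
  obtain ⟨hfc, K, n, hK⟩ := hf
  have h1 : MemLp (fun ω => 1 + ‖X ω‖) n P :=
    (memLp_const (1 : ℝ)).add (hX.memLp (by simp)).norm
  have h2 : Integrable (fun ω => (1 + ‖X ω‖) ^ n) P := by
    refine h1.integrable_norm_pow'.congr (.of_forall fun ω => ?_)
    simp only
    rw [Real.norm_of_nonneg (by positivity)]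
  refine (h2.const_mul K).mono' (hfc.comp_aestronglyMeasurable hX.aemeasurable.aestronglyMeasurable)
    (.of_forall fun ω => hK (X ω))

end Tame

variable [DecidableEq ι]

/-- Partial derivatives of a function on `ℝ^ι`. -/
def pd (i : ι) (f : (ι → ℝ) → ℝ) (x : ι → ℝ) : ℝ := fderiv ℝ f x (Pi.single i 1)

/-- A `C^1` function which has polynomial growth together with its partial derivatives. -/
structure TameDiff (f : (ι → ℝ) → ℝ) : Prop where
  contDiff : ContDiff ℝ 1 f
  tame : Tame f
  tame_pd : ∀ i, Tame (pd i f)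

theorem pd_mul {f g : (ι → ℝ) → ℝ} (hf : Differentiable ℝ f) (hg : Differentiable ℝ g) (i : ι)
    (x : ι → ℝ) : pd i (fun x => f x * g x) x = pd i f x * g x + f x * pd i g x := by
  simp only [pd]
  rw [fderiv_fun_mul (hf x) (hg x)]
  simp only [add_apply, smul_apply, smul_eq_mul]
  ring

theorem pd_add {f g : (ι → ℝ) → ℝ} (hf : Differentiable ℝ f) (hg : Differentiable ℝ g) (i : ι)
    (x : ι → ℝ) : pd i (fun x => f x + g x) x = pd i f x + pd i g x := by
  simp only [pd]
  rw [fderiv_fun_add (hf x) (hg x)]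
  rfl

theorem pd_const_mul {f : (ι → ℝ) → ℝ} (hf : Differentiable ℝ f) (c : ℝ) (i : ι)
    (x : ι → ℝ) : pd i (fun x => c * f x) x = c * pd i f x := by
  simp only [pd]
  rw [fderiv_const_mul (hf x)]
  rfl

theorem pd_sum {J : Type*} (s : Finset J) {f : J → (ι → ℝ) → ℝ} (hf : ∀ j, Differentiable ℝ (f j))
    (i : ι) (x : ι → ℝ) : pd i (fun x => ∑ j ∈ s, f j x) x = ∑ j ∈ s, pd i (f j) x := by
  simp only [pd]
  rw [fderiv_fun_sum fun j _ => hf j x]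
  simp

theorem pd_coord (i k : ι) (x : ι → ℝ) :
    pd i (fun x => x k) x = if i = k then 1 else 0 := by
  simp only [pd]
  have h : HasFDerivAt (fun x : ι → ℝ => x k)
      (ContinuousLinearMap.proj (R := ℝ) (φ := fun _ : ι => ℝ) k) x := hasFDerivAt_apply k x
  rw [h.fderiv]
  simp [Pi.single_apply, eq_comm]

namespace TameDiff

variable {f g : (ι → ℝ) → ℝ}

theorem diff (hf : TameDiff f) : Differentiable ℝ f := hf.contDiff.differentiable one_ne_zero

theorem coord (k : ι) : TameDiff fun x : ι → ℝ => x k where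
  contDiff := contDiff_apply ℝ ℝ k
  tame := Tame.coord k
  tame_pd i := by
    have : pd i (fun x : ι → ℝ => x k) = fun _ => if i = k then (1 : ℝ) else 0 :=
      funext fun x => pd_coord i k x
    rw [this]; exact Tame.const _

theorem mul (hf : TameDiff f) (hg : TameDiff g) : TameDiff fun x => f x * g x where
  contDiff := hf.contDiff.mul hg.contDiff
  tame := hf.tame.mul hg.tame
  tame_pd i := by
    rw [funext (pd_mul hf.diff hg.diff i)]
    exact ((hf.tame_pd i).mul hg.tame).add (hf.tame.mul (hg.tame_pd i))

theorem add (hf : TameDiff f) (hg : TameDiff g) : TameDiff fun x => f x + g x where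
  contDiff := hf.contDiff.add hg.contDiff
  tame := hf.tame.add hg.tame
  tame_pd i := by
    rw [funext (pd_add hf.diff hg.diff i)]
    exact (hf.tame_pd i).add (hg.tame_pd i)

theorem const_mul (hf : TameDiff f) (c : ℝ) : TameDiff fun x => c * f x where
  contDiff := contDiff_const.mul hf.contDiff
  tame := hf.tame.const_mul c
  tame_pd i := by
    rw [funext (pd_const_mul hf.diff c i)]
    exact (hf.tame_pd i).const_mul c

theorem sum {J : Type*} (s : Finset J) {f : J → (ι → ℝ) → ℝ} (hf : ∀ j, TameDiff (f j)) :
    TameDiff fun x => ∑ j ∈ s, f j x where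
  contDiff := ContDiff.sum fun j _ => (hf j).contDiff
  tame := Tame.sum s fun j => (hf j).tame
  tame_pd i := by
    rw [funext (pd_sum s (fun j => (hf j).diff) i)]
    exact Tame.sum s fun j => (hf j).tame_pd i

end TameDiff

section Gaussian

variable {Ω : Type*} [MeasurableSpace Ω] {P : Measure Ω} {X : Ω → ι → ℝ}

theorem integral_mul_coord (hX : HasGaussianLaw X P) (hmean : ∀ i, ∫ ω, X ω i ∂P = 0) (k : ι)
    {f : (ι → ℝ) → ℝ} (hf : TameDiff f) :
    ∫ ω, f (X ω) * X ω k ∂P = ∑ i, (∫ ω, X ω i * X ω k ∂P) * ∫ ω, pd i f (X ω) ∂P :=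
  integral_mul_gaussian hX hmean k hf.contDiff (hf.tame.integrable hX)
    ((hf.tame.mul (Tame.coord k)).integrable hX) fun i => (hf.tame_pd i).integrable hX

variable {J : Type*} [Fintype J]

/-- For functions `v_j` on `ℝ^ι` and indices `κ j`, the divergence of the vector field
`∑ j, v_j e_{κ j}` with respect to the Gaussian law of covariance `C`. -/
def gaussDiv (C : ι → ι → ℝ) (κ : J → ι) (v : J → (ι → ℝ) → ℝ) (x : ι → ℝ) : ℝ :=
  ∑ j, (v j x * x (κ j) + ∑ n, -C n (κ j) * pd n (v j) x)

theorem TameDiff.gaussDiv {C : ι → ι → ℝ} {κ : J → ι} {v : J → (ι → ℝ) → ℝ}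
    (hv : ∀ j, TameDiff (v j)) (hdv : ∀ j n, TameDiff (pd n (v j))) :
    TameDiff (gaussDiv C κ v) :=
  TameDiff.sum _ fun j => ((hv j).mul (TameDiff.coord _)).add
    (TameDiff.sum _ fun n => (hdv j n).const_mul _)

/-- The divergence is the adjoint of the gradient. -/
theorem integral_mul_gaussDiv (hX : HasGaussianLaw X P) (hmean : ∀ i, ∫ ω, X ω i ∂P = 0)
    {C : ι → ι → ℝ} (hC : ∀ i j, ∫ ω, X ω i * X ω j ∂P = C i j) (κ : J → ι)
    {v : J → (ι → ℝ) → ℝ} (hv : ∀ j, TameDiff (v j)) {g : (ι → ℝ) → ℝ} (hg : TameDiff g) :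
    ∫ ω, g (X ω) * gaussDiv C κ v (X ω) ∂P =
      ∑ j, ∑ n, C n (κ j) * ∫ ω, pd n g (X ω) * v j (X ω) ∂P := by
  have i1 : ∀ j, Integrable (fun ω => g (X ω) * v j (X ω) * X ω (κ j)) P := fun j =>
    ((hg.tame.mul (hv j).tame).mul (Tame.coord (κ j))).integrable hX
  have i2 : ∀ j n, Integrable (fun ω => g (X ω) * pd n (v j) (X ω)) P := fun j n =>
    (hg.tame.mul ((hv j).tame_pd n)).integrable hX
  have i3 : ∀ j n, Integrable (fun ω => pd n g (X ω) * v j (X ω)) P := fun j n =>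
    ((hg.tame_pd n).mul (hv j).tame).integrable hX
  have e : ∀ ω, g (X ω) * gaussDiv C κ v (X ω) = ∑ j, (g (X ω) * v j (X ω) * X ω (κ j) +
      ∑ n, -C n (κ j) * (g (X ω) * pd n (v j) (X ω))) := fun ω => by
    rw [gaussDiv, Finset.mul_sum]
    refine Finset.sum_congr rfl fun j _ => ?_
    rw [mul_add, Finset.mul_sum]
    congr 1
    · ring
    · exact Finset.sum_congr rfl fun n _ => by ring
  simp_rw [e]
  refine (integral_finsetSum _ fun j _ => (i1 j).add
    (integrable_finsetSum _ fun n _ => (i2 j n).const_mul (-C n (κ j)))).trans ?_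
  refine Finset.sum_congr rfl fun j _ => ?_
  simp only [Pi.add_apply]
  rw [integral_add (i1 j) (integrable_finsetSum _ fun n _ => (i2 j n).const_mul _),
    integral_finsetSum _ fun n _ => (i2 j n).const_mul _,
    integral_mul_coord hX hmean (κ j) (hg.mul (hv j)), ← Finset.sum_add_distrib]
  refine Finset.sum_congr rfl fun n _ => ?_
  simp_rw [pd_mul hg.diff (hv j).diff n]
  rw [integral_add (i3 j n) (i2 j n), integral_const_mul, hC]
  ring

/-- The second moment of the divergence. The second derivatives of the `v_j` cancel, because partial
derivatives commute. -/
theorem integral_gaussDiv_mul_self (hX : HasGaussianLaw X P) (hmean : ∀ i, ∫ ω, X ω i ∂P = 0)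
    {C : ι → ι → ℝ} (hC : ∀ i j, ∫ ω, X ω i * X ω j ∂P = C i j) (κ : J → ι)
    {v : J → (ι → ℝ) → ℝ} (hv : ∀ j, TameDiff (v j)) (hdv : ∀ j n, TameDiff (pd n (v j)))
    (hsymm : ∀ j m n x, pd m (pd n (v j)) x = pd n (pd m (v j)) x) :
    ∫ ω, gaussDiv C κ v (X ω) * gaussDiv C κ v (X ω) ∂P =
      ∑ j, ∑ n, C n (κ j) * ∑ k, ((if n = κ k then 1 else 0) * ∫ ω, v k (X ω) * v j (X ω) ∂P +
        ∑ m, C m (κ k) * ∫ ω, pd m (v j) (X ω) * pd n (v k) (X ω) ∂P) := by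
  rw [integral_mul_gaussDiv hX hmean hC κ hv (TameDiff.gaussDiv hv hdv)]
  refine Finset.sum_congr rfl fun j _ => Finset.sum_congr rfl fun n _ => ?_
  congr 1
  have e : ∀ x, pd n (gaussDiv C κ v) x = ∑ k, ((if n = κ k then 1 else 0) * v k x +
      (pd n (v k) x * x (κ k) + ∑ m, -C m (κ k) * pd n (pd m (v k)) x)) := by
    intro x
    unfold gaussDiv
    rw [pd_sum _ fun k => (((hv k).mul (TameDiff.coord _)).add
      (TameDiff.sum _ fun m => (hdv k m).const_mul _)).diff]
    refine Finset.sum_congr rfl fun k _ => ?_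
    rw [pd_add ((hv k).mul (TameDiff.coord _)).diff
      (TameDiff.sum _ fun m => (hdv k m).const_mul _).diff,
      pd_mul (hv k).diff (TameDiff.coord _).diff, pd_coord,
      pd_sum _ fun m => ((hdv k m).const_mul _).diff]
    simp_rw [fun m => pd_const_mul (hdv k m).diff (-C m (κ k)) n x]
    ring
  have i1 : ∀ k, Integrable (fun ω => v k (X ω) * v j (X ω)) P := fun k =>
    ((hv k).tame.mul (hv j).tame).integrable hX
  have i2 : ∀ k, Integrable (fun ω => v j (X ω) * pd n (v k) (X ω) * X ω (κ k)) P := fun k =>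
    (((hv j).tame.mul ((hv k).tame_pd n)).mul (Tame.coord _)).integrable hX
  have i3 : ∀ k m, Integrable (fun ω => v j (X ω) * pd n (pd m (v k)) (X ω)) P := fun k m =>
    ((hv j).tame.mul ((hdv k m).tame_pd n)).integrable hX
  have i4 : ∀ k m, Integrable (fun ω => pd m (v j) (X ω) * pd n (v k) (X ω)) P := fun k m =>
    (((hv j).tame_pd m).mul ((hv k).tame_pd n)).integrable hX
  have e' : ∀ ω, pd n (gaussDiv C κ v) (X ω) * v j (X ω) =
      ∑ k, ((if n = κ k then 1 else 0) * (v k (X ω) * v j (X ω)) +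
      (v j (X ω) * pd n (v k) (X ω) * X ω (κ k) +
        ∑ m, -C m (κ k) * (v j (X ω) * pd n (pd m (v k)) (X ω)))) := by
    intro ω
    rw [e, Finset.sum_mul]
    refine Finset.sum_congr rfl fun k _ => ?_
    rw [add_mul, add_mul, Finset.sum_mul]
    congr 1
    · ring
    congr 1
    · ring
    · exact Finset.sum_congr rfl fun m _ => by ring
  have i5 : ∀ k, Integrable (fun ω =>
      ∑ m, -C m (κ k) * (v j (X ω) * pd n (pd m (v k)) (X ω))) P := fun k =>
    integrable_finsetSum _ fun m _ => (i3 k m).const_mul _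
  have i6 : ∀ k, Integrable (fun ω => v j (X ω) * pd n (v k) (X ω) * X ω (κ k) +
      ∑ m, -C m (κ k) * (v j (X ω) * pd n (pd m (v k)) (X ω))) P := fun k => (i2 k).add (i5 k)
  simp_rw [e']
  refine (integral_finsetSum _ fun k _ => ((i1 k).const_mul _).add (i6 k)).trans ?_
  refine Finset.sum_congr rfl fun k _ => ?_
  simp only [Pi.add_apply]
  rw [integral_add ((i1 k).const_mul _) (i6 k), integral_const_mul,
    integral_add (i2 k) (i5 k), integral_finsetSum _ fun m _ => (i3 k m).const_mul _,
    integral_mul_coord hX hmean (κ k) ((hv j).mul (hdv k n)), ← Finset.sum_add_distrib]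
  congr 1
  refine Finset.sum_congr rfl fun m _ => ?_
  simp_rw [pd_mul (hv j).diff (hdv k n).diff m, hsymm k m n]
  rw [integral_add (i4 k m) (i3 k m), integral_const_mul, hC]
  ring

end Gaussian

end

/-! ### Smooth cylindrical random variables -/

section

/-- The class `C_b^∞`. -/
structure IsCb {E : Type*} [NormedAddCommGroup E] [NormedSpace ℝ E] (f : E → ℝ) : Prop where
  contDiff : ContDiff ℝ (⊤ : ℕ∞) f
  bounded : ∀ k : ℕ, ∃ C : ℝ, ∀ x, ‖iteratedFDeriv ℝ k f x‖ ≤ C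

namespace IsCb

variable {E E' : Type*} [NormedAddCommGroup E] [NormedSpace ℝ E] [NormedAddCommGroup E']
  [NormedSpace ℝ E'] {f g : E → ℝ}

theorem comp_clm (hf : IsCb f) (L : E' →L[ℝ] E) : IsCb (fun x => f (L x)) where
  contDiff := hf.contDiff.comp L.contDiff
  bounded k := by
    obtain ⟨C, hC⟩ := hf.bounded k
    refine ⟨C * ∏ _i : Fin k, ‖L‖, fun x => ?_⟩
    have h := L.iteratedFDeriv_comp_right hf.contDiff x (i := k) (by exact_mod_cast le_top)
    have e : iteratedFDeriv ℝ k (fun x => f (L x)) x =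
      (iteratedFDeriv ℝ k f (L x)).compContinuousLinearMap fun _ => L := h
    rw [e]
    refine (ContinuousMultilinearMap.norm_compContinuousLinearMap_le _ _).trans ?_
    gcongr
    exact hC (L x)

theorem add (hf : IsCb f) (hg : IsCb g) : IsCb (fun x => f x + g x) where
  contDiff := hf.contDiff.add hg.contDiff
  bounded k := by
    obtain ⟨C, hC⟩ := hf.bounded k
    obtain ⟨D, hD⟩ := hg.bounded k
    refine ⟨C + D, fun x => ?_⟩
    have e := fun_iteratedFDeriv_add_apply (𝕜 := ℝ) (i := k) (x := x) (f := f) (g := g)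
      (hf.contDiff.contDiffAt.of_le (by exact_mod_cast le_top))
      (hg.contDiff.contDiffAt.of_le (by exact_mod_cast le_top))
    rw [e]
    exact (norm_add_le _ _).trans (add_le_add (hC x) (hD x))

theorem const_mul (hf : IsCb f) (c : ℝ) : IsCb (fun x => c * f x) where
  contDiff := contDiff_const.mul hf.contDiff
  bounded k := by
    obtain ⟨C, hC⟩ := hf.bounded k
    refine ⟨‖c‖ * C, fun x => ?_⟩
    have e := iteratedFDeriv_const_smul_apply (𝕜 := ℝ) (i := k) (x := x) (f := f) (a := c)
      (hf.contDiff.contDiffAt.of_le (by exact_mod_cast le_top))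
    have e' : iteratedFDeriv ℝ k (fun x => c * f x) x = c • iteratedFDeriv ℝ k f x := e
    rw [e', norm_smul]
    gcongr
    exact hC x

theorem exists_abs_le (hf : IsCb f) : ∃ C, ∀ x, |f x| ≤ C := by
  obtain ⟨C, hC⟩ := hf.bounded 0
  exact ⟨C, fun x => by simpa [norm_iteratedFDeriv_zero] using hC x⟩

theorem cos (L : E →L[ℝ] ℝ) : IsCb fun x => Real.cos (L x) :=
  comp_clm (f := Real.cos) ⟨Real.contDiff_cos, fun k => ⟨1, fun x => by
    rw [norm_iteratedFDeriv_eq_norm_iteratedDeriv]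
    exact Real.abs_iteratedDeriv_cos_le_one k x⟩⟩ L

theorem sin (L : E →L[ℝ] ℝ) : IsCb fun x => Real.sin (L x) :=
  comp_clm (f := Real.sin) ⟨Real.contDiff_sin, fun k => ⟨1, fun x => by
    rw [norm_iteratedFDeriv_eq_norm_iteratedDeriv]
    exact Real.abs_iteratedDeriv_sin_le_one k x⟩⟩ L

variable {ι : Type*} [Fintype ι] [DecidableEq ι] {f : (ι → ℝ) → ℝ}

theorem pd (hf : IsCb f) (i : ι) : IsCb (pd i f) where
  contDiff := by
    have := hf.contDiff.fderiv_right (m := (⊤ : ℕ∞)) (by exact_mod_cast le_rfl)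
    exact this.clm_apply contDiff_const
  bounded k := by
    obtain ⟨C, hC⟩ := hf.bounded (k + 1)
    have hd := hf.contDiff.fderiv_right (m := (⊤ : ℕ∞)) (by exact_mod_cast le_rfl)
    set A : ((ι → ℝ) →L[ℝ] ℝ) →L[ℝ] ℝ := ContinuousLinearMap.apply ℝ ℝ (Pi.single i 1)
    refine ⟨‖A‖ * C, fun x => ?_⟩
    have := A.norm_iteratedFDeriv_comp_left (f := fderiv ℝ f) (x := x) (n := k)
      hd.contDiffAt (by exact_mod_cast le_top)
    refine le_trans this ?_
    rw [norm_iteratedFDeriv_fderiv]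
    gcongr
    exact hC x

theorem tameDiff (hf : IsCb f) : TameDiff f where
  contDiff := hf.contDiff.of_le (by exact_mod_cast le_top)
  tame := let ⟨_, hC⟩ := hf.exists_abs_le; Tame.of_bounded hf.contDiff.continuous hC
  tame_pd i := let ⟨_, hC⟩ := (hf.pd i).exists_abs_le
    Tame.of_bounded (hf.pd i).contDiff.continuous hC

theorem pd_comm (hf : IsCb f) (m n : ι) (x : ι → ℝ) :
    FracBM.pd m (FracBM.pd n f) x = FracBM.pd n (FracBM.pd m f) x := by
  have hs : IsSymmSndFDerivAt ℝ f x := hf.contDiff.contDiffAt.isSymmSndFDerivAt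
    (by simp only [minSmoothness_of_isRCLikeNormedField]; exact WithTop.coe_le_coe.2 le_top)
  have hd := (hf.contDiff.fderiv_right (m := (⊤ : ℕ∞)) (by exact_mod_cast le_rfl)).differentiable
    (by simp)
  have e : ∀ m n : ι, FracBM.pd m (FracBM.pd n f) x =
      fderiv ℝ (fderiv ℝ f) x (Pi.single m 1) (Pi.single n 1) := fun m n => by
    have := ((hd x).hasFDerivAt.clm_apply
      (hasFDerivAt_const (Pi.single n (1 : ℝ) : ι → ℝ) x)).fderiv
    show fderiv ℝ (fun y => fderiv ℝ f y (Pi.single n 1)) x (Pi.single m 1) = _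
    rw [this]
    simp
  rw [e, e]
  exact hs _ _

end IsCb

/-- Change of variables in the gradient of a cylindrical random variable. -/
theorem sum_pd_comp_smul {ι κ E : Type*} [Fintype ι] [DecidableEq ι] [Fintype κ] [DecidableEq κ]
    [AddCommGroup E] [Module ℝ E] {f : (ι → ℝ) → ℝ} (hf : Differentiable ℝ f) (q : ι → κ)
    (h : κ → E) (x : κ → ℝ) :
    ∑ k, pd k (fun y : κ → ℝ => f fun i => y (q i)) x • h k =
      ∑ i, pd i f (fun i => x (q i)) • h (q i) := by
  set L : (κ → ℝ) →L[ℝ] (ι → ℝ) :=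
    ContinuousLinearMap.pi fun i => ContinuousLinearMap.proj (R := ℝ) (φ := fun _ : κ => ℝ) (q i)
  have e : ∀ k, pd k (fun y : κ → ℝ => f fun i => y (q i)) x =
      ∑ i, (if q i = k then pd i f (fun i => x (q i)) else 0) := fun k => by
    have h1 : HasFDerivAt (fun y : κ → ℝ => f (L y)) ((fderiv ℝ f (L x)).comp L) x :=
      (hf (L x)).hasFDerivAt.comp x L.hasFDerivAt
    have h2 : pd k (fun y : κ → ℝ => f fun i => y (q i)) x =
        fderiv ℝ f (L x) (L (Pi.single k 1)) := by
      simp only [pd]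
      exact congrArg (fun A : (κ → ℝ) →L[ℝ] ℝ => A (Pi.single k 1)) h1.fderiv
    rw [h2, fderiv_apply_eq_sum]
    refine Finset.sum_congr rfl fun i _ => ?_
    have : L (Pi.single k 1) i = if q i = k then 1 else 0 := by
      show (Pi.single k 1 : κ → ℝ) (q i) = _
      rw [Pi.single_apply]
    rw [this, ite_mul, one_mul, zero_mul]
    rfl
  simp_rw [e, Finset.sum_smul, ite_smul, zero_smul]
  rw [Finset.sum_comm]
  simp

variable {H : ℝ} {hH : H ∈ Ioo (1 / 2 : ℝ) 1} {Ω : Type*} {B : I → Ω → ℝ}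

/-- Smooth cylindrical random variables may be indexed by any finite family of times. -/
theorem isSmoothCyl_of_fintype {ι : Type*} [Fintype ι] [DecidableEq ι] (τ : ι → I)
    {f : (ι → ℝ) → ℝ} (hf : IsCb f) :
    IsSmoothCyl hH B (fun ω => f fun i => B (τ i) ω)
      (fun ω => ∑ i, pd i f (fun i => B (τ i) ω) • ind hH (τ i)) := by
  set e := (Fintype.equivFin ι).symm
  have hf' : IsCb fun y : Fin (Fintype.card ι) → ℝ => f fun i => y (e.symm i) :=
    hf.comp_clm (ContinuousLinearMap.pi fun i =>
      ContinuousLinearMap.proj (R := ℝ) (φ := fun _ : Fin (Fintype.card ι) => ℝ) (e.symm i))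
  refine ⟨Fintype.card ι, fun k => τ (e k), fun y => f fun i => y (e.symm i), hf'.contDiff,
    hf'.bounded, ?_, ?_⟩
  · funext ω; simp
  · funext ω
    have := sum_pd_comp_smul hf.tameDiff.diff e.symm (fun k => ind hH (τ (e k)))
      (fun k => B (τ (e k)) ω)
    simp only [Equiv.apply_symm_apply] at this
    exact this.symm

/-- A smooth cylindrical random variable is a function of the values of `B` on any finite set of
times that is large enough. -/
theorem IsSmoothCyl.exists_finset {F : Ω → ℝ} {DF : Ω → Hsp H hH} (h : IsSmoothCyl hH B F DF) :
    ∃ T₀ : Finset I, ∀ T : Finset I, T₀ ⊆ T → ∃ f : (T → ℝ) → ℝ, IsCb f ∧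
      (F = fun ω => f fun i => B i ω) ∧
      DF = fun ω => ∑ i : T, pd i f (fun i => B i ω) • ind hH i := by
  classical
  obtain ⟨d, t, f, h1, h2, rfl, rfl⟩ := h
  refine ⟨Finset.univ.image t, fun T hT => ?_⟩
  have hf : IsCb f := ⟨h1, h2⟩
  set q : Fin d → T := fun i => ⟨t i, hT (Finset.mem_image_of_mem t (Finset.mem_univ i))⟩
  refine ⟨fun y => f fun i => y (q i), hf.comp_clm (ContinuousLinearMap.pi fun i =>
    ContinuousLinearMap.proj (R := ℝ) (φ := fun _ : T => ℝ) (q i)), rfl, ?_⟩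
  funext ω
  exact (sum_pd_comp_smul hf.tameDiff.diff q (fun k : T => ind hH k) (fun k => B k ω)).symm

/-- Finitely many smooth cylindrical random variables are functions of the values of `B` on a
common finite set of times. -/
theorem exists_common_finset {J : Type*} [Fintype J] {F : J → Ω → ℝ} {DF : J → Ω → Hsp H hH}
    (h : ∀ j, IsSmoothCyl hH B (F j) (DF j)) (T₁ : Finset I) :
    ∃ T : Finset I, T₁ ⊆ T ∧ ∃ f : J → (T → ℝ) → ℝ, (∀ j, IsCb (f j)) ∧
      (∀ j, F j = fun ω => f j fun i => B i ω) ∧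
      ∀ j, DF j = fun ω => ∑ i : T, pd i (f j) (fun i => B i ω) • ind hH i := by
  classical
  choose T₀ hT₀ using fun j => (h j).exists_finset
  have hsub : ∀ j, T₀ j ⊆ T₁ ∪ Finset.univ.biUnion T₀ := fun j =>
    (Finset.subset_biUnion_of_mem T₀ (Finset.mem_univ j)).trans Finset.subset_union_right
  choose f h1 h2 h3 using fun j => hT₀ j _ (hsub j)
  exact ⟨_, Finset.subset_union_left, f, h1, h2, h3⟩

theorem IsSmoothCyl.add {F G : Ω → ℝ} {DF DG : Ω → Hsp H hH} (hF : IsSmoothCyl hH B F DF)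
    (hG : IsSmoothCyl hH B G DG) :
    IsSmoothCyl hH B (fun ω => F ω + G ω) (fun ω => DF ω + DG ω) := by
  obtain ⟨T₁, h1⟩ := hF.exists_finset
  obtain ⟨T₂, h2⟩ := hG.exists_finset
  obtain ⟨f, hf, rfl, rfl⟩ := h1 (T₁ ∪ T₂) Finset.subset_union_left
  obtain ⟨g, hg, rfl, rfl⟩ := h2 (T₁ ∪ T₂) Finset.subset_union_right
  have := isSmoothCyl_of_fintype (hH := hH) (B := B) (fun i : (T₁ ∪ T₂ : Finset I) => (i : I))
    (hf.add hg)
  simp_rw [pd_add hf.tameDiff.diff hg.tameDiff.diff, add_smul, Finset.sum_add_distrib] at this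
  exact this

theorem IsSmoothCyl.const_mul {F : Ω → ℝ} {DF : Ω → Hsp H hH} (hF : IsSmoothCyl hH B F DF)
    (c : ℝ) : IsSmoothCyl hH B (fun ω => c * F ω) (fun ω => c • DF ω) := by
  obtain ⟨T₁, h1⟩ := hF.exists_finset
  obtain ⟨f, hf, rfl, rfl⟩ := h1 T₁ subset_rfl
  have := isSmoothCyl_of_fintype (hH := hH) (B := B) (fun i : T₁ => (i : I)) (hf.const_mul c)
  simp_rw [pd_const_mul hf.tameDiff.diff, mul_smul, ← Finset.smul_sum] at this
  exact this

theorem sum_comm_four {J K : Type*} [Fintype J] [Fintype K] (f : J → J → K → K → ℝ) :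
    ∑ j, ∑ k, ∑ p, ∑ q, f j k p q = ∑ p, ∑ q, ∑ j, ∑ k, f j k p q := by
  calc _ = ∑ j, ∑ p, ∑ k, ∑ q, f j k p q := Finset.sum_congr rfl fun _ _ => Finset.sum_comm
    _ = ∑ p, ∑ j, ∑ k, ∑ q, f j k p q := Finset.sum_comm
    _ = ∑ p, ∑ j, ∑ q, ∑ k, f j k p q :=
      Finset.sum_congr rfl fun _ _ => Finset.sum_congr rfl fun _ _ => Finset.sum_comm
    _ = _ := Finset.sum_congr rfl fun _ _ => Finset.sum_comm

/-- `tr (T²) ≤ ‖T‖²` for the Hilbert–Schmidt operator `T = ∑ j, a_j ⊗ e_j`. -/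
theorem sum_inner_mul_inner_le {E J : Type*} [NormedAddCommGroup E] [InnerProductSpace ℝ E]
    [Fintype J] (a e : J → E) :
    ∑ j, ∑ k, inner ℝ (a j) (e k) * inner ℝ (a k) (e j) ≤
      ∑ j, ∑ k, inner ℝ (a j) (a k) * inner ℝ (e j) (e k) := by
  set S : Submodule ℝ E := Submodule.span ℝ (range a ∪ range e) with hS
  have : FiniteDimensional ℝ S :=
    FiniteDimensional.span_of_finite ℝ ((finite_range a).union (finite_range e))
  set b := stdOrthonormalBasis ℝ S
  have hin : ∀ x y : E, x ∈ S → y ∈ S →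
      inner ℝ x y = ∑ p, inner ℝ x (b p : E) * inner ℝ y (b p : E) := by
    intro x y hx hy
    have := b.sum_inner_mul_inner (⟨x, hx⟩ : S) ⟨y, hy⟩
    simp only [Submodule.coe_inner] at this
    rw [← this]
    exact Finset.sum_congr rfl fun p _ => by rw [real_inner_comm y]
  have ha : ∀ j, a j ∈ S := fun j => Submodule.subset_span (Or.inl (mem_range_self j))
  have he : ∀ j, e j ∈ S := fun j => Submodule.subset_span (Or.inr (mem_range_self j))
  set T : Fin _ → Fin _ → ℝ := fun p q => ∑ j, inner ℝ (a j) (b p : E) * inner ℝ (e j) (b q : E)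
  have h1 : ∑ j, ∑ k, inner ℝ (a j) (e k) * inner ℝ (a k) (e j) = ∑ p, ∑ q, T p q * T q p := by
    simp only [T, Finset.sum_mul_sum, fun j k => hin (a j) (e k) (ha j) (he k)]
    rw [sum_comm_four]
    exact Finset.sum_congr rfl fun p _ => Finset.sum_congr rfl fun q _ =>
      Finset.sum_congr rfl fun j _ => Finset.sum_congr rfl fun k _ => by ring
  have h2 : ∑ j, ∑ k, inner ℝ (a j) (a k) * inner ℝ (e j) (e k) = ∑ p, ∑ q, T p q * T p q := by
    simp only [T, Finset.sum_mul_sum, fun j k => hin (a j) (a k) (ha j) (ha k),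
      fun j k => hin (e j) (e k) (he j) (he k)]
    rw [sum_comm_four]
    exact Finset.sum_congr rfl fun p _ => Finset.sum_congr rfl fun q _ =>
      Finset.sum_congr rfl fun j _ => Finset.sum_congr rfl fun k _ => by ring
  rw [h1, h2]
  have h3 : ∑ p, ∑ q, T p q * T p q = ∑ p, ∑ q, (T p q * T p q + T q p * T q p) / 2 := by
    have := Finset.sum_comm (s := Finset.univ) (t := Finset.univ) (f := fun p q => T p q * T p q)
    simp_rw [← Finset.sum_div, Finset.sum_add_distrib]
    rw [← this]
    ring
  rw [h3]
  refine Finset.sum_le_sum fun p _ => Finset.sum_le_sum fun q _ => ?_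
  nlinarith [sq_nonneg (T p q - T q p)]

end

/-! ### The divergence of smooth elementary processes -/

section

variable {H : ℝ} {hH : H ∈ Ioo (1 / 2 : ℝ) 1} {Ω : Type*} [MeasurableSpace Ω]
  {B : I → Ω → ℝ} {P : Measure Ω}

theorem IsFBM.hasGaussianLaw (hB : IsFBM H B P) (T : Finset I) :
    HasGaussianLaw (fun ω (i : T) => B i ω) P := by
  have := hB.gaussian.hasGaussianLaw T
  exact this

/-- The divergence of the smooth random element `∑ j, F_j 𝟙_{[0,s_j]}` of `𝔥`. -/
def smoothDiv {Ω : Type*} (hH : H ∈ Ioo (1 / 2 : ℝ) 1) (B : I → Ω → ℝ) {J : Type*} [Fintype J] (s : J → I)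
    (F : J → Ω → ℝ) (DF : J → Ω → Hsp H hH) (ω : Ω) : ℝ :=
  ∑ j, (F j ω * B (s j) ω - inner ℝ (DF j ω) (ind hH (s j)))

section

variable {T : Finset I} {J : Type*} [Fintype J] (κ : J → T) {f : J → (T → ℝ) → ℝ}

theorem smoothDiv_eq_gaussDiv {Ω : Type*} {B : I → Ω → ℝ} (ω : Ω) :
    smoothDiv hH B (fun j => (κ j : I)) (fun j ω => f j fun i : T => B i ω)
      (fun j ω => ∑ i : T, pd i (f j) (fun i => B i ω) • ind hH i) ω =
    gaussDiv (fun i j : T => cov H i j) κ f (fun i => B i ω) := by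
  unfold smoothDiv gaussDiv
  refine Finset.sum_congr rfl fun j _ => ?_
  rw [sum_inner, sub_eq_add_neg, ← Finset.sum_neg_distrib]
  congr 1
  refine Finset.sum_congr rfl fun n _ => ?_
  rw [real_inner_smul_left, inner_ind]
  ring

end

/-- The divergence of a smooth random element is square integrable, satisfies the duality
formula, and its second moment is that of `∑ j, F_j 𝟙_{[0,s_j]}` plus a trace term. -/
theorem smoothDiv_spec (hB : IsFBM H B P) {J : Type*} [Fintype J] (s : J → I)
    {F : J → Ω → ℝ} {DF : J → Ω → Hsp H hH} (hF : ∀ j, IsSmoothCyl hH B (F j) (DF j)) :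
    MemLp (smoothDiv hH B s F DF) 2 P ∧
    (∀ G DG, IsSmoothCyl hH B G DG → ∫ ω, G ω * smoothDiv hH B s F DF ω ∂P =
      ∑ j, ∫ ω, F j ω * inner ℝ (DG ω) (ind hH (s j)) ∂P) ∧
    ∫ ω, smoothDiv hH B s F DF ω ^ 2 ∂P ≤ ∑ j, ∑ k, inner ℝ (ind hH (s j)) (ind hH (s k)) *
      (∫ ω, F j ω * F k ω ∂P + ∫ ω, inner ℝ (DF j ω) (DF k ω) ∂P) := by
  classical
  have key : ∀ T₁ : Finset I, ∃ T : Finset I, T₁ ⊆ T ∧ ∃ (κ : J → T) (f : J → (T → ℝ) → ℝ),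
      (∀ j, IsCb (f j)) ∧ (s = fun j => (κ j : I)) ∧
      (F = fun j ω => f j fun i : T => B i ω) ∧
      DF = fun j ω => ∑ i : T, pd i (f j) (fun i => B i ω) • ind hH i := by
    intro T₁
    obtain ⟨T, hT, f, h1, h2, h3⟩ := exists_common_finset hF (T₁ ∪ Finset.univ.image s)
    refine ⟨T, Finset.subset_union_left.trans hT, fun j => ⟨s j, hT (Finset.mem_union_right _
      (Finset.mem_image_of_mem s (Finset.mem_univ j)))⟩, f, h1, rfl, funext h2, funext h3⟩
  have hmean : ∀ (T : Finset I) (i : T), ∫ ω, (fun ω (i : T) => B i ω) ω i ∂P = 0 :=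
    fun T i => hB.mean_zero i
  have hC : ∀ (T : Finset I) (i j : T), ∫ ω, (fun ω (i : T) => B i ω) ω i *
      (fun ω (i : T) => B i ω) ω j ∂P = cov H i j := fun T i j => hB.covariance i j
  refine ⟨?_, ?_, ?_⟩
  · obtain ⟨T, -, κ, f, hf, rfl, rfl, rfl⟩ := key ∅
    have ht := (TameDiff.gaussDiv (C := fun i j : T => cov H i j) (κ := κ)
      (fun j => (hf j).tameDiff) fun j n => ((hf j).pd n).tameDiff)
    rw [funext (smoothDiv_eq_gaussDiv (hH := hH) (B := B) κ), memLp_two_iff_integrable_sq]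
    · simp_rw [sq]
      exact (ht.tame.mul ht.tame).integrable (hB.hasGaussianLaw T)
    · exact (ht.tame.integrable (hB.hasGaussianLaw T)).1
  · intro G DG hG
    obtain ⟨T₀, h0⟩ := hG.exists_finset
    obtain ⟨T, hT, κ, f, hf, rfl, rfl, rfl⟩ := key T₀
    obtain ⟨g, hg, rfl, rfl⟩ := h0 T hT
    simp_rw [smoothDiv_eq_gaussDiv]
    rw [integral_mul_gaussDiv (hB.hasGaussianLaw T) (hmean T) (hC T) κ
      (fun j => (hf j).tameDiff) hg.tameDiff]
    refine Finset.sum_congr rfl fun j _ => ?_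
    have hi : ∀ n, Integrable (fun ω => pd n g (fun i : T => B i ω) * f j fun i : T => B i ω) P :=
      fun n => ((hg.pd n).tameDiff.tame.mul (hf j).tameDiff.tame).integrable (hB.hasGaussianLaw T)
    simp_rw [← integral_const_mul]
    rw [← integral_finsetSum _ fun n _ => (hi n).const_mul _]
    congr 1
    funext ω
    rw [sum_inner, Finset.mul_sum]
    refine Finset.sum_congr rfl fun n _ => ?_
    rw [real_inner_smul_left, inner_ind]
    ring
  · obtain ⟨T, -, κ, f, hf, rfl, rfl, rfl⟩ := key ∅
    set X : Ω → T → ℝ := fun ω i => B i ω with hX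
    have hG := hB.hasGaussianLaw T
    set a : J → Ω → Hsp H hH := fun j ω => ∑ i : T, pd i (f j) (X ω) • ind hH i with ha
    have ta : ∀ j (t : I), Tame fun x => inner ℝ (∑ i : T, pd i (f j) x • ind hH i)
        (ind hH t) := fun j t => by
      simp_rw [sum_inner, real_inner_smul_left]
      exact Tame.sum _ fun i => (((hf j).pd i).tameDiff.tame.mul (Tame.const _))
    have taa : ∀ j k, Tame fun x => inner ℝ (∑ i : T, pd i (f j) x • ind hH i)
        (∑ i : T, pd i (f k) x • ind hH i) := fun j k => by
      simp_rw [inner_sum, real_inner_smul_right]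
      exact Tame.sum _ fun i => (((hf k).pd i).tameDiff.tame.mul (ta j i))
    have i1 : ∀ j k, Integrable (fun ω => inner ℝ (a j ω) (ind hH (κ k)) *
        inner ℝ (a k ω) (ind hH (κ j))) P := fun j k => ((ta j _).mul (ta k _)).integrable hG
    have i2 : ∀ j k, Integrable (fun ω => inner ℝ (a j ω) (a k ω)) P := fun j k =>
      (taa j k).integrable hG
    have i3 : ∀ j k m n, Integrable (fun ω => pd m (f j) (X ω) * pd n (f k) (X ω)) P :=
      fun j k m n => (((hf j).pd m).tameDiff.tame.mul ((hf k).pd n).tameDiff.tame).integrable hG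
    have e1 : ∫ ω, smoothDiv hH B (fun j => (κ j : I)) (fun j ω => f j (X ω)) a ω ^ 2 ∂P =
        ∑ j, ∑ k, (inner ℝ (ind hH (κ j)) (ind hH (κ k)) * ∫ ω, f j (X ω) * f k (X ω) ∂P +
          ∫ ω, inner ℝ (a j ω) (ind hH (κ k)) * inner ℝ (a k ω) (ind hH (κ j)) ∂P) := by
      have e0 : ∀ ω, smoothDiv hH B (fun j => (κ j : I)) (fun j ω => f j (X ω)) a ω =
          gaussDiv (fun i j : T => cov H i j) κ f (X ω) := smoothDiv_eq_gaussDiv κ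
      simp_rw [e0, sq]
      rw [integral_gaussDiv_mul_self hG (hmean T) (hC T) κ (fun j => (hf j).tameDiff)
        (fun j n => ((hf j).pd n).tameDiff) fun j m n x => (hf j).pd_comm m n x]
      refine Finset.sum_congr rfl fun j _ => ?_
      simp_rw [Finset.mul_sum, mul_add, ← mul_assoc]
      rw [Finset.sum_comm]
      refine Finset.sum_congr rfl fun k _ => ?_
      rw [Finset.sum_add_distrib]
      congr 1
      · simp only [mul_ite, mul_one, mul_zero, ite_mul, zero_mul, Finset.sum_ite_eq',
          Finset.mem_univ, if_true]
        rw [inner_ind, cov_comm]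
        congr 1
        exact integral_congr_ae (ae_of_all _ fun ω => mul_comm _ _)
      · simp_rw [Finset.mul_sum, ← integral_const_mul]
        have e : ∀ ω, inner ℝ (a j ω) (ind hH (κ k)) * inner ℝ (a k ω) (ind hH (κ j)) =
            ∑ n : T, ∑ m : T, cov H n (κ j) * (cov H m (κ k) *
              (pd m (f j) (X ω) * pd n (f k) (X ω))) := fun ω => by
          simp only [ha]
          rw [mul_comm, sum_inner, sum_inner, Finset.sum_mul_sum]
          refine Finset.sum_congr rfl fun n _ => Finset.sum_congr rfl fun m _ => ?_
          rw [real_inner_smul_left, real_inner_smul_left, inner_ind, inner_ind]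
          ring
        simp_rw [e]
        have i4 : ∀ n m : T, Integrable (fun ω => cov H n (κ j) * (cov H m (κ k) *
              (pd m (f j) (X ω) * pd n (f k) (X ω)))) P := fun n m =>
          ((i3 j k m n).const_mul _).const_mul _
        rw [integral_finsetSum _ fun n _ => integrable_finsetSum _ fun m _ => i4 n m]
        exact Finset.sum_congr rfl fun n _ => (integral_finsetSum _ fun m _ => i4 n m).symm
    rw [e1]
    have e2 : ∑ j, ∑ k, inner ℝ (ind hH (κ j)) (ind hH (κ k)) *
        (∫ ω, f j (X ω) * f k (X ω) ∂P + ∫ ω, inner ℝ (a j ω) (a k ω) ∂P) =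
        ∑ j, ∑ k, (inner ℝ (ind hH (κ j)) (ind hH (κ k)) * ∫ ω, f j (X ω) * f k (X ω) ∂P) +
        ∫ ω, ∑ j, ∑ k, inner ℝ (a j ω) (a k ω) * inner ℝ (ind hH (κ j)) (ind hH (κ k)) ∂P := by
      rw [integral_finsetSum _ fun j _ => integrable_finsetSum _ fun k _ => (i2 j k).mul_const _,
        ← Finset.sum_add_distrib]
      refine Finset.sum_congr rfl fun j _ => ?_
      rw [integral_finsetSum _ fun k _ => (i2 j k).mul_const _, ← Finset.sum_add_distrib]
      refine Finset.sum_congr rfl fun k _ => ?_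
      rw [integral_mul_const]
      ring
    rw [e2]
    simp_rw [Finset.sum_add_distrib]
    refine add_le_add_right ?_ _
    simp_rw [← integral_finsetSum _ fun k _ => i1 _ k]
    rw [← integral_finsetSum _ fun j _ => integrable_finsetSum _ fun k _ => i1 j k]
    exact integral_mono (integrable_finsetSum _ fun j _ => integrable_finsetSum _ fun k _ => i1 j k)
      (integrable_finsetSum _ fun j _ => integrable_finsetSum _ fun k _ => (i2 j k).mul_const _)
      fun ω => sum_inner_mul_inner_le (fun j => a j ω) fun j => ind hH (κ j)

end

/-! ### The space `𝔻^{1,2}` and the estimate of the divergence -/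

section

variable {H : ℝ} {hH : H ∈ Ioo (1 / 2 : ℝ) 1} {Ω : Type*} [MeasurableSpace Ω]
  {B : I → Ω → ℝ} {P : Measure Ω}

theorem isSmoothCyl_zero {Ω : Type*} {B : I → Ω → ℝ} :
    IsSmoothCyl hH B (fun _ => 0) (fun _ => 0) := by
  have := (isSmoothCyl_of_fintype (hH := hH) (B := B) (ι := Empty) (fun i => i.elim)
    (IsCb.cos (0 : (Empty → ℝ) →L[ℝ] ℝ))).const_mul 0
  simpa using this

theorem IsSmoothCyl.exists_bound (hm : ∀ t, Measurable (B t)) {F : Ω → ℝ} {DF : Ω → Hsp H hH}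
    (h : IsSmoothCyl hH B F DF) : Measurable F ∧ StronglyMeasurable DF ∧
      ∃ C, (∀ ω, |F ω| ≤ C) ∧ ∀ ω, ‖DF ω‖ ≤ C := by
  obtain ⟨T, hT⟩ := h.exists_finset
  obtain ⟨f, hf, rfl, rfl⟩ := hT T subset_rfl
  have hX : Measurable fun ω (i : T) => B i ω := measurable_pi_lambda _ fun i => hm i
  obtain ⟨C, hC⟩ := hf.exists_abs_le
  choose D hD using fun i => (hf.pd i).exists_abs_le
  refine ⟨hf.contDiff.continuous.measurable.comp hX, ?_,
    max C (∑ i : T, D i * ‖ind hH i‖), fun ω => (hC _).trans (le_max_left _ _), fun ω => ?_⟩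
  · refine Finset.stronglyMeasurable_fun_sum _ fun i _ => ?_
    exact ((hf.pd i).contDiff.continuous.measurable.comp hX).stronglyMeasurable.smul_const _
  · refine le_trans (norm_sum_le_of_le _ fun i _ => ?_) (le_max_right _ _)
    rw [norm_smul]
    exact mul_le_mul_of_nonneg_right (hD i _) (norm_nonneg _)

theorem IsSmoothCyl.memLp [IsFiniteMeasure P] (hm : ∀ t, Measurable (B t)) {F : Ω → ℝ}
    {DF : Ω → Hsp H hH} (h : IsSmoothCyl hH B F DF) : MemLp F 2 P ∧ MemLp DF 2 P := by
  obtain ⟨h1, h2, C, h3, h4⟩ := h.exists_bound hm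
  exact ⟨MemLp.of_bound h1.aestronglyMeasurable C (ae_of_all _ h3),
    MemLp.of_bound h2.aestronglyMeasurable C (ae_of_all _ h4)⟩

/-- The Hilbert space `L²(Ω) × L²(Ω; 𝔥)`, in which `𝔻^{1,2}` is embedded by `F ↦ (F, DF)`. -/
abbrev PairSpace (hH : H ∈ Ioo (1 / 2 : ℝ) 1) (P : Measure Ω) : Type _ :=
  WithLp 2 (Lp ℝ 2 P × Lp (Hsp H hH) 2 P)

/-- The pairs `(F, DF)` with `F` smooth and cylindrical. -/
def smoothPairs (hH : H ∈ Ioo (1 / 2 : ℝ) 1) (B : I → Ω → ℝ) (P : Measure Ω) :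
    Submodule ℝ (PairSpace hH P) where
  carrier := {w | ∃ F DF, IsSmoothCyl hH B F DF ∧ w.fst =ᵐ[P] F ∧ w.snd =ᵐ[P] DF}
  add_mem' := by
    rintro a b ⟨F, DF, h, h1, h2⟩ ⟨G, DG, h', h1', h2'⟩
    exact ⟨_, _, h.add h', (Lp.coeFn_add _ _).trans (h1.add h1'),
      (Lp.coeFn_add _ _).trans (h2.add h2')⟩
  zero_mem' := ⟨_, _, isSmoothCyl_zero, Lp.coeFn_zero _ _ _, Lp.coeFn_zero _ _ _⟩
  smul_mem' := by
    rintro c a ⟨F, DF, h, h1, h2⟩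
    exact ⟨_, _, h.const_mul c, (Lp.coeFn_smul _ _).trans (h1.const_smul c),
      (Lp.coeFn_smul _ _).trans (h2.const_smul c)⟩

/-- The space `𝔻^{1,2}`, as the closed subspace of the pairs `(F, DF)`. -/
def sobolev (hH : H ∈ Ioo (1 / 2 : ℝ) 1) (B : I → Ω → ℝ) (P : Measure Ω) :
    Submodule ℝ (PairSpace hH P) :=
  (smoothPairs hH B P).topologicalClosure

theorem smoothPairs_le_sobolev : smoothPairs hH B P ≤ sobolev hH B P :=
  Submodule.le_topologicalClosure _

theorem isClosed_sobolev : IsClosed (sobolev hH B P : Set (PairSpace hH P)) :=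
  Submodule.isClosed_topologicalClosure _

/-- The point `(F, DF)` of `L²(Ω) × L²(Ω; 𝔥)`. -/
def toPair {F : Ω → ℝ} {DF : Ω → Hsp H hH} (hF : MemLp F 2 P) (hDF : MemLp DF 2 P) :
    PairSpace hH P := WithLp.toLp 2 (hF.toLp F, hDF.toLp DF)

theorem toPair_mem_smoothPairs {F : Ω → ℝ} {DF : Ω → Hsp H hH} (hF : MemLp F 2 P)
    (hDF : MemLp DF 2 P) (h : IsSmoothCyl hH B F DF) : toPair hF hDF ∈ smoothPairs hH B P :=
  ⟨F, DF, h, hF.coeFn_toLp, hDF.coeFn_toLp⟩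

theorem HasMalliavinDeriv.mem_sobolev [IsFiniteMeasure P] (hm : ∀ t, Measurable (B t)) {F : Ω → ℝ}
    {DF : Ω → Hsp H hH} (h : HasMalliavinDeriv hH B P F DF) :
    toPair h.1 h.2.1 ∈ sobolev hH B P := by
  obtain ⟨h1, h2, G, DG, hs, hG, hDG⟩ := h
  refine mem_closure_of_tendsto (f := fun k => toPair ((hs k).memLp hm).1 ((hs k).memLp hm).2)
    (b := atTop) ?_ (Eventually.of_forall fun k => toPair_mem_smoothPairs _ _ (hs k))
  refine ((WithLp.prod_continuous_toLp 2 _ _).tendsto _).comp (Tendsto.prodMk_nhds ?_ ?_)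
  · exact (Lp.tendsto_Lp_iff_tendsto_eLpNorm'' _ _ _ _).2 hG
  · exact (Lp.tendsto_Lp_iff_tendsto_eLpNorm'' _ _ _ _).2 hDG

theorem IsSmoothCyl.hasMalliavinDeriv [IsFiniteMeasure P] (hm : ∀ t, Measurable (B t)) {F : Ω → ℝ}
    {DF : Ω → Hsp H hH} (h : IsSmoothCyl hH B F DF) : HasMalliavinDeriv hH B P F DF :=
  ⟨(h.memLp hm).1, (h.memLp hm).2, fun _ => F, fun _ => DF, fun _ => h, by simp, by simp⟩

theorem norm_sq_toLp {E : Type*} [NormedAddCommGroup E] [InnerProductSpace ℝ E] {F : Ω → E}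
    (hF : MemLp F 2 P) : ‖hF.toLp F‖ ^ 2 = ∫ ω, ‖F ω‖ ^ 2 ∂P := by
  rw [← real_inner_self_eq_norm_sq, L2.inner_def]
  refine integral_congr_ae (hF.coeFn_toLp.mono fun ω h => ?_)
  simp only [h, real_inner_self_eq_norm_sq]

theorem norm_toPair {F : Ω → ℝ} {DF : Ω → Hsp H hH} (hF : MemLp F 2 P) (hDF : MemLp DF 2 P) :
    ‖toPair hF hDF‖ = norm12 P F DF := by
  rw [norm12, ← Real.sqrt_sq (norm_nonneg (toPair hF hDF)), WithLp.prod_norm_sq_eq_of_L2]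
  show √(‖hF.toLp F‖ ^ 2 + ‖hDF.toLp DF‖ ^ 2) = _
  simp only [norm_sq_toLp, Real.norm_eq_abs, sq_abs]

/-- The map `(F, h) ↦ F h` from `L²(Ω) × 𝔥` to `L²(Ω; 𝔥)`. -/
def smulVec (hH : H ∈ Ioo (1 / 2 : ℝ) 1) (P : Measure Ω) :
    Lp ℝ 2 P →L[ℝ] Hsp H hH →L[ℝ] Lp (Hsp H hH) 2 P :=
  LinearMap.mkContinuous₂
    (LinearMap.mk₂ ℝ (fun F h => (ContinuousLinearMap.toSpanSingleton ℝ h).compLp F)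
      (fun F G h => ((ContinuousLinearMap.toSpanSingleton ℝ h).compLpL 2 P).map_add F G)
      (fun c F h => ((ContinuousLinearMap.toSpanSingleton ℝ h).compLpL 2 P).map_smul c F)
      (fun F h k => by
        rw [ContinuousLinearMap.toSpanSingleton_add, ContinuousLinearMap.add_compLp])
      fun c F h => by
        rw [ContinuousLinearMap.toSpanSingleton_smul, ContinuousLinearMap.smul_compLp])
    1 fun F h => by
      refine (ContinuousLinearMap.norm_compLp_le _ _).trans ?_
      rw [ContinuousLinearMap.norm_toSpanSingleton]
      linarith

theorem coeFn_smulVec (F : Lp ℝ 2 P) (h : Hsp H hH) :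
    smulVec hH P F h =ᵐ[P] fun ω => F ω • h :=
  (ContinuousLinearMap.coeFn_compLp' (ContinuousLinearMap.toSpanSingleton ℝ h) F).trans
    (ae_of_all _ fun ω => by simp [ContinuousLinearMap.toSpanSingleton_apply])

theorem inner_smulVec (W : Lp (Hsp H hH) 2 P) (F : Lp ℝ 2 P) (h : Hsp H hH) :
    inner ℝ W (smulVec hH P F h) = ∫ ω, F ω * inner ℝ (W ω) h ∂P := by
  rw [L2.inner_def]
  refine integral_congr_ae ((coeFn_smulVec F h).mono fun ω hω => ?_)
  simp only [hω, real_inner_smul_right]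

/-- The estimate that characterizes the domain of the divergence: the functional
`G ↦ E⟨DG, V⟩` is bounded by `c` for the norm of `L²(Ω)`. -/
def DivBound (B : I → Ω → ℝ) (V : Lp (Hsp H hH) 2 P) (c : ℝ) : Prop :=
  ∀ w ∈ sobolev hH B P, |inner ℝ w.snd V| ≤ c * ‖w.fst‖

namespace DivBound

variable {V W : Lp (Hsp H hH) 2 P} {c d : ℝ}

theorem of_smooth (h : ∀ w ∈ smoothPairs hH B P, |inner ℝ w.snd V| ≤ c * ‖w.fst‖) :
    DivBound B V c := by
  have hc : IsClosed {w : PairSpace hH P | |inner ℝ w.snd V| ≤ c * ‖w.fst‖} :=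
    isClosed_le (((WithLp.sndL 2 ℝ _ _).continuous.inner continuous_const).abs)
      (continuous_const.mul (WithLp.fstL 2 ℝ _ _).continuous.norm)
  exact fun w hw => closure_minimal h hc hw

theorem mono (h : DivBound B V c) (hcd : c ≤ d) : DivBound B V d := fun w hw =>
  (h w hw).trans (mul_le_mul_of_nonneg_right hcd (norm_nonneg _))

theorem add (hV : DivBound B V c) (hW : DivBound B W d) : DivBound B (V + W) (c + d) :=
  fun w hw => by
    rw [inner_add_right, add_mul]
    exact (abs_add_le _ _).trans (add_le_add (hV w hw) (hW w hw))

/-- The estimate passes to the limit. -/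
theorem of_tendsto {ι : Type*} {l : Filter ι} [l.NeBot] {V' : ι → Lp (Hsp H hH) 2 P} {c' : ι → ℝ}
    (hV : Tendsto V' l (𝓝 V)) (hc : Tendsto c' l (𝓝 c)) (h : ∀ᶠ i in l, DivBound B (V' i) (c' i)) :
    DivBound B V c := fun w hw =>
  le_of_tendsto_of_tendsto (tendsto_const_nhds.inner hV).abs (hc.mul_const _)
    (h.mono fun _ hi => hi w hw)

end DivBound

/-- The basic estimate of the divergence for smooth `F_j` and `h_j = 𝟙_{[0,s_j]}`: the second moment
of the divergence of `∑ F_j h_j`, plus Cauchy-Schwarz. -/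
theorem divBound_sum_smooth [IsFiniteMeasure P] (hB : IsFBM H B P) {J : Type*} [Fintype J]
    {w : J → PairSpace hH P} (hw : ∀ j, w j ∈ smoothPairs hH B P) (s : J → I) :
    DivBound B (∑ j, smulVec hH P (w j).fst (ind hH (s j)))
      √(∑ j, ∑ k, inner ℝ (w j) (w k) * inner ℝ (ind hH (s j)) (ind hH (s k))) := by
  refine DivBound.of_smooth ?_
  choose F DF hF h1 h2 using hw
  obtain ⟨hm, hdual, hsq⟩ := smoothDiv_spec hB s hF
  rintro w₀ ⟨G, DG, hG, h1', h2'⟩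
  have e : inner ℝ w₀.snd (∑ j, smulVec hH P (w j).fst (ind hH (s j))) =
      inner ℝ w₀.fst (hm.toLp _) := by
    rw [inner_sum]
    simp_rw [inner_smulVec]
    rw [L2.inner_def]
    have : ∫ ω, inner ℝ (w₀.fst ω) (hm.toLp _ ω) ∂P =
        ∫ ω, G ω * smoothDiv hH B s F DF ω ∂P := by
      refine integral_congr_ae ?_
      filter_upwards [h1', hm.coeFn_toLp] with ω hω hω'
      rw [hω, hω', real_inner_eq_re_inner, mul_comm]
      simp
    rw [this, hdual G DG hG]
    refine Finset.sum_congr rfl fun j _ => integral_congr_ae ?_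
    filter_upwards [h1 j, h2'] with ω hω hω'
    rw [hω, hω']
  rw [e, mul_comm]
  refine (abs_real_inner_le_norm _ _).trans
    (mul_le_mul_of_nonneg_left (Real.le_sqrt_of_sq_le ?_) (norm_nonneg _))
  rw [norm_sq_toLp]
  simp only [Real.norm_eq_abs, sq_abs]
  refine hsq.trans (le_of_eq ?_)
  refine Finset.sum_congr rfl fun j _ => Finset.sum_congr rfl fun k _ => ?_
  rw [mul_comm, WithLp.prod_inner_apply, L2.inner_def, L2.inner_def]
  congr 2
  · refine integral_congr_ae ?_
    filter_upwards [h1 j, h1 k] with ω hω hω'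
    rw [show (WithLp.ofLp (w j)).1 ω = F j ω from hω, show (WithLp.ofLp (w k)).1 ω = F k ω from hω']
    simp [mul_comm]
  · refine integral_congr_ae ?_
    filter_upwards [h2 j, h2 k] with ω hω hω'
    rw [show (WithLp.ofLp (w j)).2 ω = DF j ω from hω,
      show (WithLp.ofLp (w k)).2 ω = DF k ω from hω']

/-- The estimate of `divBound_sum_smooth` for step functions `h_j`. The right-hand side is
bilinear, so that it suffices to expand the `h_j` and regroup. -/
theorem divBound_sum_span [IsFiniteMeasure P] (hB : IsFBM H B P) {J : Type*} [Fintype J]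
    {w : J → PairSpace hH P} (hw : ∀ j, w j ∈ smoothPairs hH B P) {h : J → Hsp H hH}
    (hh : ∀ j, h j ∈ Submodule.span ℝ (range (ind hH))) :
    DivBound B (∑ j, smulVec hH P (w j).fst (h j))
      √(∑ j, ∑ k, inner ℝ (w j) (w k) * inner ℝ (h j) (h k)) := by
  classical
  choose c hc using fun j => Finsupp.mem_span_range_iff_exists_finsupp.1 (hh j)
  set T : Finset I := Finset.univ.biUnion fun j => (c j).support
  have hc' : ∀ j, h j = ∑ t : T, c j t • ind hH t := fun j => by
    rw [← hc j, Finsupp.sum_of_support_subset (s := T) _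
      (Finset.subset_biUnion_of_mem (fun j => (c j).support) (Finset.mem_univ j)) _ (by simp)]
    exact (Finset.sum_coe_sort T fun t => c j t • ind hH t).symm
  have := divBound_sum_smooth hB (w := fun t : T => ∑ j, c j t • w j)
    (fun t => Submodule.sum_mem _ fun j _ => Submodule.smul_mem _ _ (hw j)) fun t : T => (t : I)
  have e1 : ∑ j, smulVec hH P (w j).fst (h j) =
      ∑ t : T, smulVec hH P (∑ j, c j t • w j).fst (ind hH t) := by
    have : ∀ t : T, (∑ j, c j t • w j).fst = ∑ j, c j t • (w j).fst := fun t => by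
      exact (map_sum (WithLp.fstL 2 ℝ (Lp ℝ 2 P) (Lp (Hsp H hH) 2 P)) _ _).trans
        (Finset.sum_congr rfl fun j _ => map_smul _ _ _)
    simp_rw [this, hc', map_sum, map_smul, sum_apply]
    rw [Finset.sum_comm]
    rfl
  have e2 : ∑ j, ∑ k, inner ℝ (w j) (w k) * inner ℝ (h j) (h k) =
      ∑ s : T, ∑ t : T, inner ℝ (∑ j, c j s • w j) (∑ j, c j t • w j) *
        inner ℝ (ind hH s) (ind hH t) := by
    simp_rw [hc', sum_inner, inner_sum, real_inner_smul_left, real_inner_smul_right,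
      Finset.mul_sum, Finset.sum_mul]
    rw [sum_comm_four]
    exact Finset.sum_congr rfl fun p _ => Finset.sum_congr rfl fun q _ =>
      Finset.sum_congr rfl fun j _ => Finset.sum_congr rfl fun k _ => by ring
  rw [e1, e2]
  exact this

theorem le_on_closure_pi_prod {J E K : Type*} [TopologicalSpace E] [TopologicalSpace K] {S : Set E}
    {T : Set K} {φ ψ : (J → E) × (J → K) → ℝ} (hφ : Continuous φ) (hψ : Continuous ψ)
    (h : ∀ x, (∀ j, x.1 j ∈ S) → (∀ j, x.2 j ∈ T) → φ x ≤ ψ x) {w : J → E} {k : J → K}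
    (hw : ∀ j, w j ∈ closure S) (hk : ∀ j, k j ∈ closure T) : φ (w, k) ≤ ψ (w, k) := by
  have hmem : (w, k) ∈ closure ((Set.pi univ fun _ : J => S) ×ˢ (Set.pi univ fun _ : J => T)) := by
    rw [closure_prod_eq, closure_pi_set, closure_pi_set]
    exact ⟨fun j _ => hw j, fun j _ => hk j⟩
  refine closure_minimal ?_ (isClosed_le hφ hψ) hmem
  rintro x ⟨hx, hy⟩
  exact h x (fun j => hx j trivial) (fun j => hy j trivial)

theorem continuous_sqrt_sum_inner_mul_inner {J E K : Type*} [Fintype J] [NormedAddCommGroup E]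
    [InnerProductSpace ℝ E] [NormedAddCommGroup K] [InnerProductSpace ℝ K] :
    Continuous fun x : (J → E) × (J → K) =>
      √(∑ j, ∑ k, inner ℝ (x.1 j) (x.1 k) * inner ℝ (x.2 j) (x.2 k)) := by
  fun_prop

theorem continuous_sum_clm {J E F K V : Type*} [Fintype J] [NormedAddCommGroup E]
    [NormedSpace ℝ E] [NormedAddCommGroup F] [NormedSpace ℝ F] [NormedAddCommGroup K]
    [NormedSpace ℝ K] [NormedAddCommGroup V] [NormedSpace ℝ V] (p : E →L[ℝ] F)
    (b : F →L[ℝ] K →L[ℝ] V) :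
    Continuous fun x : (J → E) × (J → K) => ∑ j, b (p (x.1 j)) (x.2 j) := by
  fun_prop

/-- The basic estimate of the divergence operator:
`‖δ(∑ j, F_j h_j)‖² ≤ ∑ j k, ⟨F_j, F_k⟩_{1,2} ⟨h_j, h_k⟩`. -/
theorem divBound_sum [IsFiniteMeasure P] (hB : IsFBM H B P) {J : Type*} [Fintype J]
    {w : J → PairSpace hH P} (hw : ∀ j, w j ∈ sobolev hH B P) (h : J → Hsp H hH) :
    DivBound B (∑ j, smulVec hH P (w j).fst (h j))
      √(∑ j, ∑ k, inner ℝ (w j) (w k) * inner ℝ (h j) (h k)) := by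
  intro w₀ hw₀
  have c1 := (continuous_const (y := w₀.snd)).inner (𝕜 := ℝ) (continuous_sum_clm (J := J)
    (WithLp.fstL 2 ℝ (Lp ℝ 2 P) (Lp (Hsp H hH) 2 P)) (smulVec hH P))
  exact le_on_closure_pi_prod c1.abs (continuous_sqrt_sum_inner_mul_inner.mul continuous_const)
    (fun x hx hy => divBound_sum_span hB hx hy w₀ hw₀) hw fun j => dense_span_ind (h j)

end

/-! ### Random variables are determined by trigonometric functionals -/

section

variable {H : ℝ} {hH : H ∈ Ioo (1 / 2 : ℝ) 1} {Ω : Type*} [MeasurableSpace Ω]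
  {B : I → Ω → ℝ} {P : Measure Ω}

/-- Two finite measures on `Ω` for which the linear combinations of the `B_t` have the same
characteristic function agree on the `σ`-field generated by `B`. -/
theorem measure_eq_of_charFun (hm : ∀ t, Measurable (B t)) {μ ν : Measure Ω} [IsFiniteMeasure μ]
    [IsFiniteMeasure ν]
    (h : ∀ (T : Finset I) (a : I → ℝ), ∫ ω, Complex.exp ((∑ t ∈ T, a t * B t ω : ℝ) * Complex.I) ∂μ =
      ∫ ω, Complex.exp ((∑ t ∈ T, a t * B t ω : ℝ) * Complex.I) ∂ν)
    {A : Set Ω} (hA : MeasurableSet[⨆ t, (borel ℝ).comap (B t)] A) : μ A = ν A := by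
  have hX : Measurable fun ω t => B t ω := measurable_pi_lambda _ hm
  have hXT : ∀ T : Finset I, Measurable fun ω (t : T) => B t ω := fun T =>
    measurable_pi_lambda _ fun t => hm t
  have hT : ∀ T : Finset I, μ.map (fun ω (t : T) => B t ω) = ν.map fun ω (t : T) => B t ω := by
    intro T
    refine Measure.ext_of_charFunDual ?_
    funext L
    classical
    rw [charFunDual_apply, charFunDual_apply, integral_map (hXT T).aemeasurable
      (Measurable.aestronglyMeasurable (by fun_prop)), integral_map (hXT T).aemeasurable
      (Measurable.aestronglyMeasurable (by fun_prop))]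
    have e : ∀ ω, L (fun t : T => B t ω) =
        ∑ t ∈ T, (if ht : t ∈ T then L (Pi.single ⟨t, ht⟩ 1) else 0) * B t ω := fun ω => by
      rw [← Finset.sum_coe_sort T, ← ContinuousLinearMap.sum_comp_single]
      refine Finset.sum_congr rfl fun t _ => ?_
      rw [dif_pos t.2, ContinuousLinearMap.comp_apply, ContinuousLinearMap.single_apply, mul_comm,
        ← smul_eq_mul (a := B t ω), ← map_smul, ← Pi.single_smul, smul_eq_mul, mul_one]
    simp_rw [e]
    exact h T _
  have hall : μ.map (fun ω t => B t ω) = ν.map fun ω t => B t ω := by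
    have key : ∀ (ρ : Measure Ω) (T : Finset I), (ρ.map fun ω t => B t ω).map T.restrict =
        ρ.map fun ω (t : T) => B t ω := fun ρ T => by
      rw [Measure.map_map (Finset.measurable_restrict T) hX]
      rfl
    exact IsProjectiveLimit.unique (P := fun T => μ.map fun ω (t : T) => B t ω)
      (fun T => key μ T) (fun T => (key ν T).trans (hT T).symm)
  have hA' : ∃ S, MeasurableSet S ∧ (fun ω t => B t ω) ⁻¹' S = A := by
    have : (⨆ t, (borel ℝ).comap (B t)) = MeasurableSpace.comap (fun ω t => B t ω)
        MeasurableSpace.pi := by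
      rw [MeasurableSpace.pi, MeasurableSpace.comap_iSup]
      refine iSup_congr fun t => ?_
      rw [MeasurableSpace.comap_comp, ← (inferInstance : BorelSpace ℝ).measurable_eq]
      rfl
    rw [this] at hA
    exact hA
  obtain ⟨S, hS, rfl⟩ := hA'
  rw [← Measure.map_apply hX hS, hall, Measure.map_apply hX hS]

/-- An integrable random variable that is orthogonal to the trigonometric functions of the `B_t`
is zero. -/
theorem ae_eq_zero_of_integral_trig (hm : ∀ t, Measurable (B t)) (hgen : GeneratedBy B P)
    {ζ : Ω → ℝ} (hζ : Integrable ζ P)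
    (hc : ∀ (T : Finset I) (a : I → ℝ), ∫ ω, ζ ω * Real.cos (∑ t ∈ T, a t * B t ω) ∂P = 0)
    (hs : ∀ (T : Finset I) (a : I → ℝ), ∫ ω, ζ ω * Real.sin (∑ t ∈ T, a t * B t ω) ∂P = 0) :
    ζ =ᵐ[P] 0 := by
  -- the positive and negative parts of `ζ`, as measures, give the `B_t` the same
  -- characteristic functions, hence they agree on the σ-field generated by `B`
  set μ : Measure Ω := P.withDensity fun ω => ENNReal.ofReal (ζ ω) with hμ
  set ν : Measure Ω := P.withDensity fun ω => ENNReal.ofReal (-ζ ω) with hν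
  have : IsFiniteMeasure μ := isFiniteMeasure_withDensity_ofReal hζ.2
  have : IsFiniteMeasure ν := isFiniteMeasure_withDensity_ofReal hζ.neg.2
  have hint : ∀ {f : Ω → ℂ}, (Measurable f) → (∀ ω, ‖f ω‖ = 1) →
      ∫ ω, f ω ∂μ - ∫ ω, f ω ∂ν = ∫ ω, ζ ω * f ω ∂P := by
    intro f hf hf1
    have hi : ∀ g : Ω → ℝ, Integrable g P → Integrable (fun ω => (max (g ω) 0 : ℝ) • f ω) P := by
      intro g hg
      refine (hg.pos_part.smul_bdd 1 hf.aestronglyMeasurable (ae_of_all _ fun ω => (hf1 ω).le))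
    have hν' : ν = P.withDensity fun ω => ENNReal.ofReal ((-ζ) ω) := hν
    rw [hμ, hν', integral_withDensity_eq_integral_toReal_smul₀ hζ.1.aemeasurable.ennreal_ofReal
      (ae_of_all _ fun _ => ENNReal.ofReal_lt_top), integral_withDensity_eq_integral_toReal_smul₀
      hζ.1.aemeasurable.neg.ennreal_ofReal (ae_of_all _ fun _ => ENNReal.ofReal_lt_top)]
    simp only [ENNReal.toReal_ofReal']
    rw [← integral_sub (hi _ hζ) (hi _ hζ.neg)]
    refine integral_congr_ae (ae_of_all _ fun ω => ?_)
    simp only [Pi.neg_apply]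
    rw [← sub_smul, max_zero_sub_max_neg_zero_eq_self]
    rfl
  refine hζ.ae_eq_zero_of_forall_setIntegral_eq_zero fun A hA _ => ?_
  have hexp : ∀ (T : Finset I) (a : I → ℝ),
      ∫ ω, Complex.exp ((∑ t ∈ T, a t * B t ω : ℝ) * Complex.I) ∂μ =
      ∫ ω, Complex.exp ((∑ t ∈ T, a t * B t ω : ℝ) * Complex.I) ∂ν := by
    intro T a
    have hX : Measurable fun ω => ∑ t ∈ T, a t * B t ω :=
      Finset.measurable_fun_sum _ fun t _ => (hm t).const_mul _
    rw [← sub_eq_zero, hint (by fun_prop) fun ω => Complex.norm_exp_ofReal_mul_I _]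
    have e : ∀ ω, (ζ ω : ℂ) * Complex.exp ((∑ t ∈ T, a t * B t ω : ℝ) * Complex.I) =
        ((ζ ω * Real.cos (∑ t ∈ T, a t * B t ω) : ℝ) : ℂ) +
          ((ζ ω * Real.sin (∑ t ∈ T, a t * B t ω) : ℝ) : ℂ) * Complex.I := fun ω => by
      rw [Complex.exp_mul_I, ← Complex.ofReal_cos, ← Complex.ofReal_sin]
      push_cast
      ring
    simp_rw [e]
    rw [integral_add, integral_mul_const, integral_complex_ofReal, integral_complex_ofReal, hc, hs]
    · simp
    · exact (hζ.mul_bdd (c := 1) (Real.measurable_cos.comp hX).aestronglyMeasurable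
        (ae_of_all _ fun ω => Real.abs_cos_le_one _)).ofReal
    · exact ((hζ.mul_bdd (c := 1) (Real.measurable_sin.comp hX).aestronglyMeasurable
        (ae_of_all _ fun ω => Real.abs_sin_le_one _)).ofReal).mul_const _
  obtain ⟨A', hA', hAA'⟩ := hgen A hA
  have hle : (⨆ t, (borel ℝ).comap (B t)) ≤ (inferInstance : MeasurableSpace Ω) :=
    iSup_le fun t => by
      rw [← (inferInstance : BorelSpace ℝ).measurable_eq]
      exact (hm t).comap_le
  have hAm : MeasurableSet A' := hle A' hA'
  rw [setIntegral_congr_set hAA']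
  have hμν := measure_eq_of_charFun hm hexp hA'
  rw [hμ, hν, withDensity_apply _ hAm, withDensity_apply _ hAm] at hμν
  rw [integral_eq_lintegral_pos_part_sub_lintegral_neg_part hζ.integrableOn, hμν, sub_self]

end

/-! ### Wiener integrals and the density of smooth random variables -/

section

variable {H : ℝ} {hH : H ∈ Ioo (1 / 2 : ℝ) 1} {Ω : Type*} [MeasurableSpace Ω]
  {B : I → Ω → ℝ} {P : Measure Ω}

theorem IsFBM.memLp (hB : IsFBM H B P) (t : I) : MemLp (B t) 2 P :=
  (hB.gaussian.hasGaussianLaw_eval t).memLp_two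

/-- The isonormal process: the isometry `𝔥 → L²(Ω)` that extends `𝟙_{[0,t]} ↦ B_t`. -/
def wiener (hH : H ∈ Ioo (1 / 2 : ℝ) 1) (hB : IsFBM H B P) : Hsp H hH →ₗᵢ[ℝ] Lp ℝ 2 P :=
  isometryOfCov hH (fun t => (hB.memLp t).toLp (B t)) fun s t => by
    rw [L2.inner_def, ← hB.covariance]
    refine integral_congr_ae ?_
    filter_upwards [(hB.memLp s).coeFn_toLp, (hB.memLp t).coeFn_toLp] with ω h1 h2
    rw [h1, h2]
    simp [mul_comm]

theorem wiener_ind (hB : IsFBM H B P) (t : I) :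
    wiener hH hB (ind hH t) = (hB.memLp t).toLp (B t) :=
  isometryOfCov_ind _ t

theorem coeFn_wiener_sum (hB : IsFBM H B P) (T : Finset I) (a : I → ℝ) :
    wiener hH hB (∑ t ∈ T, a t • ind hH t) =ᵐ[P] fun ω => ∑ t ∈ T, a t * B t ω := by
  simp_rw [map_sum, map_smul, wiener_ind]
  refine (Lp.coeFn_finsetSum _ _).trans ?_
  have : ∀ t ∈ T, (a t • (hB.memLp t).toLp (B t) : Lp ℝ 2 P) =ᵐ[P] fun ω => a t * B t ω :=
    fun t _ => (Lp.coeFn_smul _ _).trans ((hB.memLp t).coeFn_toLp.const_smul (a t))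
  filter_upwards [(eventually_all_finset T).2 this] with ω hω
  simp only [Finset.sum_apply]
  exact Finset.sum_congr rfl fun t ht => hω t ht

variable [IsProbabilityMeasure P]

theorem memLp_comp_of_bounded {ψ : ℝ → ℝ} (hψ : Continuous ψ) (hb : ∀ x, |ψ x| ≤ 1)
    (X : Lp ℝ 2 P) : MemLp (fun ω => ψ (X ω)) 2 P :=
  MemLp.of_bound (hψ.comp_aestronglyMeasurable (Lp.aestronglyMeasurable X)) 1 (ae_of_all _ fun _ => hb _)

theorem lipschitzWith_comp_toLp {ψ : ℝ → ℝ} (hψ : LipschitzWith 1 ψ) (hb : ∀ x, |ψ x| ≤ 1) :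
    LipschitzWith 1 fun X : Lp ℝ 2 P => (memLp_comp_of_bounded hψ.continuous hb X).toLp _ := by
  refine LipschitzWith.of_dist_le_mul fun X Y => ?_
  rw [NNReal.coe_one, one_mul, dist_eq_norm, dist_eq_norm]
  refine Lp.norm_le_norm_of_ae_le ?_
  filter_upwards [Lp.coeFn_sub X Y, Lp.coeFn_sub
    ((memLp_comp_of_bounded hψ.continuous hb X).toLp _)
    ((memLp_comp_of_bounded hψ.continuous hb Y).toLp _),
    (memLp_comp_of_bounded hψ.continuous hb X).coeFn_toLp,
    (memLp_comp_of_bounded hψ.continuous hb Y).coeFn_toLp] with ω h1 h2 h3 h4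
  rw [h1, h2, Pi.sub_apply, Pi.sub_apply, h3, h4, ← dist_eq_norm, ← dist_eq_norm]
  simpa using hψ.dist_le_mul (X ω) (Y ω)

/-- `cos X(h)`, for the isonormal process `X`. -/
def wcos (hB : IsFBM H B P) (h : Hsp H hH) : Lp ℝ 2 P :=
  (memLp_comp_of_bounded Real.continuous_cos Real.abs_cos_le_one (wiener hH hB h)).toLp _

/-- `sin X(h)`, for the isonormal process `X`. -/
def wsin (hB : IsFBM H B P) (h : Hsp H hH) : Lp ℝ 2 P :=
  (memLp_comp_of_bounded Real.continuous_sin Real.abs_sin_le_one (wiener hH hB h)).toLp _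

theorem coeFn_wcos (hB : IsFBM H B P) (h : Hsp H hH) :
    wcos hB h =ᵐ[P] fun ω => Real.cos (wiener hH hB h ω) := MemLp.coeFn_toLp _

theorem coeFn_wsin (hB : IsFBM H B P) (h : Hsp H hH) :
    wsin hB h =ᵐ[P] fun ω => Real.sin (wiener hH hB h ω) := MemLp.coeFn_toLp _

theorem continuous_wcos (hB : IsFBM H B P) : Continuous (wcos (hH := hH) hB) :=
  (lipschitzWith_comp_toLp Real.lipschitzWith_cos Real.abs_cos_le_one).continuous.comp
    (wiener hH hB).continuous

theorem continuous_wsin (hB : IsFBM H B P) : Continuous (wsin (hH := hH) hB) :=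
  (lipschitzWith_comp_toLp Real.lipschitzWith_sin Real.abs_sin_le_one).continuous.comp
    (wiener hH hB).continuous

theorem coeFn_wcos_sum (hB : IsFBM H B P) (T : Finset I) (a : I → ℝ) :
    wcos hB (∑ t ∈ T, a t • ind hH t) =ᵐ[P] fun ω => Real.cos (∑ t ∈ T, a t * B t ω) :=
  (coeFn_wcos hB _).trans ((coeFn_wiener_sum (hH := hH) hB T a).mono fun ω h => by simp only [h])

theorem coeFn_wsin_sum (hB : IsFBM H B P) (T : Finset I) (a : I → ℝ) :
    wsin hB (∑ t ∈ T, a t • ind hH t) =ᵐ[P] fun ω => Real.sin (∑ t ∈ T, a t * B t ω) :=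
  (coeFn_wsin hB _).trans ((coeFn_wiener_sum (hH := hH) hB T a).mono fun ω h => by simp only [h])

/-- The trigonometric functions of the `B_t` are smooth cylindrical random variables. -/
theorem exists_smoothPairs_of_isCb (hB : IsFBM H B P) {ψ : ℝ → ℝ}
    (hψ : ∀ {n : Finset I} (L : (n → ℝ) →L[ℝ] ℝ), IsCb fun x => ψ (L x)) (T : Finset I)
    (a : I → ℝ) :
    ∃ w ∈ smoothPairs hH B P, w.fst =ᵐ[P] fun ω => ψ (∑ t ∈ T, a t * B t ω) := by
  have hs := isSmoothCyl_of_fintype (hH := hH) (B := B) (fun i : T => (i : I))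
    (hψ (∑ t : T, a t • ContinuousLinearMap.proj (R := ℝ) (φ := fun _ : T => ℝ) t))
  refine ⟨_, toPair_mem_smoothPairs (hs.memLp hB.measurable).1 (hs.memLp hB.measurable).2 hs, ?_⟩
  refine (hs.memLp hB.measurable).1.coeFn_toLp.trans (ae_of_all _ fun ω => ?_)
  simp only [sum_apply, smul_apply, ContinuousLinearMap.proj_apply,
    smul_eq_mul]
  rw [← Finset.sum_coe_sort T]

/-- The products `cos X(h) k` and `sin X(h) k`, with `h` a step function, span a dense subspace
of `L²(Ω; 𝔥)`. -/
theorem eq_zero_of_inner_trig_smul (hB : IsFBM H B P) (hgen : GeneratedBy B P)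
    {W : Lp (Hsp H hH) 2 P}
    (hW : ∀ (T : Finset I) (a : I → ℝ) (k : Hsp H hH),
      inner ℝ W (smulVec hH P (wcos hB (∑ t ∈ T, a t • ind hH t)) k) = 0 ∧
      inner ℝ W (smulVec hH P (wsin hB (∑ t ∈ T, a t • ind hH t)) k) = 0) : W = 0 := by
  refine Lp.ext (EventuallyEq.trans (ae_eq_zero_of_forall_inner (𝕜 := ℝ) fun k => ?_)
    (Lp.coeFn_zero _ _ _).symm)
  have hi : Integrable (fun ω => inner ℝ k (W ω)) P :=
    ((Lp.memLp W).integrable one_le_two).const_inner k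
  refine ae_eq_zero_of_integral_trig hB.measurable hgen hi (fun T a => ?_) fun T a => ?_
  · rw [← (hW T a k).1, inner_smulVec]
    refine integral_congr_ae ((coeFn_wcos_sum (hH := hH) hB T a).mono fun ω h => ?_)
    simp only [h, real_inner_comm, mul_comm]
  · rw [← (hW T a k).2, inner_smulVec]
    refine integral_congr_ae ((coeFn_wsin_sum (hH := hH) hB T a).mono fun ω h => ?_)
    simp only [h, real_inner_comm, mul_comm]

/-- The variables `cos X(h)` and `sin X(h)`, with `h` a step function, span a dense subspace
of `L²(Ω)`. -/
theorem eq_zero_of_inner_trig (hB : IsFBM H B P) (hgen : GeneratedBy B P) {F : Lp ℝ 2 P}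
    (hF : ∀ (T : Finset I) (a : I → ℝ), inner ℝ F (wcos hB (∑ t ∈ T, a t • ind hH t)) = 0 ∧
      inner ℝ F (wsin hB (∑ t ∈ T, a t • ind hH t)) = 0) : F = 0 := by
  refine Lp.ext (EventuallyEq.trans ?_ (Lp.coeFn_zero _ _ _).symm)
  refine ae_eq_zero_of_integral_trig hB.measurable hgen ((Lp.memLp F).integrable one_le_two)
    (fun T a => ?_) fun T a => ?_
  · rw [← (hF T a).1, L2.inner_def]
    refine integral_congr_ae ((coeFn_wcos_sum (hH := hH) hB T a).mono fun ω h => ?_)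
    simp [h, mul_comm]
  · rw [← (hF T a).2, L2.inner_def]
    refine integral_congr_ae ((coeFn_wsin_sum (hH := hH) hB T a).mono fun ω h => ?_)
    simp [h, mul_comm]

theorem separableSpace_of_total {V : Type*} [NormedAddCommGroup V] [InnerProductSpace ℝ V]
    [CompleteSpace V] {S : Set V} (hS : TopologicalSpace.IsSeparable S)
    (h : ∀ v : V, (∀ s ∈ S, inner ℝ v s = 0) → v = 0) : SecondCountableTopology V := by
  have h1 : (Submodule.span ℝ S).topologicalClosure = ⊤ := by
    rw [Submodule.topologicalClosure_eq_top_iff, Submodule.eq_bot_iff]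
    exact fun v hv => h v fun s hs =>
      (Submodule.mem_orthogonal' _ _).1 hv s (Submodule.subset_span hs)
  have h2 : TopologicalSpace.IsSeparable (univ : Set V) := by
    have := (hS.span (R := ℝ)).closure
    rwa [← Submodule.topologicalClosure_coe, h1, Submodule.top_coe] at this
  have := TopologicalSpace.isSeparable_univ_iff.1 h2
  exact UniformSpace.secondCountable_of_separable V

/-- `L²(Ω)` is separable: the `cos X(h)` and `sin X(h)` are total and `h` ranges over a separable
space. -/
theorem secondCountable_L2 (hH : H ∈ Ioo (1 / 2 : ℝ) 1) (hB : IsFBM H B P)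
    (hgen : GeneratedBy B P) : SecondCountableTopology (Lp ℝ 2 P) :=
  separableSpace_of_total
    (S := range (wcos (hH := hH) hB) ∪ range (wsin (hH := hH) hB))
    ((TopologicalSpace.isSeparable_range (continuous_wcos hB)).union
      (TopologicalSpace.isSeparable_range (continuous_wsin hB)))
    fun _ hF => eq_zero_of_inner_trig (hH := hH) hB hgen fun _ _ =>
      ⟨hF _ (Or.inl (mem_range_self _)), hF _ (Or.inr (mem_range_self _))⟩

theorem secondCountable_L2_Hsp (hB : IsFBM H B P) (hgen : GeneratedBy B P) :
    SecondCountableTopology (Lp (Hsp H hH) 2 P) :=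
  separableSpace_of_total
    (S := range (fun x : Hsp H hH × Hsp H hH => smulVec hH P (wcos hB x.1) x.2) ∪
      range fun x : Hsp H hH × Hsp H hH => smulVec hH P (wsin hB x.1) x.2)
    ((TopologicalSpace.isSeparable_range (((smulVec hH P).continuous.comp
      ((continuous_wcos hB).comp continuous_fst)).clm_apply continuous_snd)).union
      (TopologicalSpace.isSeparable_range (((smulVec hH P).continuous.comp
      ((continuous_wsin hB).comp continuous_fst)).clm_apply continuous_snd)))
    fun _ hF => eq_zero_of_inner_trig_smul hB hgen fun _ _ k =>
      ⟨hF _ (Or.inl (mem_range_self (_, k))), hF _ (Or.inr (mem_range_self (_, k)))⟩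

/-- The smooth cylindrical random variables are dense in `L²(Ω)`. -/
theorem eq_zero_of_inner_smooth (hB : IsFBM H B P) (hgen : GeneratedBy B P) {F : Lp ℝ 2 P}
    (hF : ∀ w ∈ smoothPairs hH B P, inner ℝ F w.fst = 0) : F = 0 := by
  refine eq_zero_of_inner_trig (hH := hH) hB hgen fun T a => ⟨?_, ?_⟩
  · obtain ⟨w, hw, e⟩ := exists_smoothPairs_of_isCb (hH := hH) hB IsCb.cos T a
    rw [← Lp.ext (e.trans (coeFn_wcos_sum (hH := hH) hB T a).symm)]
    exact hF w hw
  · obtain ⟨w, hw, e⟩ := exists_smoothPairs_of_isCb (hH := hH) hB IsCb.sin T a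
    rw [← Lp.ext (e.trans (coeFn_wsin_sum (hH := hH) hB T a).symm)]
    exact hF w hw

/-- The smooth variables are dense in `L²(Ω)`. -/
theorem dense_smooth (hB : IsFBM H B P) (hgen : GeneratedBy B P) :
    Dense ((smoothPairs hH B P).map (WithLp.fstₗ 2 ℝ (Lp ℝ 2 P) (Lp (Hsp H hH) 2 P)) :
      Set (Lp ℝ 2 P)) := by
  rw [Submodule.dense_iff_topologicalClosure_eq_top, Submodule.topologicalClosure_eq_top_iff,
    Submodule.eq_bot_iff]
  exact fun F hF => eq_zero_of_inner_smooth hB hgen fun w hw =>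
    (Submodule.mem_orthogonal' _ _).1 hF _ (Submodule.mem_map_of_mem hw)

/-- A variable whose scalar products with the smooth `G` are bounded by `c ‖G‖` has norm at
most `c`. -/
theorem norm_le_of_inner_smooth_le (hB : IsFBM H B P) (hgen : GeneratedBy B P) {F : Lp ℝ 2 P}
    {c : ℝ} (hF : ∀ w ∈ smoothPairs hH B P, |inner ℝ w.fst F| ≤ c * ‖w.fst‖) : ‖F‖ ≤ c := by
  have h : |inner ℝ F F| ≤ c * ‖F‖ := by
    have hcl : IsClosed {G : Lp ℝ 2 P | |inner ℝ G F| ≤ c * ‖G‖} :=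
      isClosed_le (by fun_prop) (by fun_prop)
    refine closure_minimal ?_ hcl (dense_smooth (hH := hH) hB hgen F)
    rintro _ ⟨w, hw, rfl⟩
    exact hF w hw
  rw [real_inner_self_eq_norm_sq, abs_of_nonneg (sq_nonneg _)] at h
  rcases (norm_nonneg F).eq_or_lt with h0 | h0
  · obtain ⟨w, hw, hw1⟩ : ∃ w ∈ smoothPairs hH B P, 0 < ‖w.fst‖ := by
      by_contra! hn
      have h1 : (Lp.const 2 P (1 : ℝ)) = 0 := eq_zero_of_inner_smooth (hH := hH) hB hgen
        fun w hw => by rw [norm_le_zero_iff.1 (hn w hw), inner_zero_right]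
      have h2 : ‖Lp.const 2 P (1 : ℝ)‖ = 1 := by simp [Lp.norm_const]
      rw [h1, norm_zero] at h2
      exact zero_ne_one h2
    have h3 := (abs_nonneg _).trans (hF w hw)
    rw [← h0]
    exact nonneg_of_mul_nonneg_left h3 hw1
  · nlinarith

/-- The Malliavin derivative is closable: an element of `𝔻^{1,2}` determines its derivative. -/
theorem sobolev_fst_injective (hB : IsFBM H B P) (hgen : GeneratedBy B P) {w : PairSpace hH P}
    (hw : w ∈ sobolev hH B P) (h0 : w.fst = 0) : w.snd = 0 := by
  -- `⟨DF, v k⟩ = ⟨F, δ(v k)⟩ = 0` for smooth `v`, and the vectors `v k` are total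
  have key : ∀ v ∈ smoothPairs hH B P, ∀ k, inner ℝ w.snd (smulVec hH P v.fst k) = 0 := by
    intro v hv k
    have := divBound_sum hB (J := Unit) (w := fun _ => v)
      (fun _ => smoothPairs_le_sobolev hv) (fun _ => k) w hw
    simpa [h0] using this
  refine eq_zero_of_inner_trig_smul hB hgen fun T a k => ⟨?_, ?_⟩
  · obtain ⟨v, hv, e⟩ := exists_smoothPairs_of_isCb (hH := hH) hB IsCb.cos T a
    rw [← Lp.ext (e.trans (coeFn_wcos_sum (hH := hH) hB T a).symm)]
    exact key v hv k
  · obtain ⟨v, hv, e⟩ := exists_smoothPairs_of_isCb (hH := hH) hB IsCb.sin T a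
    rw [← Lp.ext (e.trans (coeFn_wsin_sum (hH := hH) hB T a).symm)]
    exact key v hv k

end

/-! ### Measurability of curves in `𝔻^{1,2}` -/

section

/-- Measurability of a map into a Polish space can be checked on countably many continuous
functions that separate the points. -/
theorem aemeasurable_of_separating {α X : Type*} [MeasurableSpace α] {μ : Measure α}
    [TopologicalSpace X] [PolishSpace X] [MeasurableSpace X] [BorelSpace X] {Φ : ℕ → X → ℝ}
    (hΦ : ∀ n, Continuous (Φ n)) (hsep : ∀ x y, (∀ n, Φ n x = Φ n y) → x = y) {f : α → X}
    (hf : ∀ n, AEMeasurable (fun a => Φ n (f a)) μ) : AEMeasurable f μ := by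
  have h1 : MeasurableEmbedding fun x n => Φ n x :=
    (continuous_pi hΦ).measurableEmbedding fun x y h => hsep x y fun n => congrFun h n
  exact (h1.aemeasurable_comp_iff).1 (aemeasurable_pi_lambda _ hf)

variable {H : ℝ} {hH : H ∈ Ioo (1 / 2 : ℝ) 1} {Ω : Type*} [MeasurableSpace Ω]
  {B : I → Ω → ℝ} {P : Measure Ω} [IsProbabilityMeasure P]

/-- A family of elements of `𝔻^{1,2}` is measurable as soon as it is measurable in `L²(Ω)`. -/
theorem aestronglyMeasurable_sobolev {α : Type*} [MeasurableSpace α] {μ : Measure α}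
    (hB : IsFBM H B P) (hgen : GeneratedBy B P) {w : α → PairSpace hH P}
    (hw : ∀ a, w a ∈ sobolev hH B P)
    (hm : ∀ g : Lp ℝ 2 P, AEMeasurable (fun a => inner ℝ (w a).fst g) μ) :
    AEStronglyMeasurable w μ := by
  have := secondCountable_L2 hH hB hgen
  have := secondCountable_L2_Hsp (hH := hH) hB hgen
  have : SecondCountableTopology (PairSpace hH P) :=
    (WithLp.prodContinuousLinearEquiv 2 ℝ (Lp ℝ 2 P)
      (Lp (Hsp H hH) 2 P)).toHomeomorph.secondCountableTopology
  have : CompleteSpace (sobolev hH B P) := isClosed_sobolev.completeSpace_coe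
  borelize (PairSpace hH P)
  have h1 : AEMeasurable (fun a => (⟨w a, hw a⟩ : sobolev hH B P)) μ := by
    refine aemeasurable_of_separating (X := sobolev hH B P) (Φ := fun n v =>
      inner ℝ (v : PairSpace hH P).fst (TopologicalSpace.denseSeq (Lp ℝ 2 P) n)) (fun n => ?_) (fun v v' h => ?_) fun n => hm _
    · exact ((WithLp.fstL 2 ℝ _ _).continuous.comp continuous_subtype_val).inner continuous_const
    · have e : (v : PairSpace hH P).fst = (v' : PairSpace hH P).fst :=
        ext_inner_right ℝ (congrFun ((TopologicalSpace.denseRange_denseSeq (Lp ℝ 2 P)).equalizer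
          (continuous_const.inner continuous_id) (continuous_const.inner continuous_id)
          (funext h)))
      have e2 := sobolev_fst_injective hB hgen (v - v').2 (sub_eq_zero.2 e)
      have e3 : (v : PairSpace hH P).snd = (v' : PairSpace hH P).snd := sub_eq_zero.1 e2
      exact Subtype.ext (WithLp.ofLp_injective 2 (Prod.ext e e3))
  exact continuous_subtype_val.comp_aestronglyMeasurable h1.aestronglyMeasurable

/-- Measurability in `𝔥` can be tested on the `𝟙_{[0,t]}`. -/
theorem aestronglyMeasurable_Hsp {α : Type*} [MeasurableSpace α] {μ : Measure α}
    {V : α → Hsp H hH} (hV : ∀ t, AEMeasurable (fun a => inner ℝ (V a) (ind hH t)) μ) :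
    AEStronglyMeasurable V μ := by
  borelize (Hsp H hH)
  refine (aemeasurable_of_separating (Φ := fun n v => inner ℝ v
    (ind hH (TopologicalSpace.denseSeq I n))) (fun n => by fun_prop) (fun v v' h => ?_)
    fun n => hV _).aestronglyMeasurable
  refine Hsp.ext_inner fun t => ?_
  have hc : IsClosed {t : I | inner ℝ v (ind hH t) = inner ℝ v' (ind hH t)} :=
    isClosed_eq (continuous_const.inner continuous_ind) (continuous_const.inner continuous_ind)
  exact hc.closure_subset_iff.2 (by rintro _ ⟨n, rfl⟩; exact h n)
    (TopologicalSpace.denseRange_denseSeq I t)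

end

/-! ### Paths of finite energy -/

section

variable {H : ℝ} {hH : H ∈ Ioo (1 / 2 : ℝ) 1}

/-- The energy is continuous along dominated convergence. -/
theorem tendsto_energy {f : ℕ → I → ℝ≥0∞} {g F : I → ℝ≥0∞} (hf : ∀ n, AEMeasurable (f n))
    (hF : AEMeasurable F) (hle : ∀ n, f n ≤ᵐ[volume] F) (hfin : energy H F < ∞)
    (hlim : ∀ᵐ t, Tendsto (fun n => f n t) atTop (𝓝 (g t))) :
    Tendsto (fun n => energy H (f n)) atTop (𝓝 (energy H g)) := by
  have hmF := measurable_potential (H := H) hF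
  refine tendsto_lintegral_of_dominated_convergence' (fun x => potential H F x ^ 2)
    (fun n => ((measurable_potential (hf n)).pow_const 2).aemeasurable)
    (fun n => .of_forall fun x => pow_le_pow_left' (potential_mono (hle n) x) 2) hfin.ne ?_
  filter_upwards [ae_lt_top (hmF.pow_const 2) hfin.ne] with x hx
  have hx' : potential H F x ≠ ∞ := fun h => by simp [h] at hx
  refine (ENNReal.continuous_pow 2).continuousAt.tendsto.comp ?_
  refine tendsto_lintegral_of_dominated_convergence'
    (fun s => F s * ENNReal.ofReal (feature H x s))
    (fun n => (hf n).mul (measurable_ofReal_feature_right x).aemeasurable)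
    (fun n => (hle n).mono fun s hs => mul_le_mul' hs le_rfl) hx' ?_
  filter_upwards [hlim] with s hs
  exact ENNReal.Tendsto.mul_const hs (Or.inr ENNReal.ofReal_ne_top)

variable {Ω : Type*} [MeasurableSpace Ω] {P : Measure Ω}

theorem lintegral_bilinear_le {S : Type*} [MeasurableSpace S] {μ : Measure S} [SFinite μ]
    [SFinite P] {g : S → Ω → ℝ≥0∞} (hg : Measurable (Function.uncurry g)) {K : S → S → ℝ≥0∞}
    (hK : Measurable (Function.uncurry K)) :
    ∫⁻ ω, ∫⁻ s, ∫⁻ t, g s ω * g t ω * K s t ∂μ ∂μ ∂P ≤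
      ∫⁻ s, ∫⁻ t, (∫⁻ ω, g s ω ^ (2 : ℝ) ∂P) ^ (1 / (2 : ℝ)) *
        (∫⁻ ω, g t ω ^ (2 : ℝ) ∂P) ^ (1 / (2 : ℝ)) * K s t ∂μ ∂μ := by
  have hgt : ∀ t, Measurable (g t) := fun t => hg.comp measurable_prodMk_left
  have hm : Measurable fun z : (Ω × S) × S => g z.1.2 z.1.1 * g z.2 z.1.1 * K z.1.2 z.2 := by
    refine ((hg.comp (by fun_prop : Measurable fun z : (Ω × S) × S => (z.1.2, z.1.1))).mul
      (hg.comp (by fun_prop : Measurable fun z : (Ω × S) × S => (z.2, z.1.1)))).mul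
      (hK.comp (by fun_prop : Measurable fun z : (Ω × S) × S => (z.1.2, z.2)))
  refine (lintegral_lintegral_swap (f := fun ω s => ∫⁻ t, g s ω * g t ω * K s t ∂μ)
    (Measurable.lintegral_prod_right' hm).aemeasurable).trans_le (lintegral_mono fun s => ?_)
  refine (lintegral_lintegral_swap (f := fun ω t => g s ω * g t ω * K s t)
    (hm.comp (by fun_prop : Measurable fun z : Ω × S => ((z.1, s), z.2))).aemeasurable).trans_le
    (lintegral_mono fun t => ?_)
  refine (lintegral_mul_const (K s t) ((hgt s).mul (hgt t))).trans_le ?_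
  exact mul_le_mul' (ENNReal.lintegral_mul_le_Lp_mul_Lq P Real.HolderConjugate.two_two
    (hgt s).aemeasurable (hgt t).aemeasurable) le_rfl

/-- The expected energy of the paths of a process is at most the energy of `t ↦ ‖g_t‖_{L²}`. -/
theorem lintegral_energy_le [SFinite P] (hH : H ∈ Ioo (1 / 2 : ℝ) 1) {g : I → Ω → ℝ≥0∞}
    (hg : Measurable (Function.uncurry g)) :
    ∫⁻ ω, energy H (fun t => g t ω) ∂P ≤
      energy H fun t => (∫⁻ ω, g t ω ^ (2 : ℝ) ∂P) ^ (1 / (2 : ℝ)) := by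
  have hgω : ∀ ω, Measurable fun t => g t ω := fun ω => hg.comp measurable_prodMk_right
  have hN : Measurable fun t => (∫⁻ ω, g t ω ^ (2 : ℝ) ∂P) ^ (1 / (2 : ℝ)) :=
    (Measurable.lintegral_prod_right' (f := fun z : I × Ω => g z.1 z.2 ^ (2 : ℝ))
      (hg.pow_const _)).pow_const _
  rw [energy_eq hH hN.aemeasurable]
  simp_rw [fun ω => energy_eq hH (hgω ω).aemeasurable]
  exact lintegral_bilinear_le hg (by unfold Function.uncurry; fun_prop)

theorem measurable_energy {g : I → Ω → ℝ≥0∞} (hg : Measurable (Function.uncurry g)) :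
    Measurable fun ω => energy H fun t => g t ω := by
  refine Measurable.lintegral_prod_right' (f := fun z : Ω × ℝ =>
    (∫⁻ s, g s z.1 * ENNReal.ofReal (feature H z.2 s)) ^ 2) (Measurable.pow_const ?_ 2)
  refine Measurable.lintegral_prod_right' (f := fun z : (Ω × ℝ) × I =>
    g z.2 z.1.1 * ENNReal.ofReal (feature H z.1.2 z.2)) ?_
  exact (hg.comp (by fun_prop : Measurable fun z : (Ω × ℝ) × I => (z.2, z.1.1))).mul
    (measurable_ofReal_feature.comp (by fun_prop : Measurable fun z : (Ω × ℝ) × I => (z.1.2, z.2)))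

theorem ae_ae_swap [SFinite P] {p : I → Ω → Prop}
    (h : ∀ᵐ z : I × Ω ∂(volume : Measure I).prod P, p z.1 z.2) : ∀ᵐ ω ∂P, ∀ᵐ t, p t ω :=
  Measure.ae_ae_of_ae_prod
    ((Measure.measurePreserving_swap (μ := P) (ν := (volume : Measure I))).quasiMeasurePreserving.ae h)

/-- The paths of a process whose `L²` norms have finite energy form a square integrable random
element of `𝔥`. -/
theorem path_spec [SFinite P] (hH : H ∈ Ioo (1 / 2 : ℝ) 1) {v : I → Ω → ℝ} {N : I → ℝ≥0∞}
    (hv : AEStronglyMeasurable (Function.uncurry v) ((volume : Measure I).prod P))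
    (hN : ∀ᵐ t, eLpNorm (v t) 2 P ≤ N t) (hfin : energy H N < ∞) :
    (∀ᵐ ω ∂P, FiniteEnergy H fun t => v t ω) ∧
    ∃ hV : MemLp (fun ω => toHsp hH fun t => v t ω) 2 P,
      ENNReal.ofReal (‖hV.toLp _‖ ^ 2) ≤ energy H N := by
  set v' : I → Ω → ℝ := fun t ω => hv.mk _ (t, ω) with hv'
  have hvm : StronglyMeasurable (Function.uncurry v') := hv.stronglyMeasurable_mk
  have hae : ∀ᵐ z ∂(volume : Measure I).prod P, v z.1 z.2 = v' z.1 z.2 := hv.ae_eq_mk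
  have h1 : ∀ᵐ t, v t =ᵐ[P] v' t := Measure.ae_ae_of_ae_prod hae
  have h2 : ∀ᵐ ω ∂P, (fun t => v t ω) =ᵐ[volume] fun t => v' t ω := ae_ae_swap hae
  have hE : ∫⁻ ω, energy H (fun t => ‖v' t ω‖ₑ) ∂P ≤ energy H N := by
    refine (lintegral_energy_le hH hvm.measurable.enorm).trans (energy_mono ?_)
    filter_upwards [h1, hN] with t ht hNt
    rw [← eLpNorm_congr_ae ht.symm, eLpNorm_eq_lintegral_rpow_enorm_toReal two_ne_zero (by simp)] at hNt
    simpa using hNt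
  have hfe : ∀ᵐ ω ∂P, FiniteEnergy H fun t => v t ω := by
    filter_upwards [h2, ae_lt_top (measurable_energy (g := fun t ω => ‖v' t ω‖ₑ)
      hvm.measurable.enorm) (hE.trans_lt hfin).ne] with ω hω hlt
    have : FiniteEnergy H fun t => v' t ω :=
      ⟨(hvm.comp_measurable measurable_prodMk_right).aestronglyMeasurable, hlt⟩
    exact this.congr hω.symm
  refine ⟨hfe, ?_⟩
  have hVm : AEStronglyMeasurable (fun ω => toHsp hH fun t => v t ω) P := by
    refine aestronglyMeasurable_Hsp fun t => ?_
    have hκ : StronglyMeasurable fun s : I => ∫ r in Iic t, |(s : ℝ) - r| ^ (2 * H - 2) :=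
      StronglyMeasurable.integral_prod_right
        (f := fun (s r : I) => |(s : ℝ) - r| ^ (2 * H - 2))
        (Measurable.stronglyMeasurable (by unfold Function.uncurry; fun_prop))
    have hm : AEStronglyMeasurable (fun ω => alpha H * ∫ s : I, v s ω *
        ∫ r in Iic t, |(s : ℝ) - r| ^ (2 * H - 2)) P := by
      refine AEStronglyMeasurable.const_mul ?_ _
      exact AEStronglyMeasurable.integral_prod_right' (f := fun z : Ω × I => v z.2 z.1 *
        ∫ r in Iic t, |(z.2 : ℝ) - r| ^ (2 * H - 2)) (hv.prod_swap.mul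
          (hκ.comp_measurable measurable_snd).aestronglyMeasurable)
    refine hm.aemeasurable.congr ?_
    filter_upwards [hfe] with ω hω
    rw [(hω.memHsp (hH := hH)).represents.2 t]
    simp_rw [integral_const_mul]
  have hsq : ∫⁻ ω, ‖toHsp hH fun t => v t ω‖ₑ ^ (2 : ℝ) ∂P ≤ energy H N := by
    refine le_trans (lintegral_mono_ae ?_) hE
    filter_upwards [hfe, h2] with ω hω h2ω
    rw [energy_congr (f := fun t => ‖v' t ω‖ₑ) (g := fun t => ‖v t ω‖ₑ)
      (h2ω.mono fun t ht => by simp only [ht])]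
    refine le_trans (le_of_eq ?_) (hω.norm_toHsp_le (hH := hH))
    rw [ENNReal.rpow_two, ← ofReal_norm, ENNReal.ofReal_pow (norm_nonneg _)]
  have hMem : MemLp (fun ω => toHsp hH fun t => v t ω) 2 P := by
    refine ⟨hVm, ?_⟩
    rw [eLpNorm_lt_top_iff_lintegral_rpow_enorm_lt_top (by simp) (by simp)]
    simpa using hsq.trans_lt hfin
  refine ⟨hMem, le_trans (le_of_eq ?_) hsq⟩
  rw [Lp.norm_toLp, ENNReal.ofReal_pow ENNReal.toReal_nonneg, ENNReal.ofReal_toReal hMem.2.ne,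
    eLpNorm_eq_lintegral_rpow_enorm_toReal two_ne_zero (by simp)]
  simp only [ENNReal.toReal_ofNat]
  rw [← ENNReal.rpow_two, ← ENNReal.rpow_mul]
  norm_num

theorem toHsp_sum {ι : Type*} (s : Finset ι) (c : ι → ℝ) {f : ι → I → ℝ}
    (hf : ∀ i, FiniteEnergy H (f i)) :
    FiniteEnergy H (fun t => ∑ i ∈ s, c i * f i t) ∧
      toHsp hH (fun t => ∑ i ∈ s, c i * f i t) = ∑ i ∈ s, c i • toHsp hH (f i) := by
  classical
  induction s using Finset.induction_on with
  | empty =>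
    have h0 : FiniteEnergy H (fun _ : I => (0 : ℝ)) :=
      finiteEnergy_of_bounded hH aestronglyMeasurable_const (C := 0) (by simp)
    refine ⟨by simpa using h0, ?_⟩
    have := h0.toHsp_const_mul (hH := hH) 0
    simpa using this
  | insert i s hi ih =>
    simp_rw [Finset.sum_insert hi]
    refine ⟨((hf i).const_mul _).add ih.1, ?_⟩
    rw [((hf i).const_mul (c i)).toHsp_add ih.1, ih.2, (hf i).toHsp_const_mul]

end

/-! ### The divergence of a process -/

section

/-- Simple approximations of a strongly measurable curve that stay in a given set and are dominated
by twice the norm of the curve. -/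
theorem exists_simpleFunc_tendsto {α E : Type*} [MeasurableSpace α] {μ : Measure α}
    [NormedAddCommGroup E] {w : α → E} (hw : AEStronglyMeasurable w μ) [SecondCountableTopology E]
    {S : Set E} (h0 : 0 ∈ S) (hS : ∀ t, w t ∈ S) : ∃ s : ℕ → SimpleFunc α E,
      (∀ n t, s n t ∈ S) ∧ (∀ᵐ t ∂μ, Tendsto (fun n => s n t) atTop (𝓝 (w t))) ∧
      ∀ n, ∀ᵐ t ∂μ, ‖s n t‖ₑ ≤ 2 * ‖w t‖ₑ := by
  borelize E
  have hm : Measurable (hw.mk w) := hw.stronglyMeasurable_mk.measurable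
  refine ⟨fun n => SimpleFunc.approxOn (hw.mk w) hm S 0 h0 n,
    fun n t => SimpleFunc.approxOn_mem hm h0 n t, ?_, fun n => ?_⟩
  · filter_upwards [hw.ae_eq_mk] with t ht
    rw [ht]
    exact SimpleFunc.tendsto_approxOn hm h0 (subset_closure (ht ▸ hS t))
  · filter_upwards [hw.ae_eq_mk] with t ht
    rw [ht, two_mul]
    have := SimpleFunc.norm_approxOn_zero_le hm h0 t n
    simp only [← ofReal_norm]
    rw [← ENNReal.ofReal_add (norm_nonneg _) (norm_nonneg _)]
    exact ENNReal.ofReal_le_ofReal this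

variable {H : ℝ} {hH : H ∈ Ioo (1 / 2 : ℝ) 1} {Ω : Type*} [MeasurableSpace Ω]
  {B : I → Ω → ℝ} {P : Measure Ω}

/-- The indicator function of a level set of a simple function. -/
def levelInd {E : Type*} (s : SimpleFunc I E) (y : E) : I → ℝ := (s ⁻¹' {y}).indicator 1

theorem measurable_levelInd {E : Type*} (s : SimpleFunc I E) (y : E) : Measurable (levelInd s y) :=
  measurable_one.indicator (s.measurableSet_fiber y)

theorem levelInd_nonneg {E : Type*} (s : SimpleFunc I E) (y : E) (t : I) : 0 ≤ levelInd s y t :=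
  indicator_nonneg (fun _ _ => zero_le_one) t

theorem finiteEnergy_levelInd {E : Type*} (hH : H ∈ Ioo (1 / 2 : ℝ) 1) (s : SimpleFunc I E)
    (y : E) : FiniteEnergy H (levelInd s y) :=
  finiteEnergy_of_bounded hH (measurable_levelInd s y).aestronglyMeasurable (C := 1)
    (.of_forall fun t => by
      by_cases h : t ∈ s ⁻¹' {y} <;> simp [levelInd, h])

theorem sum_mul_levelInd {E : Type*} (s : SimpleFunc I E) (c : E → ℝ) (t : I) :
    ∑ y : s.range, c y * levelInd s y t = c (s t) := by
  rw [Finset.sum_coe_sort s.range fun y => c y * levelInd s y t,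
    Finset.sum_eq_single_of_mem (s t) (s.mem_range_self t)]
  · simp [levelInd]
  · intro y _ hy
    have : t ∉ s ⁻¹' {y} := fun h => hy (Eq.symm h)
    simp [levelInd, this]

/-- The random element of `𝔥` given by a simple process. -/
def simpleVec (s : SimpleFunc I (PairSpace hH P)) : Lp (Hsp H hH) 2 P :=
  ∑ y : s.range, smulVec hH P (y : PairSpace hH P).fst (toHsp hH (levelInd s y))

theorem simpleVec_ae (s : SimpleFunc I (PairSpace hH P)) :
    ∀ᵐ ω ∂P, FiniteEnergy H (fun t => (s t).fst ω) ∧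
      simpleVec s ω = toHsp hH fun t => (s t).fst ω := by
  have h1 := Lp.coeFn_finsetSum Finset.univ fun y : s.range =>
    smulVec hH P (y : PairSpace hH P).fst (toHsp hH (levelInd s y))
  have h2 : ∀ᵐ ω ∂P, ∀ y : s.range, smulVec hH P (y : PairSpace hH P).fst
      (toHsp hH (levelInd s y)) ω = (y : PairSpace hH P).fst ω • toHsp hH (levelInd s y) :=
    ae_all_iff.2 fun y => coeFn_smulVec _ _
  filter_upwards [h1, h2] with ω h1 h2
  have h3 := toHsp_sum (hH := hH) Finset.univ (fun y : s.range => (y : PairSpace hH P).fst ω)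
    (f := fun y : s.range => levelInd s y) fun y => finiteEnergy_levelInd hH s y
  simp_rw [sum_mul_levelInd s fun y => y.fst ω] at h3
  refine ⟨h3.1, ?_⟩
  rw [h3.2, simpleVec, h1, Finset.sum_apply]
  exact Finset.sum_congr rfl fun y _ => h2 y

theorem aestronglyMeasurable_simple (s : SimpleFunc I (PairSpace hH P)) :
    AEStronglyMeasurable (Function.uncurry fun t ω => (s t).fst ω)
      ((volume : Measure I).prod P) := by
  have e : (Function.uncurry fun t ω => (s t).fst ω) = fun z : I × Ω =>
      ∑ y : s.range, (y : PairSpace hH P).fst z.2 * levelInd s y z.1 := by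
    funext z
    exact (sum_mul_levelInd s (fun y => y.fst z.2) z.1).symm
  rw [e]
  refine Finset.aestronglyMeasurable_fun_sum _ fun y _ => ?_
  exact (Lp.aestronglyMeasurable (y : PairSpace hH P).fst).comp_snd.mul
    ((measurable_levelInd s y).comp measurable_fst).aestronglyMeasurable

variable [IsProbabilityMeasure P]

/-- The estimate of the divergence for a simple process: the right-hand side of `divBound_sum` is
the squared norm in `𝔥` of `t ↦ ‖s t‖_{1,2}`. -/
theorem divBound_simpleVec (hB : IsFBM H B P) {s : SimpleFunc I (PairSpace hH P)}
    (hs : ∀ t, s t ∈ sobolev hH B P) :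
    DivBound B (simpleVec s) √(energy H fun t => ‖s t‖ₑ).toReal := by
  have hs' : ∀ y : s.range, (y : PairSpace hH P) ∈ sobolev hH B P := fun y => by
    obtain ⟨t, ht⟩ := s.mem_range.1 y.2
    rw [← ht]
    exact hs t
  refine (divBound_sum hB hs' fun y => toHsp hH (levelInd s y)).mono (Real.sqrt_le_sqrt ?_)
  have h3 := toHsp_sum (hH := hH) Finset.univ (fun y : s.range => ‖(y : PairSpace hH P)‖)
    (f := fun y : s.range => levelInd s y) fun y => finiteEnergy_levelInd hH s y
  simp_rw [sum_mul_levelInd s fun y => ‖y‖] at h3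
  have h4 : ‖toHsp hH fun t => ‖s t‖‖ ^ 2 = ∑ y : s.range, ∑ z : s.range,
      ‖(y : PairSpace hH P)‖ * ‖(z : PairSpace hH P)‖ *
        inner ℝ (toHsp hH (levelInd s y)) (toHsp hH (levelInd s z)) := by
    rw [← real_inner_self_eq_norm_sq, h3.2, sum_inner]
    refine Finset.sum_congr rfl fun y _ => ?_
    rw [inner_sum]
    refine Finset.sum_congr rfl fun z _ => ?_
    rw [real_inner_smul_left, real_inner_smul_right, mul_assoc]
  have h5 : energy H (fun t => ‖s t‖ₑ) = energy H fun t => ‖‖s t‖‖ₑ := by simp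
  have h6 : ‖toHsp hH fun t => ‖s t‖‖ ^ 2 ≤ (energy H fun t => ‖s t‖ₑ).toReal := by
    rw [h5, ← ENNReal.ofReal_le_iff_le_toReal h3.1.2.ne]
    exact h3.1.norm_toHsp_le
  refine le_trans ?_ h6
  rw [h4]
  refine Finset.sum_le_sum fun y _ => Finset.sum_le_sum fun z _ => ?_
  exact mul_le_mul_of_nonneg_right (real_inner_le_norm _ _)
    ((finiteEnergy_levelInd hH s y).inner_toHsp_nonneg (finiteEnergy_levelInd hH s z)
      (levelInd_nonneg s y) (levelInd_nonneg s z))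

/-- Energies of processes with values in `𝔻^{1,2}` control their divergence: if `v` is a version
of the process `w` and `t ↦ ‖w_t‖_{1,2}` has finite energy, then the paths of `v` form an element
of `L²(Ω; 𝔥)` which satisfies the estimate of the domain of the divergence. -/
theorem divBound_path (hB : IsFBM H B P) (hgen : GeneratedBy B P) {v : I → Ω → ℝ}
    {w : I → PairSpace hH P}
    (hv : AEStronglyMeasurable (Function.uncurry v) ((volume : Measure I).prod P))
    (hw : AEStronglyMeasurable w volume) (hS : ∀ t, w t ∈ sobolev hH B P)
    (hvw : ∀ᵐ t, v t =ᵐ[P] (w t).fst) (hfin : energy H (fun t => ‖w t‖ₑ) < ∞) :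
    (∀ᵐ ω ∂P, FiniteEnergy H fun t => v t ω) ∧
    ∃ hV : MemLp (fun ω => toHsp hH fun t => v t ω) 2 P,
      DivBound B (hV.toLp _) √(energy H fun t => ‖w t‖ₑ).toReal := by
  have := secondCountable_L2 hH hB hgen
  have := secondCountable_L2_Hsp (hH := hH) hB hgen
  have : SecondCountableTopology (PairSpace hH P) :=
    (WithLp.prodContinuousLinearEquiv 2 ℝ (Lp ℝ 2 P)
      (Lp (Hsp H hH) 2 P)).toHomeomorph.secondCountableTopology
  have hle : ∀ x : PairSpace hH P, ‖x.fst‖ₑ ≤ ‖x‖ₑ := fun x => by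
    rw [← ofReal_norm, ← ofReal_norm]
    refine ENNReal.ofReal_le_ofReal (abs_le_of_sq_le_sq' ?_ (norm_nonneg x)).2
    rw [WithLp.prod_norm_sq_eq_of_L2 x]
    linarith [sq_nonneg ‖x.snd‖]
  have hN : ∀ᵐ t, eLpNorm (v t) 2 P ≤ ‖w t‖ₑ := hvw.mono fun t ht => by
    rw [eLpNorm_congr_ae ht, ← Lp.enorm_def]
    exact hle _
  obtain ⟨hfe, hV, -⟩ := path_spec hH hv hN hfin
  refine ⟨hfe, hV, ?_⟩
  obtain ⟨s, hsS, hlim, hdom⟩ := exists_simpleFunc_tendsto hw (S := sobolev hH B P)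
    (Submodule.zero_mem _) hS
  have hdom3 : ∀ n, (fun t => ‖w t - s n t‖ₑ) ≤ᵐ[volume] fun t => 3 * ‖w t‖ₑ := fun n =>
    (hdom n).mono fun t ht => by
      refine (enorm_sub_le).trans ((add_le_add le_rfl ht).trans_eq ?_)
      ring
  have hfin3 : energy H (fun t => 3 * ‖w t‖ₑ) < ∞ := by
    rw [energy_const_mul hw.enorm]
    exact ENNReal.mul_lt_top (by finiteness) hfin
  have hfin2 : energy H (fun t => 2 * ‖w t‖ₑ) < ∞ := by
    rw [energy_const_mul hw.enorm]
    exact ENNReal.mul_lt_top (by finiteness) hfin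
  have hE0 : Tendsto (fun n => energy H fun t => ‖w t - s n t‖ₑ) atTop (𝓝 0) := by
    have h := tendsto_energy (H := H) (f := fun n t => ‖w t - s n t‖ₑ) (g := fun _ => 0)
      (fun n => (hw.sub (s n).aestronglyMeasurable).enorm) (hw.enorm.const_mul 3) hdom3 hfin3
      (hlim.mono fun t ht => by
        have := (tendsto_const_nhds (x := w t)).sub ht
        rw [sub_self] at this
        simpa using this.enorm)
    simpa [energy, potential] using h
  have hE1 : Tendsto (fun n => energy H fun t => ‖s n t‖ₑ) atTop
      (𝓝 (energy H fun t => ‖w t‖ₑ)) :=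
    tendsto_energy (fun n => (s n).aestronglyMeasurable.enorm) (hw.enorm.const_mul 2) hdom hfin2
      (hlim.mono fun t ht => ht.enorm)
  have hclose : ∀ n, ENNReal.ofReal (‖simpleVec (s n) - hV.toLp _‖ ^ 2) ≤
      energy H fun t => ‖w t - s n t‖ₑ := by
    intro n
    have hd : AEStronglyMeasurable (Function.uncurry fun t ω => v t ω - (s n t).fst ω)
      ((volume : Measure I).prod P) := hv.sub (aestronglyMeasurable_simple (s n))
    have hNd : ∀ᵐ t, eLpNorm (fun ω => v t ω - (s n t).fst ω) 2 P ≤ ‖w t - s n t‖ₑ := by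
      filter_upwards [hvw] with t ht
      have : (fun ω => v t ω - (s n t).fst ω) =ᵐ[P] (w t - s n t).fst :=
        EventuallyEq.trans (ht.sub .rfl) (Lp.coeFn_sub (w t).fst (s n t).fst).symm
      rw [eLpNorm_congr_ae this, ← Lp.enorm_def]
      exact hle _
    obtain ⟨-, hD, hDle⟩ := path_spec hH hd hNd ((energy_mono (hdom3 n)).trans_lt hfin3)
    have e : hV.toLp _ = hD.toLp _ + simpleVec (s n) := by
      refine Lp.ext ?_
      filter_upwards [hV.coeFn_toLp, hD.coeFn_toLp, Lp.coeFn_add (hD.toLp _) (simpleVec (s n)),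
        simpleVec_ae (s n), hfe] with ω h1 h2 h3 h4 h5
      rw [h3, Pi.add_apply, h1, h2, h4.2, ← sub_eq_iff_eq_add]
      have h6 := h5.toHsp_add (hH := hH) (h4.1.const_mul (-1))
      rw [h4.1.toHsp_const_mul] at h6
      rw [sub_eq_add_neg, ← neg_one_smul ℝ, ← h6]
      congr 1
      funext t
      ring
    rw [e, sub_add_cancel_right, norm_neg]
    exact hDle
  have hlimV : Tendsto (fun n => simpleVec (s n)) atTop (𝓝 (hV.toLp _)) := by
    rw [tendsto_iff_norm_sub_tendsto_zero]
    have h1 : Tendsto (fun n => ‖simpleVec (s n) - hV.toLp _‖ ^ 2) atTop (𝓝 0) := by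
      have h2 := tendsto_of_tendsto_of_tendsto_of_le_of_le tendsto_const_nhds hE0
        (fun _ => bot_le) hclose
      have h3 := (ENNReal.tendsto_toReal ENNReal.zero_ne_top).comp h2
      refine h3.congr fun n => ?_
      exact ENNReal.toReal_ofReal (sq_nonneg _)
    have h2 := h1.sqrt
    simpa using h2
  refine DivBound.of_tendsto hlimV (((ENNReal.tendsto_toReal hfin.ne).comp hE1).sqrt)
    (.of_forall fun n => divBound_simpleVec hB (hsS n))

end

/-! ### Stable convergence of Wiener integrals -/

section

/-- Weak convergence of a bounded sequence can be tested on a total set. -/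
theorem tendsto_inner_of_total {V : Type*} [NormedAddCommGroup V] [InnerProductSpace ℝ V]
    {z : ℕ → V} {z₀ : V} {M : ℝ} (hM : ∀ n, ‖z n‖ ≤ M) {S : Set V}
    (hS : Dense (Submodule.span ℝ S : Set V))
    (h : ∀ s ∈ S, Tendsto (fun n => inner ℝ s (z n)) atTop (𝓝 (inner ℝ s z₀))) (v : V) :
    Tendsto (fun n => inner ℝ v (z n)) atTop (𝓝 (inner ℝ v z₀)) := by
  have hspan : ∀ s ∈ Submodule.span ℝ S,
      Tendsto (fun n => inner ℝ s (z n)) atTop (𝓝 (inner ℝ s z₀)) := by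
    intro s hs
    induction hs using Submodule.span_induction with
    | mem s hs => exact h s hs
    | zero => simp
    | add s t _ _ h1 h2 => simpa only [inner_add_left] using h1.add h2
    | smul c s _ h1 => simpa only [real_inner_smul_left] using h1.const_mul c
  have hM0 : 0 ≤ M := (norm_nonneg _).trans (hM 0)
  rw [Metric.tendsto_atTop]
  intro ε hε
  have hK : 0 < M + ‖z₀‖ + 1 := by positivity
  obtain ⟨s, hs, hvs⟩ := Metric.mem_closure_iff.1 (hS v) (ε / (2 * (M + ‖z₀‖ + 1))) (by positivity)
  obtain ⟨N, hN⟩ := Metric.tendsto_atTop.1 (hspan s hs) (ε / 2) (by positivity)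
  refine ⟨N, fun n hn => ?_⟩
  have h1 := hN n hn
  rw [Real.dist_eq] at h1 ⊢
  have e : inner ℝ v (z n) - inner ℝ v z₀ =
      inner ℝ (v - s) (z n - z₀) + (inner ℝ s (z n) - inner ℝ s z₀) := by
    simp only [inner_sub_left, inner_sub_right]; ring
  have h2 : |inner ℝ (v - s) (z n - z₀)| ≤ ε / (2 * (M + ‖z₀‖ + 1)) * (M + ‖z₀‖ + 1) := by
    refine (abs_real_inner_le_norm _ _).trans (mul_le_mul ?_ ?_ (norm_nonneg _) (by positivity))
    · rw [← dist_eq_norm]; exact hvs.le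
    · linarith [norm_sub_le (z n) z₀, hM n]
  have h3 : ε / (2 * (M + ‖z₀‖ + 1)) * (M + ‖z₀‖ + 1) = ε / 2 := by field_simp
  rw [e]
  calc _ ≤ _ := abs_add_le _ _
    _ < ε := by linarith

variable {H : ℝ} {hH : H ∈ Ioo (1 / 2 : ℝ) 1} {Ω : Type*} [MeasurableSpace Ω]
  {B : I → Ω → ℝ} {P : Measure Ω} [IsProbabilityMeasure P]

theorem norm_Lp_le_one_of_abs_le {F : Lp ℝ 2 P} (h : ∀ᵐ ω ∂P, |F ω| ≤ 1) : ‖F‖ ≤ 1 := by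
  have := Lp.norm_le_of_ae_bound (f := F) (C := 1) zero_le_one (h.mono fun ω hω => hω)
  have hu : measureUnivNNReal P = 1 := by simp [measureUnivNNReal]
  simpa [hu] using this

theorem norm_wcos_le (hB : IsFBM H B P) (h : Hsp H hH) : ‖wcos hB h‖ ≤ 1 :=
  norm_Lp_le_one_of_abs_le ((coeFn_wcos hB h).mono fun ω e => by
    rw [e]; exact Real.abs_cos_le_one _)

theorem norm_wsin_le (hB : IsFBM H B P) (h : Hsp H hH) : ‖wsin hB h‖ ≤ 1 :=
  norm_Lp_le_one_of_abs_le ((coeFn_wsin hB h).mono fun ω e => by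
    rw [e]; exact Real.abs_sin_le_one _)

theorem integral_exp_sum (hB : IsFBM H B P) (T : Finset I) (a : I → ℝ) :
    ∫ ω, Complex.exp ((∑ t ∈ T, a t * B t ω : ℝ) * Complex.I) ∂P =
      Complex.exp (-(‖∑ t ∈ T, a t • ind hH t‖ ^ 2 / 2 : ℝ)) := by
  set Y : Ω → ℝ := fun ω => ∑ t ∈ T, a t * B t ω with hY
  have hG : HasGaussianLaw Y P := by
    have := (hB.hasGaussianLaw T).map_fun
      (∑ t : T, a t • ContinuousLinearMap.proj (R := ℝ) (φ := fun _ : T => ℝ) t)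
    have e : (fun ω => (∑ t : T, a t • ContinuousLinearMap.proj (R := ℝ) (φ := fun _ : T => ℝ) t)
        fun i : T => B i ω) = Y := funext fun ω => by
      simp only [hY, sum_apply, smul_apply, ContinuousLinearMap.proj_apply, smul_eq_mul]
      rw [← Finset.sum_coe_sort T]
    exact e ▸ this
  have hm : P[Y] = 0 := by
    show ∫ ω, ∑ t ∈ T, a t * B t ω ∂P = 0
    rw [integral_finsetSum _ fun t _ => ((hB.memLp t).integrable one_le_two).const_mul _]
    refine Finset.sum_eq_zero fun t _ => ?_
    rw [integral_const_mul, hB.mean_zero, mul_zero]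
  have hv : Var[Y; P] = ‖∑ t ∈ T, a t • ind hH t‖ ^ 2 := by
    rw [variance_of_integral_eq_zero hG.aemeasurable hm, ← (wiener hH hB).norm_map,
      ← real_inner_self_eq_norm_sq, L2.inner_def]
    refine integral_congr_ae ((coeFn_wiener_sum (hH := hH) hB T a).mono fun ω h => ?_)
    simp only [h]
    rw [real_inner_self_eq_norm_sq, Real.norm_eq_abs, sq_abs]
  have h1 : ∫ ω, Complex.exp ((Y ω : ℝ) * Complex.I) ∂P = charFun (P.map Y) 1 := by
    rw [charFun_apply_real, integral_map hG.aemeasurable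
      (Measurable.aestronglyMeasurable (by fun_prop))]
    simp
  have h2 : ((‖∑ t ∈ T, a t • ind hH t‖ ^ 2).toNNReal : ℝ) = ‖∑ t ∈ T, a t • ind hH t‖ ^ 2 :=
    Real.coe_toNNReal _ (sq_nonneg _)
  rw [h1, hG.map_eq_gaussianReal, hm, hv, charFun_gaussianReal]
  congr 1
  have h3 : ((‖∑ t ∈ T, a t • ind hH t‖ ^ 2).toNNReal : ℂ) =
    ((‖∑ t ∈ T, a t • ind hH t‖ ^ 2 : ℝ) : ℂ) := by exact_mod_cast h2
  rw [h3]
  push_cast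
  ring

theorem integral_trig_sum (hB : IsFBM H B P) (T : Finset I) (a : I → ℝ) :
    ∫ ω, Real.cos (∑ t ∈ T, a t * B t ω) ∂P = Real.exp (-(‖∑ t ∈ T, a t • ind hH t‖ ^ 2 / 2)) ∧
    ∫ ω, Real.sin (∑ t ∈ T, a t * B t ω) ∂P = 0 := by
  have hX : Measurable fun ω => ∑ t ∈ T, a t * B t ω :=
    Finset.measurable_fun_sum _ fun t _ => (hB.measurable t).const_mul _
  have h := integral_exp_sum (hH := hH) hB T a
  have e : ∀ ω, Complex.exp ((∑ t ∈ T, a t * B t ω : ℝ) * Complex.I) =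
      (Real.cos (∑ t ∈ T, a t * B t ω) : ℂ) + (Real.sin (∑ t ∈ T, a t * B t ω) : ℂ) * Complex.I :=
    fun ω => by rw [Complex.exp_mul_I, ← Complex.ofReal_cos, ← Complex.ofReal_sin]
  have i1 : Integrable (fun ω => Real.cos (∑ t ∈ T, a t * B t ω)) P :=
    Integrable.of_bound (Real.measurable_cos.comp hX).aestronglyMeasurable 1
      (ae_of_all _ fun ω => Real.abs_cos_le_one _)
  have i2 : Integrable (fun ω => Real.sin (∑ t ∈ T, a t * B t ω)) P :=
    Integrable.of_bound (Real.measurable_sin.comp hX).aestronglyMeasurable 1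
      (ae_of_all _ fun ω => Real.abs_sin_le_one _)
  simp_rw [e] at h
  rw [integral_add i1.ofReal (i2.ofReal.mul_const _), integral_mul_const, integral_complex_ofReal,
    integral_complex_ofReal, ← Complex.ofReal_neg, ← Complex.ofReal_exp] at h
  refine ⟨?_, ?_⟩
  · have := congrArg Complex.re h
    simpa only [Complex.add_re, Complex.ofReal_re, Complex.mul_re, Complex.ofReal_im, Complex.I_re,
      Complex.I_im, mul_zero, sub_zero, zero_mul, add_zero] using this
  · have := congrArg Complex.im h
    simpa only [Complex.add_im, Complex.ofReal_re, Complex.mul_im, Complex.ofReal_im, Complex.I_re,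
      Complex.I_im, mul_zero, mul_one, zero_add, add_zero] using this

theorem inner_one {P : Measure Ω} [IsFiniteMeasure P] (F : Lp ℝ 2 P) :
    inner ℝ (Lp.const 2 P (1 : ℝ)) F = ∫ ω, F ω ∂P := by
  rw [L2.inner_def]
  refine integral_congr_ae ((Lp.coeFn_const (p := 2) (μ := P) (1 : ℝ)).mono fun ω h => ?_)
  simp only
  rw [h]
  simp

/-- The characteristic function of the isonormal process. -/
theorem integral_wcos_wsin (hB : IsFBM H B P) (h : Hsp H hH) :
    ∫ ω, wcos hB h ω ∂P = Real.exp (-(‖h‖ ^ 2 / 2)) ∧ ∫ ω, wsin hB h ω ∂P = 0 := by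
  have hc : IsClosed {h : Hsp H hH | inner ℝ (Lp.const 2 P (1 : ℝ)) (wcos hB h) =
      Real.exp (-(‖h‖ ^ 2 / 2)) ∧ inner ℝ (Lp.const 2 P (1 : ℝ)) (wsin hB h) = 0} :=
    (isClosed_eq (continuous_const.inner (continuous_wcos hB)) (by fun_prop)).inter
      (isClosed_eq (continuous_const.inner (continuous_wsin hB)) continuous_const)
  rw [← inner_one, ← inner_one]
  refine closure_minimal ?_ hc (dense_span_ind h)
  intro k hk
  obtain ⟨c, rfl⟩ := Finsupp.mem_span_range_iff_exists_finsupp.1 hk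
  have := integral_trig_sum (hH := hH) hB c.support c
  refine ⟨?_, ?_⟩
  · rw [inner_one]
    exact (integral_congr_ae (coeFn_wcos_sum (hH := hH) hB c.support c)).trans this.1
  · rw [inner_one]
    exact (integral_congr_ae (coeFn_wsin_sum (hH := hH) hB c.support c)).trans this.2

/-- The Gram matrix of the `cos X(h)` and `sin X(h)`, from the product formulas and the Gaussian
characteristic function of `X(h ± k)`. -/
theorem inner_trig_trig (hB : IsFBM H B P) (h k : Hsp H hH) :
    inner ℝ (wcos hB h) (wcos hB k) =
      (Real.exp (-(‖h + k‖ ^ 2 / 2)) + Real.exp (-(‖h - k‖ ^ 2 / 2))) / 2 ∧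
    inner ℝ (wsin hB h) (wsin hB k) =
      (Real.exp (-(‖h - k‖ ^ 2 / 2)) - Real.exp (-(‖h + k‖ ^ 2 / 2))) / 2 ∧
    inner ℝ (wcos hB h) (wsin hB k) = 0 ∧ inner ℝ (wsin hB h) (wcos hB k) = 0 := by
  have ip : wiener hH hB (h + k) =ᵐ[P] fun ω => wiener hH hB h ω + wiener hH hB k ω := by
    rw [map_add]; exact Lp.coeFn_add _ _
  have im : wiener hH hB (h - k) =ᵐ[P] fun ω => wiener hH hB h ω - wiener hH hB k ω := by
    rw [map_sub]; exact Lp.coeFn_sub _ _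
  have hi : ∀ F : Lp ℝ 2 P, Integrable F P := fun F => (Lp.memLp F).integrable one_le_two
  have hall : ∀ᵐ ω ∂P,
      (wcos hB (h + k) ω = Real.cos (wiener hH hB h ω + wiener hH hB k ω) ∧
        wcos hB (h - k) ω = Real.cos (wiener hH hB h ω - wiener hH hB k ω)) ∧
      (wsin hB (h + k) ω = Real.sin (wiener hH hB h ω + wiener hH hB k ω) ∧
        wsin hB (h - k) ω = Real.sin (wiener hH hB h ω - wiener hH hB k ω)) ∧
      (wcos hB h ω = Real.cos (wiener hH hB h ω) ∧ wsin hB h ω = Real.sin (wiener hH hB h ω)) ∧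
      (wcos hB k ω = Real.cos (wiener hH hB k ω) ∧ wsin hB k ω = Real.sin (wiener hH hB k ω)) := by
    filter_upwards [ip, im, coeFn_wcos hB (h + k), coeFn_wcos hB (h - k), coeFn_wsin hB (h + k),
      coeFn_wsin hB (h - k), coeFn_wcos hB h, coeFn_wsin hB h, coeFn_wcos hB k, coeFn_wsin hB k]
      with ω h1 h2 h3 h4 h5 h6 h7 h8 h9 h10
    rw [h1] at h3 h5
    rw [h2] at h4 h6
    exact ⟨⟨h3, h4⟩, ⟨h5, h6⟩, ⟨h7, h8⟩, ⟨h9, h10⟩⟩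
  refine ⟨?_, ?_, ?_, ?_⟩
  · rw [← (integral_wcos_wsin hB (h + k)).1, ← (integral_wcos_wsin hB (h - k)).1,
      ← integral_add (hi _) (hi _), ← integral_div, L2.inner_def]
    refine integral_congr_ae (hall.mono fun ω ⟨⟨a1, a2⟩, ⟨a3, a4⟩, ⟨a5, a6⟩, a7, a8⟩ => ?_)
    simp only [a1, a2, a5, a7, Real.cos_add, Real.cos_sub, real_inner_eq_re_inner]
    simp
    ring
  · rw [← (integral_wcos_wsin hB (h + k)).1, ← (integral_wcos_wsin hB (h - k)).1,
      ← integral_sub (hi _) (hi _), ← integral_div, L2.inner_def]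
    refine integral_congr_ae (hall.mono fun ω ⟨⟨a1, a2⟩, ⟨a3, a4⟩, ⟨a5, a6⟩, a7, a8⟩ => ?_)
    simp only [a1, a2, a6, a8, Real.cos_add, Real.cos_sub, real_inner_eq_re_inner]
    simp
    ring
  · have : (0 : ℝ) = (∫ ω, wsin hB (h + k) ω ∂P - ∫ ω, wsin hB (h - k) ω ∂P) / 2 := by
      rw [(integral_wcos_wsin hB (h + k)).2, (integral_wcos_wsin hB (h - k)).2]; simp
    rw [this, ← integral_sub (hi _) (hi _), ← integral_div, L2.inner_def]
    refine integral_congr_ae (hall.mono fun ω ⟨⟨a1, a2⟩, ⟨a3, a4⟩, ⟨a5, a6⟩, a7, a8⟩ => ?_)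
    simp only [a3, a4, a5, a8, Real.sin_add, Real.sin_sub, real_inner_eq_re_inner]
    simp
    ring
  · have : (0 : ℝ) = (∫ ω, wsin hB (h + k) ω ∂P + ∫ ω, wsin hB (h - k) ω ∂P) / 2 := by
      rw [(integral_wcos_wsin hB (h + k)).2, (integral_wcos_wsin hB (h - k)).2]; simp
    rw [this, ← integral_add (hi _) (hi _), ← integral_div, L2.inner_def]
    refine integral_congr_ae (hall.mono fun ω ⟨⟨a1, a2⟩, ⟨a3, a4⟩, ⟨a5, a6⟩, a7, a8⟩ => ?_)
    simp only [a3, a4, a6, a7, Real.sin_add, Real.sin_sub, real_inner_eq_re_inner]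
    simp
    ring

/-- If `k_n ⇀ 0` in `𝔥` and `‖k_n‖² → L`, then `e^{i X(k_n)} ⇀ e^{-L/2}` in `L²(Ω)`: in the limit
`X(k_n)` is Gaussian and independent of everything. -/
theorem tendsto_inner_wcos_wsin (hB : IsFBM H B P) (hgen : GeneratedBy B P) {k : ℕ → Hsp H hH}
    {L : ℝ} (hk : ∀ h, Tendsto (fun n => inner ℝ h (k n)) atTop (𝓝 0))
    (hL : Tendsto (fun n => ‖k n‖ ^ 2) atTop (𝓝 L)) (Y : Lp ℝ 2 P) :
    Tendsto (fun n => inner ℝ Y (wcos hB (k n))) atTop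
      (𝓝 (Real.exp (-(L / 2)) * ∫ ω, Y ω ∂P)) ∧
    Tendsto (fun n => inner ℝ Y (wsin hB (k n))) atTop (𝓝 0) := by
  have hp : ∀ h : Hsp H hH, Tendsto (fun n => Real.exp (-(‖h + k n‖ ^ 2 / 2))) atTop
      (𝓝 (Real.exp (-(‖h‖ ^ 2 / 2)) * Real.exp (-(L / 2)))) := fun h => by
    have h1 := ((((hk h).const_mul 2).const_add (‖h‖ ^ 2)).add hL).div_const 2
    have h2 := (Real.continuous_exp.tendsto _).comp h1.neg
    rw [← Real.exp_add]
    convert h2 using 3 with n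
    · simp only [Function.comp_def]
      rw [norm_add_sq_real]
    · ring
  have hm : ∀ h : Hsp H hH, Tendsto (fun n => Real.exp (-(‖h - k n‖ ^ 2 / 2))) atTop
      (𝓝 (Real.exp (-(‖h‖ ^ 2 / 2)) * Real.exp (-(L / 2)))) := fun h => by
    have h1 := ((((hk h).const_mul 2).const_sub (‖h‖ ^ 2)).add hL).div_const 2
    have h2 := (Real.continuous_exp.tendsto _).comp h1.neg
    rw [← Real.exp_add]
    convert h2 using 3 with n
    · simp only [Function.comp_def]
      rw [norm_sub_sq_real]
    · ring
  have hdense : Dense (Submodule.span ℝ (range (wcos (hH := hH) hB) ∪ range (wsin (hH := hH) hB)) :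
      Set (Lp ℝ 2 P)) := by
    rw [Submodule.dense_iff_topologicalClosure_eq_top, Submodule.topologicalClosure_eq_top_iff,
      Submodule.eq_bot_iff]
    exact fun F hF => eq_zero_of_inner_trig (hH := hH) hB hgen fun _ _ =>
      ⟨(Submodule.mem_orthogonal' _ _).1 hF _ (Submodule.subset_span (Or.inl (mem_range_self _))),
        (Submodule.mem_orthogonal' _ _).1 hF _ (Submodule.subset_span (Or.inr (mem_range_self _)))⟩
  constructor
  · have := tendsto_inner_of_total (z := fun n => wcos hB (k n))
      (z₀ := Real.exp (-(L / 2)) • Lp.const 2 P (1 : ℝ)) (M := 1) (fun n => norm_wcos_le hB _)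
      hdense ?_ Y
    · rwa [real_inner_smul_right, real_inner_comm, inner_one] at this
    · rintro _ (⟨h, rfl⟩ | ⟨h, rfl⟩)
      · rw [real_inner_smul_right, real_inner_comm, inner_one, (integral_wcos_wsin hB h).1]
        simp_rw [fun n => (inner_trig_trig hB h (k n)).1]
        convert ((hp h).add (hm h)).div_const 2 using 2
        ring
      · rw [real_inner_smul_right, real_inner_comm, inner_one, (integral_wcos_wsin hB h).2]
        simp_rw [fun n => (inner_trig_trig hB h (k n)).2.2.2]
        simp
  · have := tendsto_inner_of_total (z := fun n => wsin hB (k n))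
      (z₀ := 0) (M := 1) (fun n => norm_wsin_le hB _) hdense ?_ Y
    · rwa [inner_zero_right] at this
    · rintro _ (⟨h, rfl⟩ | ⟨h, rfl⟩)
      · simp_rw [fun n => (inner_trig_trig hB h (k n)).2.2.1]
        simp
      · rw [inner_zero_right]
        simp_rw [fun n => (inner_trig_trig hB h (k n)).2.1]
        convert ((hm h).sub (hp h)).div_const 2 using 2
        ring

end

/-! ### Kernels that concentrate at the right end point -/

section

variable {H : ℝ} {hH : H ∈ Ioo (1 / 2 : ℝ) 1} {φ : ℕ → I → ℝ}

/-- The supremum over `[0,δ]` is at most that over `[0,1]`, so its square is bounded by the product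
of the two. -/
theorem tendsto_iSup_Iic (hφ0 : ∀ n t, 0 ≤ φ n t) (hφb : ∀ n, ∃ C : ℝ, ∀ t, φ n t ≤ C) {δ : I}
    (h3 : Tendsto (fun n => (⨆ t : Iic δ, φ n t) * ⨆ t : I, φ n t) atTop (𝓝 0)) :
    Tendsto (fun n => ⨆ t : Iic δ, φ n t) atTop (𝓝 0) := by
  have h0 : ∀ n, 0 ≤ ⨆ t : Iic δ, φ n t := fun n => Real.iSup_nonneg fun t => hφ0 n t
  have hle : ∀ n, ⨆ t : Iic δ, φ n t ≤ ⨆ t : I, φ n t := fun n => by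
    obtain ⟨C, hC⟩ := hφb n
    have : Nonempty (Iic δ) := ⟨⟨δ, mem_Iic.2 le_rfl⟩⟩
    exact ciSup_le fun t => le_ciSup (f := fun t : I => φ n t) ⟨C, by rintro _ ⟨s, rfl⟩; exact hC s⟩
      (t : I)
  have hsq : Tendsto (fun n => (⨆ t : Iic δ, φ n t) ^ 2) atTop (𝓝 0) :=
    squeeze_zero (fun n => sq_nonneg _)
      (fun n => by rw [sq]; exact mul_le_mul_of_nonneg_left (hle n) (h0 n)) h3
  have := hsq.sqrt
  simpa [Real.sqrt_sq (h0 _)] using this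

theorem le_iSup_Iic (hφb : ∀ n, ∃ C : ℝ, ∀ t, φ n t ≤ C) {δ : I} (n : ℕ) {t : I} (ht : t ≤ δ) :
    φ n t ≤ ⨆ t : Iic δ, φ n t := by
  obtain ⟨C, hC⟩ := hφb n
  exact le_ciSup (f := fun t : Iic δ => φ n t) ⟨C, by rintro _ ⟨s, rfl⟩; exact hC s⟩ ⟨t, ht⟩

theorem exists_lt_one_lt_kernel (hH : H ∈ Ioo (1 / 2 : ℝ) 1) (K : ℝ) :
    ∃ δ : I, δ < 1 ∧ K < alpha H * (1 - δ : ℝ) ^ (2 * H - 2) := by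
  have h1 : Tendsto (fun d : ℝ => alpha H * d ^ (2 * H - 2)) (𝓝[>] 0) atTop := by
    have := tendsto_rpow_neg_nhdsGT_zero (y := 2 * H - 2) (by linarith [hH.2])
    exact this.const_mul_atTop (alpha_pos hH)
  obtain ⟨d, hd, hd0, hd1⟩ := ((h1.eventually_gt_atTop K).and
    (Ioo_mem_nhdsGT (zero_lt_one (α := ℝ)))).exists
  refine ⟨⟨1 - d, by linarith, by linarith⟩, ?_, by simpa using hd⟩
  rw [← Subtype.coe_lt_coe]
  simp only [Icc.coe_one]
  linarith

/-- A sequence of kernels that is bounded in `𝔥` and tends to zero uniformly on every `[0,δ]`,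
`δ < 1`, tends to zero in `L¹`. -/
theorem tendsto_lintegral_kernel (hH : H ∈ Ioo (1 / 2 : ℝ) 1) (hφm : ∀ n, AEMeasurable (φ n))
    (hφ0 : ∀ n t, 0 ≤ φ n t) (hφb : ∀ n, ∃ C : ℝ, ∀ t, φ n t ≤ C)
    (h3 : ∀ δ : I, δ < 1 →
      Tendsto (fun n => (⨆ t : Iic δ, φ n t) * ⨆ t : I, φ n t) atTop (𝓝 0))
    {M : ℝ} (hM : ∀ n, energy H (fun t => ‖φ n t‖ₑ) ≤ ENNReal.ofReal M) :
    Tendsto (fun n => ∫⁻ t, ‖φ n t‖ₑ) atTop (𝓝 0) := by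
  rw [ENNReal.tendsto_nhds_zero]
  intro ε hε
  obtain ⟨e, he0, heε⟩ : ∃ e : ℝ, 0 < e ∧ ENNReal.ofReal (2 * e) ≤ ε := by
    rcases eq_or_ne ε ∞ with rfl | hε'
    · exact ⟨1, one_pos, le_top⟩
    · refine ⟨ε.toReal / 2, half_pos (ENNReal.toReal_pos hε.ne' hε'), ?_⟩
      rw [mul_div_cancel₀ _ two_ne_zero, ENNReal.ofReal_toReal hε']
  obtain ⟨δ, hδ1, hδ⟩ := exists_lt_one_lt_kernel hH (M / e ^ 2)
  have hκ : 0 < alpha H * (1 - δ : ℝ) ^ (2 * H - 2) :=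
    mul_pos (alpha_pos hH) (Real.rpow_pos_of_pos (sub_pos.2 hδ1) _)
  have htail : ∀ n, ∫⁻ t in Ici δ, ‖φ n t‖ₑ ≤ ENNReal.ofReal e := by
    intro n
    by_contra! hlt
    have h1 := (sq_setLIntegral_le_energy hH (hφm n).enorm hδ1).trans (hM n)
    have h2 : ENNReal.ofReal (alpha H * (1 - δ : ℝ) ^ (2 * H - 2)) * ENNReal.ofReal e ^ 2 ≤
        ENNReal.ofReal M := le_trans (by gcongr) h1
    rw [← ENNReal.ofReal_pow he0.le, ← ENNReal.ofReal_mul hκ.le] at h2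
    have h3 : 0 < alpha H * (1 - δ : ℝ) ^ (2 * H - 2) * e ^ 2 := by positivity
    have h4 := (ENNReal.ofReal_le_ofReal_iff' ).1 h2
    rw [div_lt_iff₀ (by positivity)] at hδ
    rcases h4 with h4 | h4 <;> linarith
  have hlim := tendsto_iSup_Iic hφ0 hφb (h3 δ hδ1)
  filter_upwards [hlim.eventually_lt_const he0] with n hn
  have hu : (univ : Set I) ⊆ Iic δ ∪ Ici δ := fun t _ => le_total t δ
  calc ∫⁻ t, ‖φ n t‖ₑ ≤ ∫⁻ t in Iic δ ∪ Ici δ, ‖φ n t‖ₑ := by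
        rw [← setLIntegral_univ]; exact lintegral_mono_set hu
    _ ≤ (∫⁻ t in Iic δ, ‖φ n t‖ₑ) + ∫⁻ t in Ici δ, ‖φ n t‖ₑ := lintegral_union_le _ _ _
    _ ≤ ENNReal.ofReal e + ENNReal.ofReal e := by
        refine add_le_add ?_ (htail n)
        refine (setLIntegral_mono' (g := fun _ => ENNReal.ofReal e) measurableSet_Iic
          fun t ht => ?_).trans ?_
        · rw [Real.enorm_of_nonneg (hφ0 n t)]
          exact ENNReal.ofReal_le_ofReal ((le_iSup_Iic hφb n ht).trans hn.le)
        · rw [setLIntegral_const]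
          exact mul_le_of_le_one_right' prob_le_one
    _ = ENNReal.ofReal (2 * e) := by rw [← ENNReal.ofReal_add he0.le he0.le, two_mul]
    _ ≤ ε := heε

/-- The kernels concentrate at the right end point: their product with a function of finite
energy that vanishes there tends to zero in energy. -/
theorem tendsto_energy_kernel_mul (hφm : ∀ n, AEMeasurable (φ n))
    (hφ0 : ∀ n t, 0 ≤ φ n t) (hφb : ∀ n, ∃ C : ℝ, ∀ t, φ n t ≤ C)
    (h3 : ∀ δ : I, δ < 1 →
      Tendsto (fun n => (⨆ t : Iic δ, φ n t) * ⨆ t : I, φ n t) atTop (𝓝 0))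
    {M : ℝ} (hM : ∀ n, energy H (fun t => ‖φ n t‖ₑ) ≤ ENNReal.ofReal M)
    {g : I → ℝ≥0∞} (hg : AEMeasurable g) (hgE : energy H g < ∞) (hg1 : Tendsto g (𝓝 1) (𝓝 0)) :
    Tendsto (fun n => energy H fun t => ‖φ n t‖ₑ * g t) atTop (𝓝 0) := by
  rw [ENNReal.tendsto_nhds_zero]
  intro η hη
  have h1 : Tendsto (fun e : ℝ => 4 * (ENNReal.ofReal e ^ 2 * ENNReal.ofReal M)) (𝓝[>] 0)
      (𝓝 0) := by
    have h2 : Tendsto (fun e : ℝ => ENNReal.ofReal e ^ 2) (𝓝[>] 0) (𝓝 0) := by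
      have : Continuous fun e : ℝ => ENNReal.ofReal e ^ 2 :=
        (ENNReal.continuous_pow 2).comp ENNReal.continuous_ofReal
      have h := (this.tendsto 0).mono_left (nhdsWithin_le_nhds (s := Ioi 0))
      simpa using h
    have h4 := ENNReal.Tendsto.const_mul (a := 4) (ENNReal.Tendsto.mul_const
      (b := ENNReal.ofReal M) h2 (Or.inr ENNReal.ofReal_ne_top)) (Or.inr (by simp))
    simpa using h4
  have hη2 : 0 < η / 2 := ENNReal.half_pos hη.ne'
  obtain ⟨e, hle, he0⟩ := ((h1.eventually_le_const hη2).and self_mem_nhdsWithin).exists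
  have he0' : 0 < ENNReal.ofReal e := ENNReal.ofReal_pos.2 he0
  obtain ⟨δ, hδ1, hδ⟩ : ∃ δ : I, δ < 1 ∧ ∀ t, δ < t → g t ≤ ENNReal.ofReal e := by
    have h5 := hg1.eventually_le_const he0'
    obtain ⟨δ, hδ, h6⟩ := exists_Ioc_subset_of_mem_nhds h5 ⟨0, zero_lt_one⟩
    exact ⟨δ, hδ, fun t ht => h6 ⟨ht, t.2.2⟩⟩
  have hlim := tendsto_iSup_Iic hφ0 hφb (h3 δ hδ1)
  have h7 : Tendsto (fun n => 4 * (ENNReal.ofReal (⨆ t : Iic δ, φ n t) ^ 2 * energy H g)) atTop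
      (𝓝 0) := by
    have h2 : Tendsto (fun n => ENNReal.ofReal (⨆ t : Iic δ, φ n t) ^ 2) atTop (𝓝 0) := by
      have : Continuous fun e : ℝ => ENNReal.ofReal e ^ 2 :=
        (ENNReal.continuous_pow 2).comp ENNReal.continuous_ofReal
      have h := (this.tendsto 0).comp hlim
      simpa [Function.comp_def] using h
    have h4 := ENNReal.Tendsto.const_mul (a := 4) (ENNReal.Tendsto.mul_const
      (b := energy H g) h2 (Or.inr hgE.ne)) (Or.inr (by simp))
    simpa using h4
  filter_upwards [h7.eventually_le_const hη2] with n hn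
  calc energy H (fun t => ‖φ n t‖ₑ * g t)
      ≤ energy H (fun t => ENNReal.ofReal (⨆ t : Iic δ, φ n t) * g t +
          ENNReal.ofReal e * ‖φ n t‖ₑ) := by
        refine energy_mono (.of_forall fun t => ?_)
        rcases le_or_gt t δ with ht | ht
        · refine le_add_right (mul_le_mul' ?_ le_rfl)
          rw [Real.enorm_of_nonneg (hφ0 n t)]
          exact ENNReal.ofReal_le_ofReal (le_iSup_Iic hφb n ht)
        · dsimp only
          rw [mul_comm ‖φ n t‖ₑ]
          exact le_add_left (mul_le_mul' (hδ t ht) le_rfl)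
    _ ≤ 4 * (ENNReal.ofReal (⨆ t : Iic δ, φ n t) ^ 2 * energy H g +
          ENNReal.ofReal e ^ 2 * energy H fun t => ‖φ n t‖ₑ) := by
        refine (energy_add_le (hg.const_mul _)).trans_eq ?_
        rw [energy_const_mul hg, energy_const_mul (hφm n).enorm]
    _ ≤ 4 * (ENNReal.ofReal (⨆ t : Iic δ, φ n t) ^ 2 * energy H g) +
          4 * (ENNReal.ofReal e ^ 2 * ENNReal.ofReal M) := by
        rw [mul_add]
        gcongr
        exact hM n
    _ ≤ η / 2 + η / 2 := add_le_add hn hle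
    _ = η := ENNReal.add_halves η

/-- Kernels that are bounded in `𝔥` and tend to zero in `L¹` tend to zero weakly in `𝔥`. -/
theorem tendsto_inner_toHsp_kernel (hφE : ∀ n, FiniteEnergy H (φ n)) {M : ℝ}
    (hM : ∀ n, ‖toHsp hH (φ n)‖ ≤ M) (h1 : Tendsto (fun n => ∫⁻ t, ‖φ n t‖ₑ) atTop (𝓝 0))
    (h : Hsp H hH) : Tendsto (fun n => inner ℝ h (toHsp hH (φ n))) atTop (𝓝 0) := by
  obtain ⟨C, hC0, hC⟩ := exists_abs_inner_toHsp_ind_le hH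
  have := tendsto_inner_of_total (z := fun n => toHsp hH (φ n)) (z₀ := 0) hM
    (S := range (ind hH)) dense_span_ind ?_ h
  · simpa using this
  · rintro _ ⟨t, rfl⟩
    rw [inner_zero_right]
    have h2 : Tendsto (fun n => ENNReal.ofReal C * ∫⁻ t, ‖φ n t‖ₑ) atTop (𝓝 0) := by
      have := ENNReal.Tendsto.const_mul (a := ENNReal.ofReal C) h1 (Or.inr ENNReal.ofReal_ne_top)
      simpa using this
    have h3 := tendsto_of_tendsto_of_tendsto_of_le_of_le tendsto_const_nhds h2 (fun _ => bot_le)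
      fun n => hC (φ n) (hφE n) t
    rw [tendsto_zero_iff_norm_tendsto_zero]
    have h4 := (ENNReal.tendsto_toReal ENNReal.zero_ne_top).comp h3
    simpa [Function.comp_def, real_inner_comm] using h4

end

/-! ### Existence and weak form of the divergence -/

section

variable {H : ℝ} {hH : H ∈ Ioo (1 / 2 : ℝ) 1} {Ω : Type*} [MeasurableSpace Ω]
  {B : I → Ω → ℝ} {P : Measure Ω}

theorem inner_toLp_toLp {E : Type*} [NormedAddCommGroup E] [InnerProductSpace ℝ E] {F G : Ω → E}
    (hF : MemLp F 2 P) (hG : MemLp G 2 P) :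
    inner ℝ (hF.toLp F) (hG.toLp G) = ∫ ω, inner ℝ (F ω) (G ω) ∂P := by
  rw [L2.inner_def]
  refine integral_congr_ae ?_
  filter_upwards [hF.coeFn_toLp, hG.coeFn_toLp] with ω h1 h2
  rw [h1, h2]

theorem memLp_mul_of_bounded {F : Ω → ℝ} (hF : Measurable F) {C : ℝ} (hC : ∀ ω, |F ω| ≤ C)
    {X : Ω → ℝ} (hX : MemLp X 2 P) : MemLp (fun ω => F ω * X ω) 2 P :=
  MemLp.mul' (p := ∞) (q := 2) (r := 2) hX (memLp_top_of_bound hF.aestronglyMeasurable C (ae_of_all _ hC))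

theorem integral_abs_mul_le_norm_mul_norm {F G : Ω → ℝ} (hF : MemLp F 2 P) (hG : MemLp G 2 P) :
    ∫ ω, |F ω * G ω| ∂P ≤ ‖hF.toLp F‖ * ‖hG.toLp G‖ := by
  refine le_trans (le_of_eq ?_) ((real_inner_le_norm (hF.abs.toLp _) (hG.abs.toLp _)).trans_eq ?_)
  · rw [inner_toLp_toLp]
    refine integral_congr_ae (.of_forall fun ω => ?_)
    simp [abs_mul, mul_comm]
  · have e : ∀ K : Ω → ℝ, eLpNorm |K| 2 P = eLpNorm K 2 P := fun K => eLpNorm_norm K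
    rw [Lp.norm_toLp, Lp.norm_toLp, Lp.norm_toLp, Lp.norm_toLp, e, e]

variable [IsProbabilityMeasure P]

/-- The Riesz representation: a random element that satisfies the estimate of the domain of the
divergence has a divergence. -/
theorem DivBound.exists_hasDivergence (hB : IsFBM H B P) (hgen : GeneratedBy B P)
    {V : Ω → Hsp H hH} (hV : MemLp V 2 P) {c : ℝ} (h : DivBound B (hV.toLp V) c) :
    ∃ F : Ω → ℝ, HasDivergence hH B P V F := by
  set e : sobolev hH B P →ₗ[ℝ] Lp ℝ 2 P := (WithLp.fstₗ 2 ℝ _ _).comp (sobolev hH B P).subtype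
  set f : sobolev hH B P →ₗ[ℝ] ℝ := (innerSL ℝ (hV.toLp V)).toLinearMap.comp
    ((WithLp.sndₗ 2 ℝ _ _).comp (sobolev hH B P).subtype)
  have hdense : DenseRange e := (dense_smooth (hH := hH) hB hgen).mono (by
    rintro _ ⟨w, hw, rfl⟩
    exact ⟨⟨w, smoothPairs_le_sobolev hw⟩, rfl⟩)
  have hf : ∀ w, ‖f w‖ ≤ c * ‖e w‖ := fun w => by
    have := h w w.2
    rwa [real_inner_comm] at this
  set F : Lp ℝ 2 P := (InnerProductSpace.toDual ℝ _).symm (f.extendOfNorm e) with hF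
  have key : ∀ w : sobolev hH B P, inner ℝ F (w : PairSpace hH P).fst =
      inner ℝ (hV.toLp V) (w : PairSpace hH P).snd := fun w => by
    rw [hF, InnerProductSpace.toDual_symm_apply]
    exact LinearMap.extendOfNorm_eq hdense ⟨c, hf⟩ w
  refine ⟨F, hV, Lp.memLp F, fun G DG hG => ?_⟩
  have := key ⟨_, hG.mem_sobolev hB.measurable⟩
  have h1 : inner ℝ F (hG.1.toLp G) = ∫ ω, G ω * F ω ∂P := by
    rw [L2.inner_def]
    refine integral_congr_ae (hG.1.coeFn_toLp.mono fun ω h => ?_)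
    simp [h]
  have h2 : inner ℝ (hV.toLp V) (hG.2.1.toLp DG) = ∫ ω, inner ℝ (DG ω) (V ω) ∂P := by
    rw [real_inner_comm, inner_toLp_toLp]
  rw [← h1, ← h2]
  exact this

/-- The duality between `D` and `δ`, as an identity of scalar products of `L²` spaces. -/
theorem HasDivergence.inner_eq (hB : IsFBM H B P) {V : Ω → Hsp H hH} {F : Ω → ℝ}
    (h : HasDivergence hH B P V F) {w : PairSpace hH P} (hw : w ∈ smoothPairs hH B P) :
    inner ℝ w.fst (h.2.1.toLp F) = inner ℝ w.snd (h.1.toLp V) := by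
  obtain ⟨G, DG, hG, h1, h2⟩ := hw
  have := h.2.2 G DG (hG.hasMalliavinDeriv hB.measurable)
  rw [L2.inner_def, L2.inner_def]
  refine (integral_congr_ae ?_).trans (this.trans (integral_congr_ae ?_))
  · filter_upwards [h1, h.2.1.coeFn_toLp] with ω e1 e2
    rw [e1, e2]
    simp [mul_comm]
  · filter_upwards [h2, h.1.coeFn_toLp] with ω e1 e2
    rw [e1, e2]

/-- `δ(F h) = F X(h) - ⟨DF, h⟩` for smooth `F` and `h ∈ 𝔥`, in the weak form. -/
theorem smooth_divergence (hB : IsFBM H B P) {F : Ω → ℝ} {DF : Ω → Hsp H hH}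
    (hF : IsSmoothCyl hH B F DF) (h : Hsp H hH) :
    ∃ hR : MemLp (fun ω => F ω * wiener hH hB h ω - inner ℝ (DF ω) h) 2 P,
      ∀ w ∈ smoothPairs hH B P, inner ℝ w.fst (hR.toLp _) =
        inner ℝ w.snd (smulVec hH P ((hF.memLp (P := P) hB.measurable).1.toLp F) h) := by
  obtain ⟨hFm, hDFm, C, hC, hC'⟩ := hF.exists_bound hB.measurable
  have hFL := (hF.memLp (P := P) hB.measurable).1
  have hDFL := (hF.memLp (P := P) hB.measurable).2
  have hX : ∀ h, MemLp (fun ω => F ω * wiener hH hB h ω) 2 P := fun h =>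
    memLp_mul_of_bounded hFm hC (Lp.memLp _)
  have hI : ∀ h, MemLp (fun ω => inner ℝ (DF ω) h) 2 P := fun h => hDFL.inner_const h
  refine ⟨(hX h).sub (hI h), ?_⟩
  rintro w ⟨G, DG, hG, h1, h2⟩
  obtain ⟨hGm, -, D, hD, -⟩ := hG.exists_bound hB.measurable
  have hGL := (hG.memLp (P := P) hB.measurable).1
  have hDGL := (hG.memLp (P := P) hB.measurable).2
  have hGF : MemLp (fun ω => G ω * F ω) 2 P := memLp_mul_of_bounded hGm hD hFL
  set Λ₁ : Hsp H hH →L[ℝ] ℝ := (innerSL ℝ (hGF.toLp _)).comp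
    (wiener hH hB).toContinuousLinearMap - (innerSL ℝ (hDFL.toLp _)).comp
      (smulVec hH P (hGL.toLp _)) with hΛ₁
  set Λ₂ : Hsp H hH →L[ℝ] ℝ := (innerSL ℝ (hDGL.toLp _)).comp (smulVec hH P (hFL.toLp _)) with hΛ₂
  have e1 : ∀ h, Λ₁ h = ∫ ω, G ω * (F ω * wiener hH hB h ω - inner ℝ (DF ω) h) ∂P := fun h => by
    have a1 : Λ₁ h = inner ℝ (hGF.toLp _) (wiener hH hB h) -
        inner ℝ (hDFL.toLp _) (smulVec hH P (hGL.toLp _) h) := rfl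
    have i1 : Integrable (fun ω => G ω * (F ω * wiener hH hB h ω)) P :=
      hGL.integrable_mul (hX h)
    have i2 : Integrable (fun ω => G ω * inner ℝ (DF ω) h) P := hGL.integrable_mul (hI h)
    rw [a1, inner_smulVec, L2.inner_def]
    simp_rw [mul_sub]
    rw [integral_sub i1 i2]
    congr 1
    · refine integral_congr_ae (hGF.coeFn_toLp.mono fun ω e => ?_)
      simp only [e, real_inner_eq_re_inner]
      simp
      ring
    · refine integral_congr_ae ?_
      filter_upwards [hGL.coeFn_toLp, hDFL.coeFn_toLp] with ω e e'
      rw [e, e']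
  have e2 : ∀ h, Λ₂ h = ∫ ω, F ω * inner ℝ (DG ω) h ∂P := fun h => by
    have a1 : Λ₂ h = inner ℝ (hDGL.toLp _) (smulVec hH P (hFL.toLp _) h) := rfl
    rw [a1, inner_smulVec]
    refine integral_congr_ae ?_
    filter_upwards [hFL.coeFn_toLp, hDGL.coeFn_toLp] with ω e e'
    rw [e, e']
  have e3 : Λ₁ = Λ₂ := by
    refine ContinuousLinearMap.ext_on dense_span_ind ?_
    rintro _ ⟨t, rfl⟩
    obtain ⟨-, h3, -⟩ := smoothDiv_spec hB (J := Unit) (fun _ => t) (F := fun _ => F)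
      (DF := fun _ => DF) fun _ => hF
    have h4 := h3 G DG hG
    simp only [smoothDiv, Finset.univ_unique, Finset.sum_const, Finset.card_singleton,
      one_smul] at h4
    rw [e1, e2, ← h4, wiener_ind]
    refine integral_congr_ae ((hB.memLp t).coeFn_toLp.mono fun ω e => ?_)
    simp only [e]
  have e4 : inner ℝ w.fst (((hX h).sub (hI h)).toLp _) =
      ∫ ω, G ω * (F ω * wiener hH hB h ω - inner ℝ (DF ω) h) ∂P := by
    rw [L2.inner_def]
    refine integral_congr_ae ?_
    filter_upwards [h1, ((hX h).sub (hI h)).coeFn_toLp] with ω e e'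
    rw [e, e', real_inner_eq_re_inner]
    simp [mul_comm]
  have e5 : inner ℝ w.snd (smulVec hH P (hFL.toLp F) h) = ∫ ω, F ω * inner ℝ (DG ω) h ∂P := by
    rw [inner_smulVec]
    refine integral_congr_ae ?_
    filter_upwards [hFL.coeFn_toLp, h2] with ω e e'
    rw [e, e']
  exact e4.trans ((e1 h).symm.trans ((congrArg (fun Λ => Λ h) e3).trans ((e2 h).trans e5.symm)))

end

/-! ### Skorohod integrals against concentrating kernels -/

section

variable {H : ℝ} {hH : H ∈ Ioo (1 / 2 : ℝ) 1} {Ω : Type*} [MeasurableSpace Ω]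
  {B : I → Ω → ℝ} {P : Measure Ω} [IsProbabilityMeasure P]

/-- The estimate of the divergence for the product of a process and a bounded kernel. -/
theorem divBound_kernel_mul (hB : IsFBM H B P) (hgen : GeneratedBy B P) {ψ : I → ℝ}
    (hψ : AEMeasurable ψ) {C : ℝ} (hC : ∀ t, |ψ t| ≤ C) {v : I → Ω → ℝ} {w : I → PairSpace hH P}
    (hv : AEStronglyMeasurable (Function.uncurry v) ((volume : Measure I).prod P))
    (hw : AEStronglyMeasurable w volume) (hS : ∀ t, w t ∈ sobolev hH B P)
    (hvw : ∀ t, v t =ᵐ[P] (w t).fst) (hfin : energy H (fun t => ‖w t‖ₑ) < ∞) :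
    (∀ᵐ ω ∂P, FiniteEnergy H fun t => ψ t * v t ω) ∧
    ∃ hV : MemLp (fun ω => toHsp hH fun t => ψ t * v t ω) 2 P,
      DivBound B (hV.toLp _) √(energy H fun t => ‖ψ t‖ₑ * ‖w t‖ₑ).toReal := by
  have he : (fun t => ‖ψ t‖ₑ * ‖w t‖ₑ) = fun t => ‖ψ t • w t‖ₑ :=
    funext fun t => (enorm_smul _ _).symm
  have hfin' : energy H (fun t => ‖ψ t • w t‖ₑ) < ∞ := by
    rw [← he]
    refine (energy_mono (g := fun t => ENNReal.ofReal C * ‖w t‖ₑ)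
      (.of_forall fun t => mul_le_mul' ?_ le_rfl)).trans_lt ?_
    · rw [← ofReal_norm]
      exact ENNReal.ofReal_le_ofReal (hC t)
    · rw [energy_const_mul hw.enorm]
      exact ENNReal.mul_lt_top (by finiteness) hfin
  rw [he]
  refine divBound_path hB hgen (v := fun t ω => ψ t * v t ω) (w := fun t => ψ t • w t) ?_
    (hψ.aestronglyMeasurable.smul hw) (fun t => Submodule.smul_mem _ _ (hS t))
    (.of_forall fun t => ?_) hfin'
  · exact hψ.aestronglyMeasurable.comp_fst.mul hv
  · exact ((hvw t).const_smul (ψ t)).trans (Lp.coeFn_smul (ψ t) (w t).fst).symm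

theorem divBound_smulVec (hB : IsFBM H B P) {w : PairSpace hH P} (hw : w ∈ sobolev hH B P)
    (h : Hsp H hH) : DivBound B (smulVec hH P w.fst h) (‖w‖ * ‖h‖) := by
  have := divBound_sum hB (J := Unit) (fun _ => hw) fun _ => h
  simp only [Finset.univ_unique, Finset.sum_const, Finset.card_singleton, one_smul,
    real_inner_self_eq_norm_sq] at this
  rwa [← mul_pow, Real.sqrt_sq (by positivity)] at this

/-- The Skorohod integral of `φ u` is close to `G X(φ) - ⟨DG, φ⟩`, when `φ` sits near the right
end point and `G` is a smooth approximation of `u_1`. -/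
theorem norm_skorohod_sub_le (hB : IsFBM H B P) (hgen : GeneratedBy B P) {φ : I → ℝ}
    (hφ : AEMeasurable φ) {C : ℝ} (hC : ∀ t, |φ t| ≤ C) {u : I → Ω → ℝ} {w : I → PairSpace hH P}
    (hu : AEStronglyMeasurable (Function.uncurry u) ((volume : Measure I).prod P))
    (hw : AEStronglyMeasurable w volume) (hS : ∀ t, w t ∈ sobolev hH B P)
    (huw : ∀ t, u t =ᵐ[P] (w t).fst) (hfin : energy H (fun t => ‖w t - w 1‖ₑ) < ∞)
    {F : Ω → ℝ} (hF : HasSkorohodIntegral hH B P (fun t ω => φ t * u t ω) F)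
    {G : Ω → ℝ} {DG : Ω → Hsp H hH} (hG : IsSmoothCyl hH B G DG) :
    ∃ hR : MemLp (fun ω => G ω * wiener hH hB (toHsp hH φ) ω - inner ℝ (DG ω) (toHsp hH φ)) 2 P,
      ‖hF.2.2.1.toLp F - hR.toLp _‖ ≤ √(energy H fun t => ‖φ t‖ₑ * ‖w t - w 1‖ₑ).toReal +
        ‖w 1 - toPair (hG.memLp (P := P) hB.measurable).1 (hG.memLp hB.measurable).2‖ *
          ‖toHsp hH φ‖ := by
  obtain ⟨hR, hRe⟩ := smooth_divergence hB hG (toHsp hH φ)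
  refine ⟨hR, ?_⟩
  have hu1 : AEStronglyMeasurable (u 1) P :=
    (Lp.aestronglyMeasurable (w 1).fst).congr (huw 1).symm
  obtain ⟨hDfin, hD, hDb⟩ := divBound_kernel_mul hB hgen hφ hC (v := fun t ω => u t ω - u 1 ω)
    (w := fun t => w t - w 1) (hu.sub hu1.comp_snd) (hw.sub aestronglyMeasurable_const)
    (fun t => Submodule.sub_mem _ (hS t) (hS 1))
    (fun t => ((huw t).sub (huw 1)).trans (Lp.coeFn_sub (w t).fst (w 1).fst).symm) hfin
  have hφE : FiniteEnergy H φ := finiteEnergy_of_bounded hH hφ.aestronglyMeasurable (.of_forall hC)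
  have hdec : hF.2.1.toLp _ = hD.toLp _ + smulVec hH P (w 1).fst (toHsp hH φ) := by
    refine Lp.ext ?_
    filter_upwards [hF.2.1.coeFn_toLp, hD.coeFn_toLp,
      Lp.coeFn_add (hD.toLp _) (smulVec hH P (w 1).fst (toHsp hH φ)),
      coeFn_smulVec (w 1).fst (toHsp hH φ), hDfin, huw 1] with ω h1 h2 h3 h4 h5 h6
    rw [h3, Pi.add_apply, h1, h2, h4, ← h6, ← hφE.toHsp_const_mul,
      ← h5.toHsp_add (hφE.const_mul _)]
    congr 1
    funext t
    ring
  set g := toPair (hG.memLp (P := P) hB.measurable).1 (hG.memLp hB.measurable).2 with hg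
  have hgS : g ∈ sobolev hH B P :=
    smoothPairs_le_sobolev (toPair_mem_smoothPairs _ _ hG)
  have hb := hDb.add (divBound_smulVec hB (Submodule.sub_mem _ (hS 1) hgS) (toHsp hH φ))
  refine norm_le_of_inner_smooth_le (hH := hH) hB hgen fun z hz => ?_
  have e : inner ℝ z.fst (hF.2.2.1.toLp F - hR.toLp _) =
      inner ℝ z.snd (hD.toLp _ + smulVec hH P (w 1 - g).fst (toHsp hH φ)) := by
    rw [inner_sub_right, hF.2.inner_eq hB hz, hRe z hz, ← inner_sub_right, hdec]
    congr 1
    have : (w 1 - g).fst = (w 1).fst - (hG.memLp (P := P) hB.measurable).1.toLp G := rfl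
    rw [this, map_sub, sub_apply, add_sub_assoc]
  rw [e]
  exact hb z (smoothPairs_le_sobolev hz)

theorem integral_abs_le_norm {F : Ω → ℝ} (hF : MemLp F 2 P) : ∫ ω, |F ω| ∂P ≤ ‖hF.toLp F‖ := by
  have h1 : eLpNorm F 1 P ≤ eLpNorm F 2 P :=
    eLpNorm_le_eLpNorm_of_exponent_le (by norm_num) hF.1
  rw [Lp.norm_toLp]
  refine le_trans (le_of_eq ?_) (ENNReal.toReal_mono hF.2.ne h1)
  rw [eLpNorm_one_eq_lintegral_enorm]
  exact integral_norm_eq_lintegral_enorm hF.1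

/-- Against a weakly null sequence of `𝔥`, the derivative of a smooth random variable tends to
zero in `L¹`. -/
theorem tendsto_integral_abs_inner {DG : Ω → Hsp H hH} (hDG : AEStronglyMeasurable DG P) {C : ℝ}
    (hC : ∀ ω, ‖DG ω‖ ≤ C) {k : ℕ → Hsp H hH} {M : ℝ} (hM : ∀ n, ‖k n‖ ≤ M)
    (hk : ∀ h, Tendsto (fun n => inner ℝ h (k n)) atTop (𝓝 0)) :
    Tendsto (fun n => ∫ ω, |inner ℝ (DG ω) (k n)| ∂P) atTop (𝓝 0) := by
  have := tendsto_integral_of_dominated_convergence (μ := P)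
    (F := fun n ω => |inner ℝ (DG ω) (k n)|) (f := fun _ => 0) (fun _ => C * M)
    (fun n => continuous_abs.comp_aestronglyMeasurable (hDG.inner aestronglyMeasurable_const))
    (integrable_const _)
    (fun n => .of_forall fun ω => ?_) (.of_forall fun ω => ?_)
  · simpa using this
  · rw [Real.norm_eq_abs, abs_abs]
    exact (abs_real_inner_le_norm _ _).trans
      (mul_le_mul (hC ω) (hM n) (norm_nonneg _) ((norm_nonneg _).trans (hC ω)))
  · simpa using (hk (DG ω)).abs

/-- The Skorohod integrals `δ(φ_n u)` behave like `u_1 X(φ_n)`, up to an error that tends to zero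
in `L¹`. -/
theorem tendsto_integral_abs_skorohod_sub (hB : IsFBM H B P) (hgen : GeneratedBy B P)
    {φ : ℕ → I → ℝ} (hφ : ∀ n, AEMeasurable (φ n)) (hC : ∀ n, ∃ C, ∀ t, |φ n t| ≤ C) {M : ℝ}
    (hM : ∀ n, ‖toHsp hH (φ n)‖ ≤ M)
    (hweak : ∀ h, Tendsto (fun n => inner ℝ h (toHsp hH (φ n))) atTop (𝓝 0))
    {u : I → Ω → ℝ} {w : I → PairSpace hH P}
    (hu : AEStronglyMeasurable (Function.uncurry u) ((volume : Measure I).prod P))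
    (hw : AEStronglyMeasurable w volume) (hS : ∀ t, w t ∈ sobolev hH B P)
    (huw : ∀ t, u t =ᵐ[P] (w t).fst) (hfin : energy H (fun t => ‖w t - w 1‖ₑ) < ∞)
    (hlim : Tendsto (fun n => energy H fun t => ‖φ n t‖ₑ * ‖w t - w 1‖ₑ) atTop (𝓝 0))
    {F : ℕ → Ω → ℝ}
    (hF : ∀ n, HasSkorohodIntegral hH B P (fun t ω => φ n t * u t ω) (F n)) :
    Tendsto (fun n => ∫ ω, |F n ω - u 1 ω * wiener hH hB (toHsp hH (φ n)) ω| ∂P) atTop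
      (𝓝 0) := by
  have hM0 : 0 ≤ M := (norm_nonneg _).trans (hM 0)
  have hu1 : MemLp (u 1) 2 P := (Lp.memLp (w 1).fst).ae_eq (huw 1).symm
  have hlim' : Tendsto (fun n => √(energy H fun t => ‖φ n t‖ₑ * ‖w t - w 1‖ₑ).toReal) atTop
      (𝓝 0) := by
    have := ((ENNReal.tendsto_toReal ENNReal.zero_ne_top).comp hlim).sqrt
    simpa using this
  rw [Metric.tendsto_atTop']
  intro ε hε
  -- a smooth `G` near `u_1`; it enters twice below, each time with a factor `‖φ_n‖ ≤ M`
  obtain ⟨g, ⟨G, DG, hG, hg1, hg2⟩, hgε⟩ : ∃ g ∈ smoothPairs hH B P,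
      ‖w 1 - g‖ < ε / (4 * (M + 1)) := by
    have := Metric.mem_closure_iff.1 (hS 1) (ε / (4 * (M + 1))) (by positivity)
    obtain ⟨g, hg, hd⟩ := this
    exact ⟨g, hg, by rwa [dist_eq_norm] at hd⟩
  have hgp : g = toPair (hG.memLp (P := P) hB.measurable).1 (hG.memLp hB.measurable).2 := by
    refine WithLp.ofLp_injective 2 (Prod.ext ?_ ?_)
    · exact Lp.ext (hg1.trans (hG.memLp (P := P) hB.measurable).1.coeFn_toLp.symm)
    · exact Lp.ext (hg2.trans (hG.memLp (P := P) hB.measurable).2.coeFn_toLp.symm)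
  obtain ⟨hGm, hDGm, C, hGC, hDGC⟩ := hG.exists_bound hB.measurable
  have hGL := (hG.memLp (P := P) hB.measurable).1
  have hDGL := (hG.memLp (P := P) hB.measurable).2
  have h3 := tendsto_integral_abs_inner (P := P) hDGm.aestronglyMeasurable hDGC hM hweak
  have h4 := hlim'.add h3
  rw [add_zero] at h4
  obtain ⟨N, hN⟩ := eventually_atTop.1 (h4.eventually_lt_const (half_pos hε))
  refine ⟨N, fun n hn => ?_⟩
  obtain ⟨Cn, hCn⟩ := hC n
  obtain ⟨hR, hRb⟩ := norm_skorohod_sub_le hB hgen (hφ n) hCn hu hw hS huw hfin (hF n) hG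
  have hX : MemLp (wiener hH hB (toHsp hH (φ n))) 2 P := Lp.memLp _
  have hFn := (hF n).2.2.1
  have hXn : ‖hX.toLp _‖ ≤ M := by
    rw [Lp.toLp_coeFn, LinearIsometry.norm_map]
    exact hM n
  have hsub : ‖(hu1.sub hGL).toLp _‖ ≤ ‖w 1 - g‖ := by
    have e : (hu1.sub hGL).toLp _ = (w 1 - g).fst := by
      refine Lp.ext ((hu1.sub hGL).coeFn_toLp.trans (EventuallyEq.trans ?_
        (Lp.coeFn_sub (w 1).fst g.fst).symm))
      exact (huw 1).sub hg1.symm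
    rw [e]
    refine (abs_le_of_sq_le_sq' ?_ (norm_nonneg _)).2
    rw [WithLp.prod_norm_sq_eq_of_L2 (w 1 - g)]
    linarith [sq_nonneg ‖(w 1 - g).snd‖]
  have i1 : Integrable (fun ω => |F n ω - (G ω * wiener hH hB (toHsp hH (φ n)) ω -
      inner ℝ (DG ω) (toHsp hH (φ n)))|) P := ((hFn.sub hR).integrable (by norm_num)).abs
  have i2 : Integrable (fun ω => |(u 1 ω - G ω) * wiener hH hB (toHsp hH (φ n)) ω|) P :=
    ((hu1.sub hGL).integrable_mul hX).abs
  have i3 : Integrable (fun ω => |inner ℝ (DG ω) (toHsp hH (φ n))|) P :=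
    ((hDGL.inner_const _).integrable (by norm_num)).abs
  have b1 : ∫ ω, |F n ω - (G ω * wiener hH hB (toHsp hH (φ n)) ω -
      inner ℝ (DG ω) (toHsp hH (φ n)))| ∂P ≤
      √(energy H fun t => ‖φ n t‖ₑ * ‖w t - w 1‖ₑ).toReal + ‖w 1 - g‖ * M := by
    refine (integral_abs_le_norm (hFn.sub hR)).trans ?_
    rw [MemLp.toLp_sub, hgp]
    exact hRb.trans (add_le_add le_rfl (mul_le_mul_of_nonneg_left (hM n) (norm_nonneg _)))
  have b2 : ∫ ω, |(u 1 ω - G ω) * wiener hH hB (toHsp hH (φ n)) ω| ∂P ≤ ‖w 1 - g‖ * M :=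
    (integral_abs_mul_le_norm_mul_norm (hu1.sub hGL) hX).trans
      (mul_le_mul hsub hXn (norm_nonneg _) (norm_nonneg _))
  -- `δ(φ_n u) - u_1 X(φ_n) = [δ(φ_n u) - δ(φ_n G)] - (u_1 - G) X(φ_n) - ⟨DG, φ_n⟩`
  have b : ∫ ω, |F n ω - u 1 ω * wiener hH hB (toHsp hH (φ n)) ω| ∂P ≤
      (∫ ω, |F n ω - (G ω * wiener hH hB (toHsp hH (φ n)) ω -
        inner ℝ (DG ω) (toHsp hH (φ n)))| ∂P +
      ∫ ω, |(u 1 ω - G ω) * wiener hH hB (toHsp hH (φ n)) ω| ∂P) +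
      ∫ ω, |inner ℝ (DG ω) (toHsp hH (φ n))| ∂P := by
    have i12 := integral_add (i1.add i2) i3
    simp only [Pi.add_apply] at i12
    rw [← integral_add i1 i2, ← i12]
    refine integral_mono_of_nonneg (.of_forall fun ω => abs_nonneg _) ((i1.add i2).add i3)
      (.of_forall fun ω => ?_)
    dsimp only
    have := abs_add_three (F n ω - (G ω * wiener hH hB (toHsp hH (φ n)) ω -
      inner ℝ (DG ω) (toHsp hH (φ n)))) (-((u 1 ω - G ω) * wiener hH hB (toHsp hH (φ n)) ω))
      (-inner ℝ (DG ω) (toHsp hH (φ n)))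
    rw [abs_neg, abs_neg] at this
    refine le_trans (le_of_eq (congrArg abs ?_)) this
    ring
  have hε4 : ‖w 1 - g‖ * M ≤ ε / 4 := by
    have h5 : ‖w 1 - g‖ * (M + 1) ≤ ε / (4 * (M + 1)) * (M + 1) :=
      mul_le_mul_of_nonneg_right hgε.le (by positivity)
    have h6 : ε / (4 * (M + 1)) * (M + 1) = ε / 4 := by field_simp
    nlinarith [norm_nonneg (w 1 - g)]
  rw [Real.dist_0_eq_abs, abs_of_nonneg (integral_nonneg fun ω => abs_nonneg _)]
  have := hN n hn.le
  linarith

end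

/-! ### Gaussian mixtures -/

section

variable {Ω : Type*} [MeasurableSpace Ω] {P : Measure Ω}

theorem norm_exp_sub_exp_le (a b : ℝ) :
    ‖Complex.exp (Complex.I * (a : ℂ)) - Complex.exp (Complex.I * (b : ℂ))‖ ≤ |a - b| := by
  have e : Complex.exp (Complex.I * (a : ℂ)) - Complex.exp (Complex.I * (b : ℂ)) =
      Complex.exp (Complex.I * (b : ℂ)) * (Complex.exp (Complex.I * ((a - b : ℝ) : ℂ)) - 1) := by
    rw [mul_sub, ← Complex.exp_add, mul_one]
    congr 2
    push_cast
    ring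
  rw [e, norm_mul, mul_comm Complex.I (b : ℂ), Complex.norm_exp_ofReal_mul_I, one_mul]
  exact Real.norm_exp_I_mul_ofReal_sub_one_le

theorem integrable_mul_exp [IsFiniteMeasure P] {Y : Ω → ℝ} (hY : AEStronglyMeasurable Y P) {C : ℝ}
    (hC : ∀ ω, |Y ω| ≤ C) {F : Ω → ℝ} (hF : AEStronglyMeasurable F P) :
    Integrable (fun ω => (Y ω : ℂ) * Complex.exp (Complex.I * (F ω : ℂ))) P := by
  refine Integrable.of_bound (C := C) ?_ (.of_forall fun ω => ?_)
  · have h1 := Complex.continuous_ofReal.comp_aestronglyMeasurable hY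
    have h2 : Continuous fun x : ℝ => Complex.exp (Complex.I * (x : ℂ)) := by fun_prop
    exact h1.mul (h2.comp_aestronglyMeasurable hF)
  · rw [norm_mul, mul_comm Complex.I, Complex.norm_exp_ofReal_mul_I, mul_one, Complex.norm_real]
    exact hC ω

theorem norm_integral_exp_sub_le [IsFiniteMeasure P] {Y : Ω → ℝ} (hY : AEStronglyMeasurable Y P)
    {C : ℝ} (hC : ∀ ω, |Y ω| ≤ C) {F G : Ω → ℝ} (hF : AEStronglyMeasurable F P)
    (hG : AEStronglyMeasurable G P) (hFG : Integrable (fun ω => F ω - G ω) P) :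
    ‖(∫ ω, (Y ω : ℂ) * Complex.exp (Complex.I * (F ω : ℂ)) ∂P) -
      ∫ ω, (Y ω : ℂ) * Complex.exp (Complex.I * (G ω : ℂ)) ∂P‖ ≤ C * ∫ ω, |F ω - G ω| ∂P := by
  rw [← integral_sub (integrable_mul_exp hY hC hF) (integrable_mul_exp hY hC hG),
    ← integral_const_mul]
  refine norm_integral_le_of_norm_le (hFG.abs.const_mul C) (.of_forall fun ω => ?_)
  rw [← mul_sub, norm_mul, Complex.norm_real]
  exact mul_le_mul (hC ω) (norm_exp_sub_exp_le _ _) (norm_nonneg _)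
    ((abs_nonneg _).trans (hC ω))

theorem apply_simpleFunc_eq_sum_indicator {E : Type*} [AddCommMonoid E] (s : SimpleFunc Ω ℝ)
    (f : ℝ → E) (ω : Ω) :
    f (s ω) = ∑ c ∈ s.range, (s ⁻¹' {c}).indicator (fun _ => f c) ω := by
  rw [Finset.sum_eq_single_of_mem (s ω) (s.mem_range_self ω) ?_]
  · exact (indicator_of_mem (s := s ⁻¹' {s ω}) rfl fun _ => f (s ω)).symm
  · intro c _ hc
    exact indicator_of_notMem (s := s ⁻¹' {c}) (fun h : s ω = c => hc h.symm) (fun _ => f c)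

theorem exists_simpleFunc_tendsto_L2 {U : Ω → ℝ} (hU : MemLp U 2 P) :
    ∃ s : ℕ → SimpleFunc Ω ℝ, (∀ᵐ ω ∂P, Tendsto (fun n => s n ω) atTop (𝓝 (U ω))) ∧
      ∃ hs : ∀ n, MemLp (fun ω => s n ω - U ω) 2 P,
        Tendsto (fun n => ‖(hs n).toLp _‖) atTop (𝓝 0) := by
  obtain ⟨s, -, hlim, hdom⟩ := exists_simpleFunc_tendsto hU.1 (S := univ) (mem_univ _)
    fun _ => mem_univ _
  have hsL : ∀ n, MemLp (fun ω => s n ω - U ω) 2 P := fun n => by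
    refine MemLp.sub (hU.of_enorm_le_mul (c := 2) (s n).aestronglyMeasurable (hdom n)) hU
  refine ⟨s, hlim, hsL, ?_⟩
  have h2 : ∀ n, ‖(hsL n).toLp _‖ ^ 2 = ∫ ω, (s n ω - U ω) ^ 2 ∂P := fun n => by
    rw [norm_sq_toLp]
    simp only [Real.norm_eq_abs, sq_abs]
  have h3 : Tendsto (fun n => ‖(hsL n).toLp _‖ ^ 2) atTop (𝓝 0) := by
    simp_rw [h2]
    have := tendsto_integral_of_dominated_convergence (μ := P)
      (F := fun n ω => (s n ω - U ω) ^ 2) (f := fun _ => 0) (fun ω => 9 * U ω ^ 2)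
      (fun n => (hsL n).integrable_sq.1) (hU.integrable_sq.const_mul 9)
      (fun n => (hdom n).mono fun ω h => ?_) (hlim.mono fun ω h => ?_)
    · simpa using this
    · have h4 : |s n ω| ≤ 2 * |U ω| := by
        have := ENNReal.toReal_mono (by finiteness) h
        simpa using this
      rw [Real.norm_eq_abs, abs_of_nonneg (sq_nonneg _)]
      have h5 : |s n ω - U ω| ≤ 3 * |U ω| := (abs_sub _ _).trans (by linarith)
      have h6 := pow_le_pow_left₀ (abs_nonneg _) h5 2
      rw [sq_abs, mul_pow, sq_abs] at h6
      linarith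
    · simpa using (h.sub_const (U ω)).pow 2
  simpa using h3.sqrt

variable {H : ℝ} {hH : H ∈ Ioo (1 / 2 : ℝ) 1} {B : I → Ω → ℝ} [IsProbabilityMeasure P]

/-- The stable convergence of `c X(k_n)` for a constant `c`. -/
theorem tendsto_integral_mul_exp_const (hB : IsFBM H B P) (hgen : GeneratedBy B P)
    {k : ℕ → Hsp H hH} {L : ℝ} (hk : ∀ h, Tendsto (fun n => inner ℝ h (k n)) atTop (𝓝 0))
    (hL : Tendsto (fun n => ‖k n‖ ^ 2) atTop (𝓝 L)) {Y : Ω → ℝ} (hY : AEStronglyMeasurable Y P)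
    {C : ℝ} (hC : ∀ ω, |Y ω| ≤ C) (c : ℝ) :
    Tendsto (fun n => ∫ ω, (Y ω : ℂ) *
      Complex.exp (Complex.I * ((c * wiener hH hB (k n) ω : ℝ) : ℂ)) ∂P) atTop
      (𝓝 (∫ ω, (Y ω : ℂ) * (Real.exp (-(c ^ 2 * L / 2)) : ℂ) ∂P)) := by
  have hYL : MemLp Y 2 P := (memLp_top_of_bound hY C (.of_forall hC)).mono_exponent le_top
  obtain ⟨h1, h2⟩ := tendsto_inner_wcos_wsin hB hgen (k := fun n => c • k n) (L := c ^ 2 * L)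
    (fun h => by
      have := (hk h).const_mul c
      rw [mul_zero] at this
      exact this.congr fun n => (real_inner_smul_right _ _ _).symm)
    ((hL.const_mul (c ^ 2)).congr fun n => by rw [norm_smul, mul_pow, Real.norm_eq_abs, sq_abs])
    (hYL.toLp Y)
  have h3 := ((Complex.continuous_ofReal.tendsto _).comp h1).add
    (((Complex.continuous_ofReal.tendsto _).comp h2).mul_const Complex.I)
  have e : ∀ n, ((inner ℝ (hYL.toLp Y) (wcos hB (c • k n)) : ℝ) : ℂ) +
      ((inner ℝ (hYL.toLp Y) (wsin hB (c • k n)) : ℝ) : ℂ) * Complex.I =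
      ∫ ω, (Y ω : ℂ) * Complex.exp (Complex.I * ((c * wiener hH hB (k n) ω : ℝ) : ℂ)) ∂P := by
    intro n
    have hi : ∀ V : Lp ℝ 2 P, Integrable (fun ω => inner ℝ (hYL.toLp Y ω) (V ω)) P :=
      fun V => L2.integrable_inner _ _
    rw [L2.inner_def, L2.inner_def, ← integral_complex_ofReal, ← integral_complex_ofReal, ← integral_mul_const,
      ← integral_add (hi _).ofReal ((hi _).ofReal.mul_const _)]
    refine integral_congr_ae ?_
    filter_upwards [hYL.coeFn_toLp, coeFn_wcos hB (c • k n), coeFn_wsin hB (c • k n),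
      Lp.coeFn_smul c (wiener hH hB (k n))] with ω e1 e2 e3 e4
    have e5 : wiener hH hB (c • k n) ω = c * wiener hH hB (k n) ω := by
      rw [map_smul, e4, Pi.smul_apply, smul_eq_mul]
    rw [e1, e2, e3, e5, mul_comm Complex.I, Complex.exp_mul_I, ← Complex.ofReal_cos,
      ← Complex.ofReal_sin]
    simp only [RCLike.inner_apply, conj_trivial]
    push_cast
    ring
  have e' : ((Real.exp (-(c ^ 2 * L / 2)) * ∫ ω, hYL.toLp Y ω ∂P : ℝ) : ℂ) + ((0 : ℝ) : ℂ) * Complex.I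
      = ∫ ω, (Y ω : ℂ) * (Real.exp (-(c ^ 2 * L / 2)) : ℂ) ∂P := by
    rw [integral_mul_const, integral_complex_ofReal, integral_congr_ae hYL.coeFn_toLp]
    push_cast
    ring
  rw [← e']
  exact h3.congr e

/-- The limit of the characteristic functions, with a random factor that takes finitely many
values. -/
theorem tendsto_integral_mul_exp_simple (hB : IsFBM H B P) (hgen : GeneratedBy B P)
    {k : ℕ → Hsp H hH} {L : ℝ} (hk : ∀ h, Tendsto (fun n => inner ℝ h (k n)) atTop (𝓝 0))
    (hL : Tendsto (fun n => ‖k n‖ ^ 2) atTop (𝓝 L)) {Y : Ω → ℝ} (hY : AEStronglyMeasurable Y P)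
    {C : ℝ} (hC : ∀ ω, |Y ω| ≤ C) (s : SimpleFunc Ω ℝ) :
    Tendsto (fun n => ∫ ω, (Y ω : ℂ) *
      Complex.exp (Complex.I * ((s ω * wiener hH hB (k n) ω : ℝ) : ℂ)) ∂P) atTop
      (𝓝 (∫ ω, (Y ω : ℂ) * (Real.exp (-(s ω ^ 2 * L / 2)) : ℂ) ∂P)) := by
  set Z : ℝ → Ω → ℝ := fun c => (s ⁻¹' {c}).indicator Y with hZ
  have hZm : ∀ c, AEStronglyMeasurable (Z c) P := fun c => hY.indicator (s.measurableSet_fiber c)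
  have hZC : ∀ c ω, |Z c ω| ≤ C := fun c ω => by
    by_cases h : ω ∈ s ⁻¹' {c}
    · rw [hZ]
      dsimp only
      rw [indicator_of_mem h]
      exact hC ω
    · rw [hZ]
      dsimp only
      rw [indicator_of_notMem h, abs_zero]
      exact (abs_nonneg _).trans (hC ω)
  have key : ∀ (f : ℝ → Ω → ℂ) ω, (Y ω : ℂ) * f (s ω) ω = ∑ c ∈ s.range, (Z c ω : ℂ) * f c ω := by
    intro f ω
    rw [apply_simpleFunc_eq_sum_indicator s (fun c => (Y ω : ℂ) * f c ω)]
    refine Finset.sum_congr rfl fun c _ => ?_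
    by_cases h : ω ∈ s ⁻¹' {c}
    · simp only [hZ, indicator_of_mem h]
    · simp only [hZ, indicator_of_notMem h, Complex.ofReal_zero, zero_mul]
  have hX : ∀ n, AEStronglyMeasurable (wiener hH hB (k n)) P := fun n => Lp.aestronglyMeasurable _
  have e1 : ∀ n, ∫ ω, (Y ω : ℂ) *
      Complex.exp (Complex.I * ((s ω * wiener hH hB (k n) ω : ℝ) : ℂ)) ∂P =
      ∑ c ∈ s.range, ∫ ω, (Z c ω : ℂ) *
        Complex.exp (Complex.I * ((c * wiener hH hB (k n) ω : ℝ) : ℂ)) ∂P := fun n => by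
    rw [← integral_finsetSum _ fun c _ => integrable_mul_exp (hZm c) (hZC c)
      ((hX n).const_mul c)]
    exact integral_congr_ae (.of_forall
      (key fun c ω => Complex.exp (Complex.I * ((c * wiener hH hB (k n) ω : ℝ) : ℂ))))
  have e2 : ∫ ω, (Y ω : ℂ) * (Real.exp (-(s ω ^ 2 * L / 2)) : ℂ) ∂P =
      ∑ c ∈ s.range, ∫ ω, (Z c ω : ℂ) * (Real.exp (-(c ^ 2 * L / 2)) : ℂ) ∂P := by
    rw [← integral_finsetSum _ fun c _ => ?_]
    · exact integral_congr_ae (.of_forall (key fun c _ => (Real.exp (-(c ^ 2 * L / 2)) : ℂ)))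
    · exact (Integrable.of_bound (hZm c) C (.of_forall (hZC c))).ofReal.mul_const _
  simp_rw [e1, e2]
  exact tendsto_finsetSum _ fun c _ =>
    tendsto_integral_mul_exp_const hB hgen hk hL (hZm c) (hZC c) c

/-- For a weakly null sequence `k n` of `𝔥` with `‖k n‖² → L`, the products `U X(k n)` converge
stably to a centered Gaussian mixture with conditional variance `L U²`. -/
theorem tendsto_integral_mul_exp_wiener (hB : IsFBM H B P) (hgen : GeneratedBy B P)
    {k : ℕ → Hsp H hH} {L : ℝ} (hL0 : 0 ≤ L)
    (hk : ∀ h, Tendsto (fun n => inner ℝ h (k n)) atTop (𝓝 0)) {M : ℝ} (hM : ∀ n, ‖k n‖ ≤ M)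
    (hL : Tendsto (fun n => ‖k n‖ ^ 2) atTop (𝓝 L)) {Y : Ω → ℝ} (hY : AEStronglyMeasurable Y P)
    {C : ℝ} (hC : ∀ ω, |Y ω| ≤ C) {U : Ω → ℝ} (hU : MemLp U 2 P) :
    Tendsto (fun n => ∫ ω, (Y ω : ℂ) *
      Complex.exp (Complex.I * ((U ω * wiener hH hB (k n) ω : ℝ) : ℂ)) ∂P) atTop
      (𝓝 (∫ ω, (Y ω : ℂ) * (Real.exp (-(U ω ^ 2 * L / 2)) : ℂ) ∂P)) := by
  obtain ⟨s, hlim, hs, hs0⟩ := exists_simpleFunc_tendsto_L2 hU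
  have hC0 : 0 ≤ C := by
    obtain ⟨ω⟩ := P.nonempty_of_neZero
    exact (abs_nonneg _).trans (hC ω)
  have hM0 : 0 ≤ M := (norm_nonneg _).trans (hM 0)
  have hX : ∀ n, MemLp (wiener hH hB (k n)) 2 P := fun n => Lp.memLp _
  refine TendstoUniformlyOnFilter.tendsto_of_eventually_tendsto (p := (atTop : Filter ℕ))
    (F := fun j n => ∫ ω, (Y ω : ℂ) *
      Complex.exp (Complex.I * ((s j ω * wiener hH hB (k n) ω : ℝ) : ℂ)) ∂P)
    (L := fun j => ∫ ω, (Y ω : ℂ) * (Real.exp (-(s j ω ^ 2 * L / 2)) : ℂ) ∂P) ?_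
    (.of_forall fun j => tendsto_integral_mul_exp_simple hB hgen hk hL hY hC (s j)) ?_
  · rw [Metric.tendstoUniformlyOnFilter_iff]
    intro ε hε
    have h1 : Tendsto (fun j => C * (‖(hs j).toLp _‖ * M)) atTop (𝓝 0) := by
      simpa using (hs0.mul_const M).const_mul C
    have h2 := (h1.eventually_lt_const hε).prod_inl (atTop : Filter ℕ)
    refine h2.mono fun ⟨j, n⟩ hj => lt_of_le_of_lt ?_ hj
    dsimp only at hj ⊢
    have e : (fun ω => s j ω * wiener hH hB (k n) ω - U ω * wiener hH hB (k n) ω) =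
        fun ω => (s j ω - U ω) * wiener hH hB (k n) ω := by
      funext ω
      ring
    have hint : Integrable (fun ω => s j ω * wiener hH hB (k n) ω -
        U ω * wiener hH hB (k n) ω) P := by
      rw [e]
      exact (hs j).integrable_mul (hX n)
    rw [dist_comm, dist_eq_norm]
    refine (norm_integral_exp_sub_le hY hC ((s j).aestronglyMeasurable.mul (hX n).1)
      (hU.1.mul (hX n).1) hint).trans ?_
    refine mul_le_mul_of_nonneg_left ?_ hC0
    have e' := congrArg (fun f : Ω → ℝ => ∫ ω, |f ω| ∂P) e
    refine e'.trans_le ?_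
    refine (integral_abs_mul_le_norm_mul_norm (hs j) (hX n)).trans
      (mul_le_mul_of_nonneg_left ?_ (norm_nonneg _))
    rw [Lp.toLp_coeFn, LinearIsometry.norm_map]
    exact hM n
  · have hc : Continuous fun x : ℝ => (Real.exp (-(x ^ 2 * L / 2)) : ℂ) := by fun_prop
    refine tendsto_integral_of_dominated_convergence (fun _ => C) (fun j => ?_)
      (integrable_const C) (fun j => .of_forall fun ω => ?_) (hlim.mono fun ω h => ?_)
    · exact (Complex.continuous_ofReal.comp_aestronglyMeasurable hY).mul
        (hc.comp_aestronglyMeasurable (s j).aestronglyMeasurable)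
    · rw [norm_mul, Complex.norm_real, Complex.norm_real, Real.norm_eq_abs, Real.norm_eq_abs,
        Real.abs_exp]
      refine (mul_le_of_le_one_right (abs_nonneg _) (Real.exp_le_one_iff.2 ?_)).trans (hC ω)
      have := mul_nonneg (sq_nonneg (s j ω)) hL0
      linarith
    · exact ((hc.tendsto _).comp h).const_mul _

/-- On an extension of the probability space, a random variable that is independent of the
generating process is independent of the whole original space. -/
theorem map_prodMk_eq_prod {Ω' : Type*} [MeasurableSpace Ω'] {P' : Measure Ω'}
    [IsProbabilityMeasure P'] (hB : ∀ t, Measurable (B t)) (hgen : GeneratedBy B P) {π : Ω' → Ω}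
    (hπ : MeasurePreserving π P' P) {Z : Ω' → ℝ} {ν : Measure ℝ} [IsProbabilityMeasure ν]
    (hZ : HasLaw Z ν P') (hind : IndepFun Z (fun ω' t => B t (π ω')) P') :
    P'.map (fun ω' => (π ω', Z ω')) = P.prod ν := by
  symm
  refine Measure.prod_eq fun A S hA hS => ?_
  have hm : AEMeasurable (fun ω' => (π ω', Z ω')) P' :=
    hπ.measurable.aemeasurable.prodMk hZ.aemeasurable
  rw [Measure.map_apply_of_aemeasurable hm (hA.prod hS)]
  obtain ⟨A', hA', hAA'⟩ := hgen A hA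
  obtain ⟨T, hT, rfl⟩ : ∃ T : Set (I → ℝ), MeasurableSet T ∧ (fun ω t => B t ω) ⁻¹' T = A' := by
    have e : (⨆ t, (borel ℝ).comap (B t)) =
        MeasurableSpace.comap (fun ω t => B t ω) MeasurableSpace.pi := by
      rw [MeasurableSpace.pi, MeasurableSpace.comap_iSup]
      refine iSup_congr fun t => ?_
      rw [MeasurableSpace.comap_comp, BorelSpace.measurable_eq (α := ℝ)]
      rfl
    rw [e] at hA'
    exact hA'
  have hBm : Measurable fun ω t => B t ω := measurable_pi_lambda _ hB
  have e1 : (π ⁻¹' A : Set Ω') =ᵐ[P'] π ⁻¹' ((fun ω t => B t ω) ⁻¹' T) :=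
    hπ.quasiMeasurePreserving.preimage_ae_eq hAA'
  have e2 : (fun ω' => (π ω', Z ω')) ⁻¹' A ×ˢ S = π ⁻¹' A ∩ Z ⁻¹' S := rfl
  have e3 : P' (π ⁻¹' A ∩ Z ⁻¹' S) = P' (π ⁻¹' ((fun ω t => B t ω) ⁻¹' T) ∩ Z ⁻¹' S) :=
    measure_congr (e1.inter (ae_eq_refl _))
  rw [e2, e3, inter_comm]
  have h := indepFun_iff_measure_inter_preimage_eq_mul.1 hind S T hS hT
  refine h.trans ?_
  rw [mul_comm, measure_congr hAA', ← hZ.map_eq, Measure.map_apply_of_aemeasurable hZ.aemeasurable hS]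
  congr 1
  exact hπ.measure_preimage (hBm hT).nullMeasurableSet

/-- The characteristic function of the Gaussian mixture `c U Z`, with `Z` independent of the
original probability space. -/
theorem integral_mul_exp_gaussian {Ω' : Type*} [MeasurableSpace Ω'] {P' : Measure Ω'}
    [IsProbabilityMeasure P'] {π : Ω' → Ω} {Z : Ω' → ℝ} (hm : AEMeasurable Z P')
    (hπ : MeasurePreserving π P' P)
    (hlaw : P'.map (fun ω' => (π ω', Z ω')) = P.prod (gaussianReal 0 1)) {Y : Ω → ℝ}
    (hY : AEStronglyMeasurable Y P) {C : ℝ} (hC : ∀ ω, |Y ω| ≤ C) {U : Ω → ℝ}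
    (hU : AEStronglyMeasurable U P) :
    ∫ ω', (Y (π ω') : ℂ) * Complex.exp (Complex.I * ((U (π ω') * Z ω' : ℝ) : ℂ)) ∂P' =
      ∫ ω, (Y ω : ℂ) * (Real.exp (-(U ω ^ 2 / 2)) : ℂ) ∂P := by
  have hint : Integrable (fun z : Ω × ℝ => (Y z.1 : ℂ) *
      Complex.exp (Complex.I * ((U z.1 * z.2 : ℝ) : ℂ))) (P.prod (gaussianReal 0 1)) :=
    integrable_mul_exp hY.comp_fst (fun z => hC z.1)
      (hU.comp_fst.mul measurable_snd.aestronglyMeasurable)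
  have e1 := integral_map (μ := P') (hπ.measurable.aemeasurable.prodMk hm)
    (f := fun z : Ω × ℝ => (Y z.1 : ℂ) * Complex.exp (Complex.I * ((U z.1 * z.2 : ℝ) : ℂ)))
    (by rw [hlaw]; exact hint.1)
  refine e1.symm.trans ?_
  rw [hlaw, integral_prod _ hint]
  refine integral_congr_ae (.of_forall fun ω => ?_)
  dsimp only
  rw [integral_const_mul]
  congr 1
  have e2 := charFun_gaussianReal (μ := 0) (v := 1) (U ω)
  rw [charFun_apply_real] at e2
  refine Eq.trans ?_ (e2.trans ?_)
  · refine integral_congr_ae (.of_forall fun x => ?_)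
    dsimp only
    congr 1
    push_cast
    ring
  · rw [Complex.ofReal_exp]
    congr 1
    push_cast
    ring

end

/-! ### Convergence of the Skorohod integrals -/

section

variable {H : ℝ} {hH : H ∈ Ioo (1 / 2 : ℝ) 1} {Ω : Type*} [MeasurableSpace Ω]
  {B : I → Ω → ℝ} {P : Measure Ω}

/-- A jointly measurable process in `𝔻^{1,2}`, as a curve in `L²(Ω) × L²(Ω; 𝔥)`. The function
`t ↦ ‖u_t‖_{1,2}` need not be assumed to be measurable, and neither does `t ↦ Du_t`. -/
theorem aestronglyMeasurable_toPair [IsProbabilityMeasure P] (hB : IsFBM H B P) (hgen : GeneratedBy B P) {u : I → Ω → ℝ}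
    (hum : AEStronglyMeasurable (Function.uncurry u) ((volume : Measure I).prod P))
    {Du : I → Ω → Hsp H hH} (hi : ∀ t, HasMalliavinDeriv hH B P (u t) (Du t)) :
    AEStronglyMeasurable (fun t => toPair (hi t).1 (hi t).2.1) volume := by
  refine aestronglyMeasurable_sobolev hB hgen (fun t => (hi t).mem_sobolev hB.measurable)
    fun g => ?_
  have h1 : AEStronglyMeasurable (fun t => ∫ ω, u t ω * g ω ∂P) volume :=
    (hum.mul (Lp.aestronglyMeasurable g).comp_snd).integral_prod_right'
  refine h1.aemeasurable.congr (.of_forall fun t => ?_)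
  have e : inner ℝ ((hi t).1.toLp (u t)) g = ∫ ω, u t ω * g ω ∂P := by
    rw [L2.inner_def]
    refine integral_congr_ae ((hi t).1.coeFn_toLp.mono fun ω h => ?_)
    simp [h, mul_comm]
  exact e.symm

/-- The energy of the curve `t ↦ (u_t, Du_t)` is finite when `t ↦ ‖u_t‖_{1,2}` belongs to `𝔥`. -/
theorem energy_toPair_lt_top {u : I → Ω → ℝ} {Du : I → Ω → Hsp H hH}
    (hi : ∀ t, HasMalliavinDeriv hH B P (u t) (Du t))
    (hi' : MemHsp hH fun t => norm12 P (u t) (Du t)) :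
    energy H (fun t => ‖toPair (hi t).1 (hi t).2.1‖ₑ) < ∞ := by
  have h := (hi'.represents.finiteEnergy fun t => Real.sqrt_nonneg _).2
  refine (energy_congr (.of_forall fun t => ?_)).trans_lt h
  dsimp only
  rw [← norm_toPair (hi t).1 (hi t).2.1, enorm_norm]

end

end FracBM

end

theorem theorem6 {Ω : Type*} [MeasurableSpace Ω] (P : Measure Ω) [IsProbabilityMeasure P]
    (H : ℝ) (hH : H ∈ Ioo (1 / 2 : ℝ) 1)
    -- the fractional Brownian motion, which generates the σ-field
    (B : I → Ω → ℝ) (hB : FracBM.IsFBM H B P) (hgen : FracBM.GeneratedBy B P)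
    -- the kernels
    (φ : ℕ → I → ℝ) (hφm : ∀ n, AEMeasurable (φ n)) (hφ0 : ∀ n t, 0 ≤ φ n t)
    (hφb : ∀ n, ∃ C : ℝ, ∀ t, φ n t ≤ C)
    (h3 : ∀ δ : I, δ < 1 →
      Tendsto (fun n => (⨆ t : Iic δ, φ n t) * ⨆ t : I, φ n t) atTop (𝓝 0))
    (L : ℝ) (hL : 0 < L)
    (h4 : Tendsto (fun n => ‖FracBM.toHsp hH (φ n)‖ ^ 2) atTop (𝓝 L))
    (r : ℝ) (hr0 : 0 < r) (hr : r < 1 / H)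
    (h5 : Tendsto (fun n => eLpNorm (φ n) (ENNReal.ofReal r) volume) atTop (𝓝 0))
    -- the process `u` and its Malliavin derivatives
    (u : I → Ω → ℝ)
    (hum : AEStronglyMeasurable (Function.uncurry u) ((volume : Measure I).prod P))
    (Du : I → Ω → FracBM.Hsp H hH)
    (hi : ∀ t, FracBM.HasMalliavinDeriv hH B P (u t) (Du t))
    (hi' : FracBM.MemHsp hH fun t => FracBM.norm12 P (u t) (Du t))
    (hii : Tendsto (fun t => FracBM.norm12 P (u t - u 1) (Du t - Du 1)) (𝓝 1) (𝓝 0))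
    (p : ℝ) (hp0 : 0 < p) (hp : 1 / p + 1 / r = 2 * H)
    (Du1 : I → Ω → ℝ)
    (hDu1m : AEStronglyMeasurable (Function.uncurry Du1) ((volume : Measure I).prod P))
    (hDu1 : ∀ᵐ ω ∂P, FracBM.Represents hH (fun s => Du1 s ω) (Du 1 ω))
    (hiii : ∫⁻ s : I, (∫⁻ ω, ‖Du1 s ω‖ₑ ∂P) ^ p < ∞) :
    -- the Skorohod integrals exist
    (∀ n, ∃ F : Ω → ℝ, FracBM.HasSkorohodIntegral hH B P (fun t ω => φ n t * u t ω) F) ∧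
    -- and they converge stably, whatever the extension that carries `Z`
    ∀ F : ℕ → Ω → ℝ,
      (∀ n, FracBM.HasSkorohodIntegral hH B P (fun t ω => φ n t * u t ω) (F n)) →
      ∀ {Ω' : Type*} [MeasurableSpace Ω'] (P' : Measure Ω') [IsProbabilityMeasure P']
        (π : Ω' → Ω) (Z : Ω' → ℝ), MeasurePreserving π P' P →
        HasLaw Z (gaussianReal 0 1) P' → IndepFun Z (fun ω' t => B t (π ω')) P' →
        FracBM.ConvergesStably P F P' π fun ω' => √L * u 1 (π ω') * Z ω' := by
  classical
  -- the curve `t ↦ (u_t, Du_t)`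
  set w : I → FracBM.PairSpace hH P := fun t => FracBM.toPair (hi t).1 (hi t).2.1 with hwdef
  have hw : AEStronglyMeasurable w volume := FracBM.aestronglyMeasurable_toPair hB hgen hum hi
  have hS : ∀ t, w t ∈ FracBM.sobolev hH B P := fun t => (hi t).mem_sobolev hB.measurable
  have huw : ∀ t, u t =ᵐ[P] (w t).fst := fun t => (hi t).1.coeFn_toLp.symm
  have hfin : FracBM.energy H (fun t => ‖w t‖ₑ) < ∞ := FracBM.energy_toPair_lt_top hi hi'
  have hφC : ∀ n, ∃ C : ℝ, ∀ t, |φ n t| ≤ C := fun n =>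
    (hφb n).imp fun C hC t => (abs_of_nonneg (hφ0 n t)).trans_le (hC t)
  refine ⟨fun n => ?_, ?_⟩
  · obtain ⟨C, hC⟩ := hφC n
    obtain ⟨h1, hV, h2⟩ := FracBM.divBound_kernel_mul hB hgen (hφm n) hC hum hw hS huw hfin
    obtain ⟨F, hF⟩ := h2.exists_hasDivergence hB hgen hV
    exact ⟨F, h1.mono fun ω h => h.memHsp, hF⟩
  intro F hF Ω' _ P' _ π Z hπ hZ hind lam Y hY ⟨C, hC⟩
  have hφE : ∀ n, FracBM.FiniteEnergy H (φ n) := fun n => by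
    obtain ⟨C, hC⟩ := hφC n
    exact FracBM.finiteEnergy_of_bounded hH (hφm n).aestronglyMeasurable (.of_forall hC)
  obtain ⟨M, hM⟩ := h4.bddAbove_range
  have hM2 : ∀ n, ‖FracBM.toHsp hH (φ n)‖ ^ 2 ≤ M := fun n => hM ⟨n, rfl⟩
  have hM1 : ∀ n, ‖FracBM.toHsp hH (φ n)‖ ≤ √M := fun n => Real.le_sqrt_of_sq_le (hM2 n)
  have hME : ∀ n, FracBM.energy H (fun t => ‖φ n t‖ₑ) ≤ ENNReal.ofReal M := fun n =>
    ((hφE n).energy_le_of_nonneg (hH := hH) (hφ0 n)).trans (ENNReal.ofReal_le_ofReal (hM2 n))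
  have hweak : ∀ h, Tendsto (fun n => inner ℝ h (FracBM.toHsp hH (φ n))) atTop (𝓝 0) :=
    FracBM.tendsto_inner_toHsp_kernel hφE hM1
      (FracBM.tendsto_lintegral_kernel hH hφm hφ0 hφb h3 hME)
  have hdfin : FracBM.energy H (fun t => ‖w t - w 1‖ₑ) < ∞ := by
    refine (FracBM.energy_mono (.of_forall fun t => enorm_sub_le)).trans_lt
      ((FracBM.energy_add_le hw.enorm).trans_lt ?_)
    have := FracBM.energy_lt_top_of_le hH (f := fun _ => ‖w 1‖ₑ) (enorm_ne_top (x := w 1))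
      (.of_forall fun _ => le_rfl)
    exact ENNReal.mul_lt_top (by simp) (ENNReal.add_lt_top.2 ⟨hfin, this⟩)
  have hd1 : Tendsto (fun t => ‖w t - w 1‖ₑ) (𝓝 1) (𝓝 0) := by
    have e : ∀ t, ‖w t - w 1‖ = FracBM.norm12 P (u t - u 1) (Du t - Du 1) := fun t => by
      rw [← FracBM.norm_toPair ((hi t).1.sub (hi 1).1) ((hi t).2.1.sub (hi 1).2.1)]
      rfl
    have h1 : Tendsto (fun t => ‖w t - w 1‖) (𝓝 1) (𝓝 0) := hii.congr fun t => (e t).symm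
    have h2 := ENNReal.tendsto_ofReal h1
    rw [ENNReal.ofReal_zero] at h2
    exact h2.congr fun t => ofReal_norm _
  have hlim := FracBM.tendsto_energy_kernel_mul hφm hφ0 hφb h3 hME
    (hw.sub aestronglyMeasurable_const).enorm hdfin hd1
  have hL1 := FracBM.tendsto_integral_abs_skorohod_sub hB hgen hφm hφC hM1 hweak hum hw hS huw
    hdfin hlim hF
  have hY' : AEStronglyMeasurable Y P := hY.aestronglyMeasurable
  have hX : ∀ n, MemLp (FracBM.wiener hH hB (FracBM.toHsp hH (φ n))) 2 P := fun n => Lp.memLp _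
  have hint : ∀ n, Integrable (fun ω => F n ω -
      u 1 ω * FracBM.wiener hH hB (FracBM.toHsp hH (φ n)) ω) P := fun n =>
    ((hF n).2.2.1.integrable (by norm_num)).sub ((hi 1).1.integrable_mul (hX n))
  have hmain := FracBM.tendsto_integral_mul_exp_wiener hB hgen hL.le hweak hM1 h4 hY' hC
    ((hi 1).1.const_mul lam)
  have hlaw := FracBM.map_prodMk_eq_prod hB.measurable hgen hπ hZ hind
  have hgauss := FracBM.integral_mul_exp_gaussian hZ.aemeasurable hπ hlaw hY' hC
    ((hi 1).1.1.const_mul (lam * √L))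
  have e1 : ∫ ω', (Y (π ω') : ℂ) *
      Complex.exp (Complex.I * (lam * (√L * u 1 (π ω') * Z ω') : ℝ)) ∂P' =
      ∫ ω, (Y ω : ℂ) * (Real.exp (-((lam * u 1 ω) ^ 2 * L / 2)) : ℂ) ∂P := by
    refine Eq.trans ?_ (hgauss.trans ?_)
    · simp only [mul_assoc]
    · simp only [mul_pow, Real.sq_sqrt hL.le]
      refine integral_congr_ae (.of_forall fun ω => ?_)
      dsimp only
      congr 4
      ring
  rw [e1]
  have hdiff : Tendsto (fun n =>
      (∫ ω, (Y ω : ℂ) * Complex.exp (Complex.I * (lam * F n ω : ℝ)) ∂P) -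
      ∫ ω, (Y ω : ℂ) * Complex.exp (Complex.I *
        ((lam * u 1 ω * FracBM.wiener hH hB (FracBM.toHsp hH (φ n)) ω : ℝ) : ℂ)) ∂P) atTop
      (𝓝 0) := by
    have h1 : Tendsto (fun n => C * (|lam| * ∫ ω, |F n ω -
        u 1 ω * FracBM.wiener hH hB (FracBM.toHsp hH (φ n)) ω| ∂P)) atTop (𝓝 0) := by
      simpa using (hL1.const_mul |lam|).const_mul C
    refine squeeze_zero_norm (fun n => ?_) h1
    have e2 : ∀ ω, lam * F n ω - lam * u 1 ω * FracBM.wiener hH hB (FracBM.toHsp hH (φ n)) ω =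
        lam * (F n ω - u 1 ω * FracBM.wiener hH hB (FracBM.toHsp hH (φ n)) ω) := fun ω => by ring
    have h2 := FracBM.norm_integral_exp_sub_le hY' hC (F := fun ω => lam * F n ω)
      (G := fun ω => lam * u 1 ω * FracBM.wiener hH hB (FracBM.toHsp hH (φ n)) ω)
      ((hF n).2.2.1.1.const_mul lam) (((hi 1).1.1.const_mul lam).mul (hX n).1)
      (by simp_rw [e2]; exact (hint n).const_mul lam)
    simp_rw [e2, abs_mul] at h2
    rwa [integral_const_mul] at h2
  have := hdiff.add hmain
  rw [zero_add] at this
  exact this.congr fun n => sub_add_cancel _ _
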